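/- **Setting.** Let $\Omega\subset\mathbb R^2$ be a bounded domain, $T>0$, $m\in\mathbb N$, and let $u=(u_1,\dots,u_m)$, $u_i\in L^2(0,T;H^1_0(\Omega))\cap C([0,T];L^\infty(\Omega))$, $\partial_tu_i\in L^2(0,T;H^{-1}(\Omega))$, be a weak solution, with $u_i(0)=u_i^0$, of $$\partial_t u_i-\nabla\cdot(\xi_i\nabla u_i)+\omega\cdot\nabla u_i+u_i\sum_{j}\mathsf A(i,j)u_j+\sum_{\ell\ne i,\,j\neq i}\mathsf Q(i,\ell,j)u_\ell u_j+\sum_{j}\mathsf R(i,j)u_j=f_i ,$$ where the diffusion term is understood as $(\xi_i\nabla u_i,\nabla v_i)_0$, $\xi_i>0$ is bounded, $\omega\in[L^2(0,T;H^1(\Omega)\cap L^\infty(\Omega))]^2$ is divergence free, $\mathsf A,\mathsf Q,\mathsf R$ are bounded and $f_i\in L^2(0,T;L^2(\Omega))$. Let $1\le s\le p$ be integers and assume that $\sup_{t\in[0,T]}\|u_i(t)\|_{H^{s+1}(\Omega)}<\infty$ (each $u_i(t)$ being represented by a function continuous on $\overline\Omega$) and $\|u_i(t)\|_\infty\le\mu$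 for all $i$ and all $t\in[0,T]$, with some $\mu>0$. Let $\mathcal T_h$ be conforming partitions of $\Omega$ into polygonal elements, $h=\max_E h_E$ with $h_E$ the diameter of $E$, such that, for constants $\delta,c,\sigma>0$ independent of $h$, every element $E$ is star-shaped with respect to a disc of radius $\delta h_E$, every edge of $E$ has length at least $c\,h_E$, and $h_E\ge\sigma h$. Let $V_h^p\subset H_0^1(\Omega)$ be the virtual element space of the functions whose restriction to each $E$ lies in $$V_E^p=\{v\in H^1(E)\cap C^0(\partial E): v|_e\in\mathbb P_p(e)\ \forall e,\ \Delta v\in\mathbb P_p(E),\ (v-\mathcal P_p^\nabla v,q)_E=0\ \ \forall q\in\mathbb P_p(E),\ q\perp_{L^2(E)}\mathbb P_{p-2}(E)\},$$ where $\mathcal P_p^\nabla v\in\mathbb P_p(E)$ is determined by $(\nabla(v-\mathcal P_p^\nabla v),\nabla q)_E=0$ for all $q\in\mathbb P_p(E)$ and $\int_{\partial E}(\mathcal P_p^\nabla v-v)\,ds=0$. Let $\delta t=T/N$, $t_n=n\,\delta t$, and let $U^0,\dots,U^N\in[V_h^p]^m$ satisfy that $U_i^0$ is the interpolant of $u_i^0$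 and that, for $1\le n\le N$ and all $V\in[V_h^p]^m$, $$\begin{aligned}\sum_{i}\Big\{&m_h(U_i^n-U_i^{n-1},V_i)+\delta t\,a_h(U_i^n,V_i)+\delta t\big(\omega\cdot\boldsymbol{\mathcal P}\nabla U_i^n,\mathcal PV_i\big)_0+\delta t\Big(\mathcal PU_i^n\sum_j\mathsf A(i,j)\mathcal PL_j,\mathcal PV_i\Big)_0\\&+\delta t\Big(\sum_{\ell,j\ne i}\mathsf Q(i,\ell,j)\mathcal PL_\ell\,\mathcal PL_j,\mathcal PV_i\Big)_0+\delta t\Big(\mathsf R(i,i)\mathcal PU_i^n+\sum_{j\ne i}\mathsf R(i,j)\mathcal PL_j,\mathcal PV_i\Big)_0\Big\}=\delta t\sum_i(f_i^n,\mathcal PV_i)_0,\end{aligned}$$ with coefficients taken at $t_n$, where either $L=U^n$ for all $n$ (nonlinear backward Euler scheme) or $L=U^{n-1}$ for all $n$ (linearized scheme). Here $\mathcal P$ is the elementwise $L^2$ projection onto $\mathbb P_p$, $\boldsymbol{\mathcal P}$ is the elementwise $L^2$ projection onto $[\mathbb P_{p-1}]^2$, $$m_h(v,w)=\sum_E\big\{(\mathcal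 Pv,\mathcal Pw)_E+S_1^E(v-\mathcal Pv,w-\mathcal Pw)\big\},$$ $$a_h(v,w)=\sum_E\big\{(\xi_i\boldsymbol{\mathcal P}\nabla v,\boldsymbol{\mathcal P}\nabla w)_E+\sup_E|\xi_i(t_n,\cdot)|\;S_2^E(v-\mathcal P_p^\nabla v,w-\mathcal P_p^\nabla w)\big\},$$ and $S_1^E,S_2^E$ are symmetric bilinear forms on $V_E^p$ such that $\alpha_*\|v\|_{0,E}^2\le S_1^E(v,v)\le\alpha^*\|v\|_{0,E}^2$ if $\mathcal Pv=0$, and $\beta_*\|\nabla v\|_{0,E}^2\le S_2^E(v,v)\le\beta^*\|\nabla v\|_{0,E}^2$ if $\mathcal P_p^\nabla v=0$, with constants $0<\alpha_*\le\alpha^*$, $0<\beta_*\le\beta^*$. The interpolant of a continuous $w$ is the $W\in V_h^p$ having the same values as $w$ at the vertices and the Gauss–Lobatto nodes of all edges (the $p-1$ interior nodes and the end points) and the same moments $(\cdot,q)_E$, $q\in\mathbb P_{p-2}(E)$. **Lemma.** For every constant $C_0$ there are constants $C,h_0,\rho>0$, independent of the mesh, of $N$, of $n$ and of the discrete solution,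 with the following property. Let $0\le n\le N$, let $\mathcal U_i^n$ be the interpolant of $u_i(t_n)$, put $\chi_i^n=\mathcal U_i^n-U_i^n$, and suppose that the error bound $$\sum_{i=1}^m\|\chi_i^n\|_0^2\le C_0\big(h^{2s}+(\delta t)^2\big)$$ holds. Then, for $i=1,\dots,m$, $$\|U_i^n\|_\infty\le\mu+C\big(h^s+h^{s-1}+h^{-1}\,\delta t\big).$$ Consequently, if $s\ge2$, $h\le h_0$ and $\delta t\le\rho\,h$, then $\|U_i^n\|_\infty\le\mu+1$ for $i=1,\dots,m$. -/

import Mathlib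

open MeasureTheory Set
open scoped ENNReal NNReal ContDiff

noncomputable section

namespace VEM

/-- The plane with its Euclidean norm. -/
abbrev E2 : Type := EuclideanSpace ℝ (Fin 2)

/-! ### Weak derivatives and Sobolev spaces -/

/-- Classical partial derivative in the `j`-th coordinate. -/
def pd (j : Fin 2) (φ : E2 → ℝ) : E2 → ℝ :=
  fun x => fderiv ℝ φ x (EuclideanSpace.single j 1)

/-- Classical mixed partial derivative of order `(a, b)`. -/
def pdMulti (a b : ℕ) (φ : E2 → ℝ) : E2 → ℝ := (pd 0)^[a] ((pd 1)^[b] φ)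

/-- Test functions: smooth functions with compact support inside `G`. -/
def IsTest (G : Set E2) (φ : E2 → ℝ) : Prop :=
  ContDiff ℝ ∞ φ ∧ HasCompactSupport φ ∧ tsupport φ ⊆ G

/-- `g ∈ L²(G)` is the weak derivative of order `(a, b)` of `f` on the open set `G`. -/
def IsWeakDeriv (G : Set E2) (a b : ℕ) (f g : E2 → ℝ) : Prop :=
  MemLp g 2 (volume.restrict G) ∧
    ∀ φ, IsTest G φ →
      ∫ x in G, f x * pdMulti a b φ x = (-1) ^ (a + b) * ∫ x in G, g x * φ x

/-- `f ∈ H^k(G)`. -/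
def MemH (G : Set E2) (k : ℕ) (f : E2 → ℝ) : Prop :=
  MemLp f 2 (volume.restrict G) ∧ ∀ a b : ℕ, a + b ≤ k → ∃ g, IsWeakDeriv G a b f g

open Classical in
/-- The weak derivative of order `(a, b)` of `f` on `G` (zero if there is none in `L²(G)`). -/
def weakD (G : Set E2) (a b : ℕ) (f : E2 → ℝ) : E2 → ℝ :=
  if h : ∃ g, IsWeakDeriv G a b f g then h.choose else 0

/-- The components of the weak gradient on `G`. -/
def weakPartial (G : Set E2) (j : Fin 2) (f : E2 → ℝ) : E2 → ℝ :=
  if j = 0 then weakD G 1 0 f else weakD G 0 1 f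

open Classical in
/-- The `H^k(G)` norm, infinite outside `H^k(G)`. -/
def sobolevNorm (G : Set E2) (k : ℕ) (f : E2 → ℝ) : ℝ≥0∞ :=
  if MemH G k f then
    (∑ a ∈ Finset.range (k + 1), ∑ b ∈ Finset.range (k + 1 - a),
      eLpNorm (weakD G a b f) 2 (volume.restrict G) ^ 2) ^ (1 / 2 : ℝ)
  else ⊤

/-- `f ∈ H^1_0(G)`: the closure of the test functions in `H^1(G)`. -/
def MemH01 (G : Set E2) (f : E2 → ℝ) : Prop :=
  MemH G 1 f ∧ ∀ ε : ℝ≥0∞, 0 < ε → ∃ φ, IsTest G φ ∧ sobolevNorm G 1 (f - φ) < ε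

/-! ### Polygonal elements and meshes -/

/-- A simple polygon with vertices `vertex 0, …, vertex (n + 2)` in cyclic order; two consecutive
edges may be collinear. The open set `carrier` is the region enclosed by the polygon: a non-empty
bounded open set whose boundary is the polygonal line is the inside of that Jordan curve. -/
structure PolygonalElement where
  n : ℕ
  vertex : Fin (n + 3) → E2
  carrier : Set E2
  vertex_injective : Function.Injective vertex
  edges_adjacent : ∀ i, segment ℝ (vertex i) (vertex (i + 1)) ∩
    segment ℝ (vertex (i + 1)) (vertex (i + 1 + 1)) = {vertex (i + 1)}
  edges_disjoint : ∀ i j, j ≠ i → j ≠ i + 1 → i ≠ j + 1 →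
    Disjoint (segment ℝ (vertex i) (vertex (i + 1))) (segment ℝ (vertex j) (vertex (j + 1)))
  isOpen_carrier : IsOpen carrier
  nonempty_carrier : carrier.Nonempty
  isBounded_carrier : Bornology.IsBounded carrier
  frontier_carrier : frontier carrier = ⋃ i, segment ℝ (vertex i) (vertex (i + 1))

namespace PolygonalElement

variable (E : PolygonalElement)

/-- The `i`-th closed edge. -/
def edge (i : Fin (E.n + 3)) : Set E2 := segment ℝ (E.vertex i) (E.vertex (i + 1))

/-- The point with parameter `t ∈ [0, 1]` on the `i`-th edge. -/
def edgePoint (i : Fin (E.n + 3)) (t : ℝ) : E2 :=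
  AffineMap.lineMap (E.vertex i) (E.vertex (i + 1)) t

/-- Length of the `i`-th edge. -/
def edgeLength (i : Fin (E.n + 3)) : ℝ := dist (E.vertex i) (E.vertex (i + 1))

/-- The diameter of the element. -/
def diam : ℝ := Metric.diam E.carrier

/-- Integral over the boundary with respect to arc length. -/
def boundaryIntegral (v : E2 → ℝ) : ℝ :=
  ∑ i, E.edgeLength i * ∫ t in (0 : ℝ)..1, v (E.edgePoint i t)

end PolygonalElement

/-- A conforming partition of `Ω` into finitely many polygonal elements. A node of a neighbour in
the interior of a side of `E` counts as a vertex of `E`. -/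
structure PolyMesh (Ω : Set E2) where
  card : ℕ
  elem : Fin card → PolygonalElement
  elem_subset : ∀ K, (elem K).carrier ⊆ Ω
  elem_disjoint : ∀ K L, K ≠ L → Disjoint (elem K).carrier (elem L).carrier
  cover : Ω ⊆ ⋃ K, closure (elem K).carrier
  conforming : ∀ K i, (∃ L j, L ≠ K ∧ (elem K).edge i = (elem L).edge j) ∨
    (elem K).edge i ⊆ frontier Ω

namespace PolyMesh

variable {Ω : Set E2} (M : PolyMesh Ω)

/-- The mesh size: the largest element diameter. -/
def size : ℝ := ⨆ K, (M.elem K).diam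

/-- Every element `E` is star-shaped with respect to a disc of radius `δ h_E`, and each of its
edges has length at least `c h_E`. -/
def ShapeRegular (δ c : ℝ) : Prop :=
  ∀ K, (∃ y : E2, ∀ z ∈ Metric.ball y (δ * (M.elem K).diam), StarConvex ℝ z (M.elem K).carrier) ∧
    ∀ i, c * (M.elem K).diam ≤ (M.elem K).edgeLength i

/-- All element diameters are comparable with the mesh size. -/
def QuasiUniform (σ : ℝ) : Prop := ∀ K, σ * M.size ≤ (M.elem K).diam

end PolyMesh

/-! ### Polynomials and projections on an element -/

/-- The function on the plane given by a polynomial in two variables. -/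
def polyFun (q : MvPolynomial (Fin 2) ℝ) : E2 → ℝ := fun x => MvPolynomial.eval (fun j => x j) q

open Classical in
/-- The polynomial function singled out by `P` (zero if no polynomial satisfies `P`); it is used
only for conditions that at most one polynomial satisfies. -/
def thePoly (P : MvPolynomial (Fin 2) ℝ → Prop) : E2 → ℝ :=
  if h : ∃ q, P q then polyFun h.choose else 0

/-- The `L²(E)`-orthogonal projection onto polynomials of degree at most `k`. -/
def l2Proj (E : PolygonalElement) (k : ℕ) (f : E2 → ℝ) : E2 → ℝ :=
  thePoly fun q => q.totalDegree ≤ k ∧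
    ∀ r : MvPolynomial (Fin 2) ℝ, r.totalDegree ≤ k →
      ∫ x in E.carrier, (f x - polyFun q x) * polyFun r x = 0

/-- The gradient projection of `f ∈ H¹(E)` onto polynomials of degree at most `k`. -/
def gradProj (E : PolygonalElement) (k : ℕ) (f : E2 → ℝ) : E2 → ℝ :=
  thePoly fun q => q.totalDegree ≤ k ∧
    (∀ r : MvPolynomial (Fin 2) ℝ, r.totalDegree ≤ k →
      ∫ x in E.carrier, ∑ j : Fin 2,
        (weakPartial E.carrier j f x - polyFun (MvPolynomial.pderiv j q) x) *
          polyFun (MvPolynomial.pderiv j r) x = 0) ∧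
    E.boundaryIntegral (fun x => polyFun q x - f x) = 0

/-! ### Virtual element spaces -/

/-- The local space `W_E^p`. Functions are represented by their versions that are continuous up to
the boundary of `E`, so that the trace on the boundary is the restriction. -/
def MemW (E : PolygonalElement) (p : ℕ) (v : E2 → ℝ) : Prop :=
  MemH E.carrier 1 v ∧ ContinuousOn v (closure E.carrier) ∧
    (∀ i, ∃ q : Polynomial ℝ, q.natDegree ≤ p ∧ ∀ t ∈ Icc (0 : ℝ) 1, v (E.edgePoint i t) = q.eval t) ∧
    ∃ q : MvPolynomial (Fin 2) ℝ, q.totalDegree ≤ p ∧ ∀ φ, IsTest E.carrier φ →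
      ∫ x in E.carrier, v x * (pdMulti 2 0 φ x + pdMulti 0 2 φ x) =
        ∫ x in E.carrier, polyFun q x * φ x

/-- The local virtual element space `V_E^p`: the functions `v ∈ W_E^p` such that `v - Π^∇ v` is
orthogonal to the polynomials of degree at most `p` that are `L²(E)`-orthogonal to those of
degree at most `p - 2`. -/
def MemVLoc (E : PolygonalElement) (p : ℕ) (v : E2 → ℝ) : Prop :=
  MemW E p v ∧ ∀ q : MvPolynomial (Fin 2) ℝ, q.totalDegree ≤ p →
    (∀ r : MvPolynomial (Fin 2) ℝ, r.totalDegree + 2 ≤ p →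
      ∫ x in E.carrier, polyFun q x * polyFun r x = 0) →
    ∫ x in E.carrier, (v x - gradProj E p v x) * polyFun q x = 0

/-- The global virtual element space `V_h^p`. -/
def MemV {Ω : Set E2} (M : PolyMesh Ω) (p : ℕ) (v : E2 → ℝ) : Prop :=
  MemH01 Ω v ∧ ∀ K, MemVLoc (M.elem K) p v

/-- Parameters in `[0, 1]` of the `p + 1` Gauss–Lobatto nodes of an edge: the end points and the
zeros of the derivative of the Legendre polynomial of degree `p` of the interval. -/
def IsLobatto (p : ℕ) (t : ℝ) : Prop :=
  t = 0 ∨ t = 1 ∨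
    (Polynomial.derivative ((Polynomial.shiftedLegendre p).map (Int.castRingHom ℝ))).IsRoot t

/-- `W ∈ V_h^p` is the interpolant of `w`: it has the same values at the vertices and at the
Gauss–Lobatto nodes of all edges, and the same moments of order up to `p - 2` in all elements. -/
def IsInterpolant {Ω : Set E2} (M : PolyMesh Ω) (p : ℕ) (w W : E2 → ℝ) : Prop :=
  MemV M p W ∧
    (∀ K i t, IsLobatto p t → W ((M.elem K).edgePoint i t) = w ((M.elem K).edgePoint i t)) ∧
    ∀ K, ∀ r : MvPolynomial (Fin 2) ℝ, r.totalDegree + 2 ≤ p →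
      ∫ x in (M.elem K).carrier, W x * polyFun r x = ∫ x in (M.elem K).carrier, w x * polyFun r x

/-! ### The convection-diffusion-reaction system -/

/-- The data of the system; the arguments of the coefficients are time and position. -/
structure Coeffs (m : ℕ) where
  ξ : Fin m → ℝ → E2 → ℝ
  conv : Fin 2 → ℝ → E2 → ℝ
  A : Fin m → Fin m → ℝ → E2 → ℝ
  Q : Fin m → Fin m → Fin m → ℝ → E2 → ℝ
  R : Fin m → Fin m → ℝ → E2 → ℝ
  f : Fin m → ℝ → E2 → ℝ
  u₀ : Fin m → E2 → ℝ

/-- Standing assumptions on the data: bounded positive diffusion, divergence-free convection in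
`L²(0,T; H¹ ∩ L^∞)`, bounded kinetic coefficients, sources in `L²(0,T; L²)`. -/
structure Coeffs.Admissible {m : ℕ} (D : Coeffs m) (Ω : Set E2) (T : ℝ) : Prop where
  ξ_meas : ∀ i, Measurable (Function.uncurry (D.ξ i))
  conv_meas : ∀ k, Measurable (Function.uncurry (D.conv k))
  A_meas : ∀ i j, Measurable (Function.uncurry (D.A i j))
  Q_meas : ∀ i l j, Measurable (Function.uncurry (D.Q i l j))
  R_meas : ∀ i j, Measurable (Function.uncurry (D.R i j))
  f_meas : ∀ i, Measurable (Function.uncurry (D.f i))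
  ξ_pos : ∀ i, ∀ t ∈ Icc 0 T, ∀ x ∈ Ω, 0 < D.ξ i t x
  bounded : ∃ B : ℝ, ∀ t ∈ Icc 0 T, ∀ x ∈ Ω, ∀ i j l,
    D.ξ i t x ≤ B ∧ |D.A i j t x| ≤ B ∧ |D.Q i l j t x| ≤ B ∧ |D.R i j t x| ≤ B
  conv_mem : ∀ k, ∀ t ∈ Icc 0 T, MemH Ω 1 (D.conv k t) ∧ MemLp (D.conv k t) ∞ (volume.restrict Ω)
  conv_sq : ∀ k, ∫⁻ t in Icc 0 T, (sobolevNorm Ω 1 (D.conv k t) ^ 2 +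
    eLpNorm (D.conv k t) ∞ (volume.restrict Ω) ^ 2) < ⊤
  conv_div : ∀ᵐ t ∂volume.restrict (Icc 0 T), ∀ᵐ x ∂volume.restrict Ω,
    weakPartial Ω 0 (D.conv 0 t) x + weakPartial Ω 1 (D.conv 1 t) x = 0
  f_mem : ∀ i, ∀ t ∈ Icc 0 T, MemLp (D.f i t) 2 (volume.restrict Ω)
  f_sq : ∀ i, ∫⁻ t in Icc 0 T, eLpNorm (D.f i t) 2 (volume.restrict Ω) ^ 2 < ⊤

/-- `u` solves the variational formulation with `u_i ∈ L²(0,T; H¹₀) ∩ C([0,T]; L^∞)`. The functional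
`ut i t` is the value at time `t` of `∂u_i/∂t ∈ L²(0,T; H⁻¹)`. -/
def IsWeakSolution {m : ℕ} (D : Coeffs m) (Ω : Set E2) (T : ℝ) (u : Fin m → ℝ → E2 → ℝ) : Prop :=
  (∀ i, AEStronglyMeasurable (Function.uncurry (u i))
    ((volume.restrict (Icc 0 T)).prod (volume.restrict Ω))) ∧
  (∀ i, ∀ t ∈ Icc 0 T, MemH01 Ω (u i t)) ∧
  (∀ i, ∫⁻ t in Icc 0 T, sobolevNorm Ω 1 (u i t) ^ 2 < ⊤) ∧
  (∀ i, ∀ t ∈ Icc 0 T, MemLp (u i t) ∞ (volume.restrict Ω)) ∧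
  (∀ i, ∀ t ∈ Icc 0 T, Filter.Tendsto
    (fun r => eLpNorm (u i r - u i t) ∞ (volume.restrict Ω)) (nhdsWithin t (Icc 0 T)) (nhds 0)) ∧
  (∀ i, ∀ x ∈ closure Ω, u i 0 x = D.u₀ i x) ∧
  ∃ ut : Fin m → ℝ → (E2 → ℝ) →ₗ[ℝ] ℝ,
    (∀ i v, MemH01 Ω v →
      AEStronglyMeasurable (fun t => ut i t v) (volume.restrict (Icc 0 T))) ∧
    (∀ i, ∃ G : ℝ → ℝ, MemLp G 2 (volume.restrict (Icc 0 T)) ∧ ∀ t ∈ Icc 0 T, ∀ v, MemH01 Ω v →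
      |ut i t v| ≤ G t * (sobolevNorm Ω 1 v).toReal) ∧
    (∀ i v, MemH01 Ω v → ∀ φ : ℝ → ℝ, ContDiff ℝ ∞ φ → HasCompactSupport φ →
      tsupport φ ⊆ Ioo 0 T →
      ∫ t in Icc 0 T, (∫ x in Ω, u i t x * v x) * deriv φ t =
        - ∫ t in Icc 0 T, ut i t v * φ t) ∧
    ∀ v : Fin m → E2 → ℝ, (∀ i, MemH01 Ω (v i)) → ∀ᵐ t ∂volume.restrict (Icc 0 T),
      ∑ i, (ut i t (v i)
        + (∫ x in Ω, D.ξ i t x * ∑ k, weakPartial Ω k (u i t) x * weakPartial Ω k (v i) x)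
        + (∫ x in Ω, (∑ k, D.conv k t x * weakPartial Ω k (u i t) x) * v i x)
        + (∫ x in Ω, u i t x * (∑ j, D.A i j t x * u j t x) * v i x)
        + (∫ x in Ω, (∑ l ∈ Finset.univ.erase i, ∑ j ∈ Finset.univ.erase i,
            D.Q i l j t x * u l t x * u j t x) * v i x)
        + (∫ x in Ω, (∑ j, D.R i j t x * u j t x) * v i x))
      = ∑ i, ∫ x in Ω, D.f i t x * v i x

/-! ### The virtual element schemes -/

/-- The local stabilising bilinear forms. They are only ever used on `V_E^p`; every bilinear form
on that space is the restriction of one on the space of all functions. -/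
structure Stabilization {Ω : Set E2} (M : PolyMesh Ω) where
  S₁ : Fin M.card → LinearMap.BilinForm ℝ (E2 → ℝ)
  S₂ : Fin M.card → LinearMap.BilinForm ℝ (E2 → ℝ)

/-- Symmetry and stability of the stabilising forms on the kernels of the projections. -/
def Stabilization.Admissible {Ω : Set E2} {M : PolyMesh Ω} (S : Stabilization M) (p : ℕ)
    (α₁ α₂ β₁ β₂ : ℝ) : Prop :=
  ∀ K,
    (∀ v w, MemVLoc (M.elem K) p v → MemVLoc (M.elem K) p w →
      S.S₁ K v w = S.S₁ K w v ∧ S.S₂ K v w = S.S₂ K w v) ∧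
    (∀ v, MemVLoc (M.elem K) p v →
      (∀ r : MvPolynomial (Fin 2) ℝ, r.totalDegree ≤ p →
        ∫ x in (M.elem K).carrier, v x * polyFun r x = 0) →
      α₁ * (∫ x in (M.elem K).carrier, v x ^ 2) ≤ S.S₁ K v v ∧
        S.S₁ K v v ≤ α₂ * ∫ x in (M.elem K).carrier, v x ^ 2) ∧
    (∀ v, MemVLoc (M.elem K) p v →
      (∀ r : MvPolynomial (Fin 2) ℝ, r.totalDegree ≤ p →
        ∫ x in (M.elem K).carrier, ∑ j : Fin 2,
          weakPartial (M.elem K).carrier j v x * polyFun (MvPolynomial.pderiv j r) x = 0) →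
      (M.elem K).boundaryIntegral v = 0 →
      β₁ * (∫ x in (M.elem K).carrier, ∑ j : Fin 2, weakPartial (M.elem K).carrier j v x ^ 2)
          ≤ S.S₂ K v v ∧
        S.S₂ K v v ≤
          β₂ * ∫ x in (M.elem K).carrier, ∑ j : Fin 2, weakPartial (M.elem K).carrier j v x ^ 2)

section Scheme

variable {Ω : Set E2} (M : PolyMesh Ω) (p : ℕ) (S : Stabilization M)

/-- The projection `𝒫` on the element `K`. -/
def proj (K : Fin M.card) (v : E2 → ℝ) : E2 → ℝ := l2Proj (M.elem K) p v

/-- The `k`-th component of the projected gradient `𝒫∇v` on the element `K`. -/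
def projGrad (K : Fin M.card) (k : Fin 2) (v : E2 → ℝ) : E2 → ℝ :=
  l2Proj (M.elem K) (p - 1) (weakPartial (M.elem K).carrier k v)

/-- The discrete mass form `m_h`. -/
def massForm (v w : E2 → ℝ) : ℝ :=
  ∑ K, ((∫ x in (M.elem K).carrier, proj M p K v x * proj M p K w x) +
    S.S₁ K (v - proj M p K v) (w - proj M p K w))

/-- The discrete stiffness form `a_h` with the diffusion coefficient `ξ`. -/
def stiffForm (ξ : E2 → ℝ) (v w : E2 → ℝ) : ℝ :=
  ∑ K, ((∫ x in (M.elem K).carrier, ξ x * ∑ k, projGrad M p K k v x * projGrad M p K k w x) +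
    sSup ((fun x => |ξ x|) '' (M.elem K).carrier) *
      S.S₂ K (v - gradProj (M.elem K) p v) (w - gradProj (M.elem K) p w))

variable {m : ℕ} (D : Coeffs m)

/-- One step of size `dt` of the discrete scheme, from `Uold` to `U` at the new time `t`; in the
nonlinear terms and in the coupling through `R` the factor `L` takes the place of `U`. -/
def SchemeStep (dt t : ℝ) (Uold U L : Fin m → E2 → ℝ) : Prop :=
  ∀ V : Fin m → E2 → ℝ, (∀ i, MemV M p (V i)) →
    ∑ i, (massForm M p S (U i - Uold i) (V i)
      + dt * stiffForm M p S (D.ξ i t) (U i) (V i)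
      + dt * (∑ K, ∫ x in (M.elem K).carrier,
          (∑ k, D.conv k t x * projGrad M p K k (U i) x) * proj M p K (V i) x)
      + dt * (∑ K, ∫ x in (M.elem K).carrier,
          proj M p K (U i) x * (∑ j, D.A i j t x * proj M p K (L j) x) * proj M p K (V i) x)
      + dt * (∑ K, ∫ x in (M.elem K).carrier,
          (∑ l ∈ Finset.univ.erase i, ∑ j ∈ Finset.univ.erase i,
            D.Q i l j t x * proj M p K (L l) x * proj M p K (L j) x) * proj M p K (V i) x)
      + dt * (∑ K, ∫ x in (M.elem K).carrier,
          (D.R i i t x * proj M p K (U i) x +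
            ∑ j ∈ Finset.univ.erase i, D.R i j t x * proj M p K (L j) x) * proj M p K (V i) x))
    = dt * ∑ i, ∑ K, ∫ x in (M.elem K).carrier, D.f i t x * proj M p K (V i) x

/-- `U 0, …, U N` solve the nonlinear backward Euler scheme on `[0, T]` with `N` time steps. -/
def IsNonlinearSolution (T : ℝ) (N : ℕ) (U : ℕ → Fin m → E2 → ℝ) : Prop :=
  (∀ n ≤ N, ∀ i, MemV M p (U n i)) ∧ (∀ i, IsInterpolant M p (D.u₀ i) (U 0 i)) ∧
    ∀ n < N, SchemeStep M p S D (T / N) ((n + 1 : ℕ) * (T / N)) (U n) (U (n + 1)) (U (n + 1))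

/-- `U 0, …, U N` solve the linearised backward Euler scheme on `[0, T]` with `N` time steps. -/
def IsLinearSolution (T : ℝ) (N : ℕ) (U : ℕ → Fin m → E2 → ℝ) : Prop :=
  (∀ n ≤ N, ∀ i, MemV M p (U n i)) ∧ (∀ i, IsInterpolant M p (D.u₀ i) (U 0 i)) ∧
    ∀ n < N, SchemeStep M p S D (T / N) ((n + 1 : ℕ) * (T / N)) (U n) (U (n + 1)) (U n)

end Scheme

end VEM

end

open VEM

/-!
On one element `E` of diameter `h` the discrete solution is compared with `u` in two steps,
`|U - u| ≤ |I - u| + |I - U|`, with `I` the interpolant. The first term is at most `C h ^ s`. For the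
second, an inverse estimate gives `|I - U| ≤ C h⁻¹ ‖I - U‖_{L²(E)}`, and the assumed error bound
together with quasi-uniformity turns this into `C (h ^ (s - 1) + δt / h)`. The scheme enters only
through the error bound. All constants have to be uniform over shape-regular elements, so compactness
on a reference element is not available; it is replaced by arguments that use only the following
facts: `E` is star-shaped with respect to a disc (`StarDisc`), the functions of the space have
polynomial weak Laplacians (`WeakLap`) and polynomial traces on the edges.

*Polynomial approximation* (`exists_poly_approx`). A function with `s + 1` weak derivatives in `L²` is
within `C h ^ s` of a polynomial of degree `s`. For smooth functions this is the Taylor formula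
averaged over the disc. In general one mollifies on the shrunk copies `dil y a E`; the polynomials
found for different `a` agree up to the size of the error, by the inverse inequality for polynomials,
so one of them serves all `a`.

*Maximum principle and energy* (`integral_sq_comp_le`, `WeakLap.le_of_frontier_le`). If `ψ` vanishes
on an interval around `0` that contains the boundary values of `v`, then `ψ(v)` vanishes near the
boundary, and mollification justifies testing `Δ v = q` with it. This gives a bound for `ψ(v)` in `L²`
by Poincaré's inequality, and with it the maximum principle.

*Inverse estimate* (`exists_inverse_estimate`). Testing with a bump function bounds the Laplacian `q`
by `C h⁻³ ‖v‖_{L²}`. Let the maximum of `|v|` on the boundary be attained on some edge. The trace is a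
polynomial, so `|v|` has comparable size near some point `z` of the middle third of that edge
(`exists_middle_point`). Star-shapedness makes `E` a half-disc near `z` (`StarDisc.exists_halfDisc`),
where an explicit barrier shows that `|v|` stays comparable on a disc of radius proportional to `h`.
Hence the boundary maximum is at most `C h⁻¹ ‖v‖_{L²}`, and the maximum principle extends this to `E`.

*Stability of the interpolation* (`exists_interpolant_bound`). Let `q` be a polynomial with
`|u - q| ≤ ε`, and `v = I - q`. The Gauss–Lobatto nodes, at least `p + 1` on each edge by Rolle's
theorem, bound `v` by `C ε` on the boundary. Green's formula, tested with cut-off functions whose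
gradients are bounded in `L¹`, bounds the gradient projection of `v` by boundary values and moments of
degree at most `p - 2` (`exists_gradProj_bound`). The defining orthogonality of the space then yields
all moments of `v` up to degree `p`. Testing `Δ v` with `v` truncated at the level of its boundary
values gives `‖v‖_{L²} ≤ C ε h`, and the maximum principle gives `|v| ≤ C ε`.
-/

namespace VEM

/-! ### Partial derivatives of smooth functions -/

lemma contDiff_pd {f : E2 → ℝ} (hf : ContDiff ℝ ∞ f) (j : Fin 2) : ContDiff ℝ ∞ (pd j f) :=
  (hf.fderiv_right (m := ∞) (by simp)).clm_apply contDiff_const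

lemma continuous_pd {f : E2 → ℝ} (hf : ContDiff ℝ 1 f) (j : Fin 2) : Continuous (pd j f) :=
  (hf.continuous_fderiv one_ne_zero).clm_apply continuous_const

lemma contDiff_pd_iterate {f : E2 → ℝ} (hf : ContDiff ℝ ∞ f) (j : Fin 2) (n : ℕ) :
    ContDiff ℝ ∞ ((pd j)^[n] f) := by
  induction n with
  | zero => exact hf
  | succ n ih => rw [Function.iterate_succ_apply']; exact contDiff_pd ih j

lemma contDiff_pdMulti {f : E2 → ℝ} (hf : ContDiff ℝ ∞ f) (a b : ℕ) :
    ContDiff ℝ ∞ (pdMulti a b f) :=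
  contDiff_pd_iterate (contDiff_pd_iterate hf 1 b) 0 a

lemma pd_comm {f : E2 → ℝ} (hf : ContDiff ℝ ∞ f) (i j : Fin 2) :
    pd i (pd j f) = pd j (pd i f) := by
  have h2 : ContDiff ℝ ∞ (fderiv ℝ f) := hf.fderiv_right (m := ∞) (by simp)
  have key : ∀ (k l : Fin 2) (x : E2), pd k (pd l f) x =
      fderiv ℝ (fderiv ℝ f) x (EuclideanSpace.single k 1) (EuclideanSpace.single l 1) := by
    intro k l x
    unfold pd
    rw [fderiv_clm_apply (h2.differentiable (by simp) x) (differentiableAt_const _)]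
    simp
  ext x
  rw [key, key]
  exact (hf.contDiffAt.isSymmSndFDerivAt (by
    rw [minSmoothness_of_isRCLikeNormedField]
    exact WithTop.coe_le_coe.2 (le_top : (2 : ℕ∞) ≤ ⊤))).eq _ _

lemma pd_iterate_comm {f : E2 → ℝ} (hf : ContDiff ℝ ∞ f) (i j : Fin 2) (n : ℕ) :
    pd i ((pd j)^[n] f) = (pd j)^[n] (pd i f) := by
  induction n with
  | zero => rfl
  | succ n ih =>
    rw [Function.iterate_succ_apply', Function.iterate_succ_apply', ← ih,
      pd_comm (contDiff_pd_iterate hf j n)]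

lemma pd_zero_pdMulti (f : E2 → ℝ) (a b : ℕ) : pd 0 (pdMulti a b f) = pdMulti (a + 1) b f := by
  unfold pdMulti; rw [Function.iterate_succ_apply']

lemma pd_one_pdMulti {f : E2 → ℝ} (hf : ContDiff ℝ ∞ f) (a b : ℕ) :
    pd 1 (pdMulti a b f) = pdMulti a (b + 1) f := by
  unfold pdMulti
  rw [pd_iterate_comm (contDiff_pd_iterate hf 1 b), Function.iterate_succ_apply']

lemma support_pd_subset (f : E2 → ℝ) (j : Fin 2) : Function.support (pd j f) ⊆ tsupport f := by
  intro x hx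
  by_contra h
  apply hx
  have : fderiv ℝ f x = 0 := by
    by_contra h'
    exact h (support_fderiv_subset ℝ h')
  simp [pd, this]

lemma tsupport_pd_subset (f : E2 → ℝ) (j : Fin 2) : tsupport (pd j f) ⊆ tsupport f :=
  closure_minimal (support_pd_subset f j) (isClosed_tsupport f)

lemma tsupport_pdMulti_subset (f : E2 → ℝ) (a b : ℕ) : tsupport (pdMulti a b f) ⊆ tsupport f := by
  have : ∀ (j : Fin 2) (g : E2 → ℝ) (n : ℕ), tsupport ((pd j)^[n] g) ⊆ tsupport g := by
    intro j g n
    induction n with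
    | zero => exact subset_rfl
    | succ n ih =>
      rw [Function.iterate_succ_apply']; exact (tsupport_pd_subset _ _).trans ih
  exact (this _ _ _).trans (this _ _ _)

lemma hasCompactSupport_pd {f : E2 → ℝ} (hf : HasCompactSupport f) (j : Fin 2) :
    HasCompactSupport (pd j f) :=
  hf.of_isClosed_subset (isClosed_tsupport _) (tsupport_pd_subset f j)

lemma hasCompactSupport_pdMulti {f : E2 → ℝ} (hf : HasCompactSupport f) (a b : ℕ) :
    HasCompactSupport (pdMulti a b f) :=
  hf.of_isClosed_subset (isClosed_tsupport _) (tsupport_pdMulti_subset f a b)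

lemma IsTest.pd {G : Set E2} {φ : E2 → ℝ} (h : IsTest G φ) (j : Fin 2) :
    IsTest G (VEM.pd j φ) :=
  ⟨contDiff_pd h.1 j, hasCompactSupport_pd h.2.1 j, (tsupport_pd_subset φ j).trans h.2.2⟩

lemma IsTest.mul_left {G : Set E2} {φ f : E2 → ℝ} (h : IsTest G φ) (hf : ContDiff ℝ ∞ f) :
    IsTest G (fun x => f x * φ x) :=
  ⟨hf.mul h.1, h.2.1.mul_left, (tsupport_mul_subset_right (f := f)).trans h.2.2⟩

lemma pd_add {f g : E2 → ℝ} {x : E2} (hf : DifferentiableAt ℝ f x) (hg : DifferentiableAt ℝ g x)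
    (j : Fin 2) : pd j (fun x => f x + g x) x = pd j f x + pd j g x := by
  unfold pd; rw [fderiv_fun_add hf hg]; rfl

lemma pd_mul {f g : E2 → ℝ} {x : E2} (hf : DifferentiableAt ℝ f x) (hg : DifferentiableAt ℝ g x)
    (j : Fin 2) : pd j (fun x => f x * g x) x = pd j f x * g x + f x * pd j g x := by
  unfold pd; rw [fderiv_fun_mul hf hg]; simp; ring

lemma pd_comp_affine (f : E2 → ℝ) (s : ℝ) (y : E2) (j : Fin 2) :
    pd j (fun x => f (s • (x - y))) = fun x => s * pd j f (s • (x - y)) := by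
  ext x
  unfold pd
  rcases eq_or_ne s 0 with rfl | hs
  · simp
  have h1 : (fun x => f (s • (x - y))) = fun x => (fun z => f (s • z)) (x - y) := rfl
  rw [h1, fderiv_comp_sub (f := fun z => f (s • z)), fderiv_comp_smul]
  simp

lemma pd_const_mul {f : E2 → ℝ} (s : ℝ) (j : Fin 2) :
    pd j (fun x => s * f x) = fun x => s * pd j f x := by
  ext x; unfold pd
  have : (fun x => s * f x) = s • f := rfl
  rw [this, fderiv_const_smul_field]; simp

lemma pd_scomp {ψ ψ' : ℝ → ℝ} {f : E2 → ℝ} {x : E2} (hψ : HasDerivAt ψ (ψ' (f x)) (f x))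
    (hf : DifferentiableAt ℝ f x) (j : Fin 2) :
    pd j (fun x => ψ (f x)) x = ψ' (f x) * pd j f x := by
  unfold pd
  have h : HasFDerivAt (fun x => ψ (f x)) (ψ' (f x) • fderiv ℝ f x) x :=
    hψ.comp_hasFDerivAt x hf.hasFDerivAt
  rw [h.fderiv]; simp

/-- Integration by parts on the plane when one of the two factors has compact support. -/
lemma integral_mul_pd {f g : E2 → ℝ} (hf : ContDiff ℝ 1 f) (hg : ContDiff ℝ 1 g)
    (hc : HasCompactSupport g) (j : Fin 2) :
    ∫ x, f x * pd j g x = - ∫ x, pd j f x * g x := by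
  have hgc := hg.continuous
  apply integral_mul_fderiv_eq_neg_fderiv_mul_of_integrable
  · exact ((continuous_pd hf j).mul hgc).integrable_of_hasCompactSupport hc.mul_left
  · exact (hf.continuous.mul (continuous_pd hg j)).integrable_of_hasCompactSupport
      (hasCompactSupport_pd hc j).mul_left
  · exact (hf.continuous.mul hgc).integrable_of_hasCompactSupport hc.mul_left
  · intro x _; exact hf.differentiable one_ne_zero x
  · intro x _; exact hg.differentiable one_ne_zero x

/-- An integral over `G` of a function supported in `G` is an integral over the plane. -/
lemma setIntegral_eq_integral_of_tsupport {G : Set E2} {F φ : E2 → ℝ}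
    (h : tsupport φ ⊆ G) (hF : ∀ x, φ x = 0 → F x = 0) : ∫ x in G, F x = ∫ x, F x := by
  apply setIntegral_eq_integral_of_forall_compl_eq_zero
  intro x hx
  exact hF x (image_eq_zero_of_notMem_tsupport fun h' => hx (h h'))

/-! ### Mollification -/

/-- A fixed smooth bump of integral one supported in the unit disc. -/
noncomputable def bump0 : ContDiffBump (0 : E2) := ⟨1 / 2, 1, by norm_num, by norm_num⟩

/-- The unscaled mollifier. -/
noncomputable def moll0 : E2 → ℝ := bump0.normed volume

/-- The mollifier of width `ε`. -/
noncomputable def moll (ε : ℝ) : E2 → ℝ := fun x => (ε ^ 2)⁻¹ * moll0 (ε⁻¹ • x)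

lemma moll0_contDiff : ContDiff ℝ ∞ moll0 := bump0.contDiff_normed

lemma moll0_support : Function.support moll0 = Metric.ball 0 1 := bump0.support_normed_eq

lemma moll_contDiff (ε : ℝ) : ContDiff ℝ ∞ (moll ε) :=
  contDiff_const.mul (moll0_contDiff.comp (contDiff_const_smul _))

lemma moll_nonneg (ε : ℝ) (x : E2) : 0 ≤ moll ε x :=
  mul_nonneg (by positivity) (bump0.nonneg_normed _)

lemma moll_support {ε : ℝ} (hε : 0 < ε) : Function.support (moll ε) ⊆ Metric.ball 0 ε := by
  intro x hx
  have h1 : ε⁻¹ • x ∈ Function.support moll0 := fun h => hx (by simp [moll, h])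
  rw [moll0_support, mem_ball_zero_iff, norm_smul, Real.norm_eq_abs, abs_of_pos (by positivity),
    inv_mul_lt_iff₀ hε] at h1
  simpa using h1

lemma moll_tsupport {ε : ℝ} (hε : 0 < ε) : tsupport (moll ε) ⊆ Metric.closedBall 0 ε :=
  closure_minimal ((moll_support hε).trans Metric.ball_subset_closedBall) Metric.isClosed_closedBall

lemma moll_hasCompactSupport {ε : ℝ} (hε : 0 < ε) : HasCompactSupport (moll ε) :=
  (isCompact_closedBall (0 : E2) ε).of_isClosed_subset (isClosed_tsupport _) (moll_tsupport hε)

lemma finrank_E2 : Module.finrank ℝ E2 = 2 := by simp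

/-- Change of variables under a dilation of the plane. -/
lemma integral_comp_smul_E2 (f : E2 → ℝ) {s : ℝ} (hs : 0 < s) :
    ∫ x, f (s • x) = (s ^ 2)⁻¹ * ∫ x, f x := by
  rw [Measure.integral_comp_smul_of_nonneg _ _ _ (hR := hs.le), finrank_E2, smul_eq_mul]

lemma moll_integral {ε : ℝ} (hε : 0 < ε) : ∫ x, moll ε x = 1 := by
  unfold moll
  rw [integral_const_mul, integral_comp_smul_E2 _ (inv_pos.2 hε)]
  have : ∫ x, moll0 x = 1 := bump0.integral_normed
  rw [this]; field_simp

lemma integral_abs_pd_moll {ε : ℝ} (hε : 0 < ε) (j : Fin 2) :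
    ∫ x, |pd j (moll ε) x| = ε⁻¹ * ∫ x, |pd j moll0 x| := by
  have : pd j (moll ε) = fun x => (ε ^ 2)⁻¹ * (ε⁻¹ * pd j moll0 (ε⁻¹ • x)) := by
    unfold moll
    rw [pd_const_mul]
    have := pd_comp_affine moll0 ε⁻¹ 0 j
    simp only [sub_zero] at this
    rw [this]
  rw [this]
  simp only [abs_mul]
  rw [integral_const_mul, integral_const_mul,
    integral_comp_smul_E2 (fun x => |pd j moll0 x|) (inv_pos.2 hε),
    abs_of_pos (by positivity : (0:ℝ) < (ε ^ 2)⁻¹), abs_of_pos (by positivity : (0:ℝ) < ε⁻¹)]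
  field_simp

open scoped Convolution in
/-- The convolution `κ ⋆ f` of two real functions on the plane. -/
noncomputable def conv (κ f : E2 → ℝ) : E2 → ℝ := κ ⋆[ContinuousLinearMap.lsmul ℝ ℝ, volume] f

lemma conv_apply (κ f : E2 → ℝ) (x : E2) : conv κ f x = ∫ t, κ t * f (x - t) := rfl

lemma conv_apply_swap (κ f : E2 → ℝ) (x : E2) : conv κ f x = ∫ t, κ (x - t) * f t := by
  unfold conv; rw [convolution_eq_swap]; rfl

lemma conv_contDiff {κ f : E2 → ℝ} (hc : HasCompactSupport κ) (hκ : ContDiff ℝ ∞ κ)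
    (hf : LocallyIntegrable f) : ContDiff ℝ ∞ (conv κ f) :=
  hc.contDiff_convolution_left (n := ⊤) (ContinuousLinearMap.lsmul ℝ ℝ) hκ hf

lemma pd_conv {κ f : E2 → ℝ} (hc : HasCompactSupport κ) (hκ : ContDiff ℝ ∞ κ)
    (hf : LocallyIntegrable f) (j : Fin 2) : pd j (conv κ f) = conv (pd j κ) f := by
  ext x
  have h := hc.hasFDerivAt_convolution_left (ContinuousLinearMap.lsmul ℝ ℝ)
    (hκ.of_le (by simp)) hf x (μ := volume)
  unfold pd conv
  rw [h.fderiv]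
  have h' := convolution_precompR_apply (ContinuousLinearMap.lsmul ℝ ℝ : ℝ →L[ℝ] ℝ →L[ℝ] ℝ).flip
    hf (hc.fderiv ℝ) (hκ.continuous_fderiv (by simp)) x (EuclideanSpace.single j 1) (μ := volume)
  rw [← convolution_flip, ← convolution_flip (f := fun x => fderiv ℝ κ x _)]
  exact h'

lemma pdMulti_conv {κ f : E2 → ℝ} (hc : HasCompactSupport κ) (hκ : ContDiff ℝ ∞ κ)
    (hf : LocallyIntegrable f) (a b : ℕ) : pdMulti a b (conv κ f) = conv (pdMulti a b κ) f := by
  have : ∀ (j : Fin 2) (n : ℕ) (κ : E2 → ℝ), HasCompactSupport κ → ContDiff ℝ ∞ κ →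
      (pd j)^[n] (conv κ f) = conv ((pd j)^[n] κ) f ∧ HasCompactSupport ((pd j)^[n] κ) := by
    intro j n κ hc hκ
    induction n with
    | zero => exact ⟨rfl, hc⟩
    | succ n ih =>
      rw [Function.iterate_succ_apply', Function.iterate_succ_apply', ih.1]
      exact ⟨pd_conv ih.2 (contDiff_pd_iterate hκ j n) hf j, hasCompactSupport_pd ih.2 j⟩
  unfold pdMulti
  rw [(this 1 b κ hc hκ).1]
  exact (this 0 a _ (this 1 b κ hc hκ).2 (contDiff_pd_iterate hκ 1 b)).1

lemma pd_comp_neg_sub (f : E2 → ℝ) (x : E2) (j : Fin 2) :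
    pd j (fun t => f (x - t)) = fun t => - pd j f (x - t) := by
  have := pd_comp_affine f (-1) x j
  simpa using this

lemma pdMulti_comp_sub (f : E2 → ℝ) (x : E2) (a b : ℕ) :
    pdMulti a b (fun t => f (x - t)) = fun t => (-1) ^ (a + b) * pdMulti a b f (x - t) := by
  have : ∀ (j : Fin 2) (n : ℕ) (g : E2 → ℝ) (s : ℝ),
      (pd j)^[n] (fun t => s * g (x - t)) = fun t => (-1) ^ n * s * ((pd j)^[n] g) (x - t) := by
    intro j n g s
    induction n with
    | zero => simp
    | succ n ih =>
      rw [Function.iterate_succ_apply', ih, pd_const_mul, pd_comp_neg_sub,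
        Function.iterate_succ_apply']
      ext t; ring
  unfold pdMulti
  have h1 := this 1 b f 1
  simp only [one_mul, mul_one] at h1
  rw [h1, this 0 a]
  ext t; ring

lemma tsupport_moll_shift {ε : ℝ} (hε : 0 < ε) (x : E2) :
    tsupport (fun t => moll ε (x - t)) ⊆ Metric.closedBall x ε := by
  refine closure_minimal ?_ Metric.isClosed_closedBall
  intro t ht
  have h1 : x - t ∈ Metric.ball (0 : E2) ε := moll_support hε ht
  rw [mem_ball_zero_iff] at h1
  rw [Metric.mem_closedBall, dist_comm, dist_eq_norm]
  exact h1.le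

lemma isTest_moll_shift {G : Set E2} {ε : ℝ} (hε : 0 < ε) {x : E2}
    (hx : Metric.closedBall x ε ⊆ G) : IsTest G (fun t => moll ε (x - t)) :=
  ⟨(moll_contDiff ε).comp (contDiff_const.sub contDiff_id),
    (isCompact_closedBall x ε).of_isClosed_subset (isClosed_tsupport _) (tsupport_moll_shift hε x),
    (tsupport_moll_shift hε x).trans hx⟩

lemma conv_indicator {G : Set E2} (hG : MeasurableSet G) (κ f : E2 → ℝ) (x : E2) :
    conv κ (G.indicator f) x = ∫ t in G, f t * κ (x - t) := by
  rw [conv_apply_swap, ← integral_indicator hG]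
  congr 1; ext t
  by_cases h : t ∈ G <;> simp [h, mul_comm]

/-- Weak derivatives commute with mollification away from the boundary. -/
lemma pdMulti_moll_of_weak {G : Set E2} (hG : MeasurableSet G) {f g : E2 → ℝ} {a b : ℕ}
    (hf : IntegrableOn f G)
    (h : ∀ φ, IsTest G φ → ∫ x in G, f x * pdMulti a b φ x = (-1) ^ (a + b) * ∫ x in G, g x * φ x)
    {ε : ℝ} (hε : 0 < ε) {x : E2} (hx : Metric.closedBall x ε ⊆ G) :
    pdMulti a b (conv (moll ε) (G.indicator f)) x = conv (moll ε) (G.indicator g) x := by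
  have hf' : LocallyIntegrable (G.indicator f) := (hf.integrable_indicator hG).locallyIntegrable
  rw [pdMulti_conv (moll_hasCompactSupport hε) (moll_contDiff ε) hf', conv_indicator hG,
    conv_indicator hG]
  have h1 := h _ (isTest_moll_shift hε hx)
  rw [pdMulti_comp_sub] at h1
  have h2 : ∫ t in G, f t * ((-1) ^ (a + b) * pdMulti a b (moll ε) (x - t)) =
      (-1) ^ (a + b) * ∫ t in G, f t * pdMulti a b (moll ε) (x - t) := by
    rw [← integral_const_mul]; congr 1; ext t; ring
  rw [h2] at h1
  exact mul_left_cancel₀ (by positivity) h1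

lemma conv_moll_dist_le {f : E2 → ℝ} (hf : AEStronglyMeasurable f) {ε : ℝ} (hε : 0 < ε) {x : E2}
    {z η : ℝ} (hη : 0 ≤ η) (h : ∀ t ∈ Metric.ball x ε, |f t - z| ≤ η) :
    |conv (moll ε) f x - z| ≤ η :=
  dist_convolution_le hη (moll_support hε) (moll_nonneg ε) (moll_integral hε) hf h

lemma conv_moll_tendsto {f : E2 → ℝ} (hf : AEStronglyMeasurable f) {x : E2}
    (h : ContinuousAt f x) :
    Filter.Tendsto (fun ε => conv (moll ε) f x) (nhdsWithin 0 (Ioi 0)) (nhds (f x)) := by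
  rw [Metric.tendsto_nhds]
  intro η hη
  obtain ⟨d, hd, hd'⟩ := Metric.continuousAt_iff.1 h (η / 2) (by positivity)
  filter_upwards [Ioo_mem_nhdsGT hd] with ε hε
  refine lt_of_le_of_lt (conv_moll_dist_le hf hε.1 (η := η / 2) (by positivity) ?_) (by linarith)
  intro t ht
  exact (hd' (lt_trans ht hε.2)).le

/-! ### The truncated energy inequality and the maximum principle -/

/-- `Δ v = q` in the sense of distributions on `G`. -/
def WeakLap (G : Set E2) (v q : E2 → ℝ) : Prop :=
  ∀ φ, IsTest G φ →
    ∫ x in G, v x * (pdMulti 2 0 φ x + pdMulti 0 2 φ x) = ∫ x in G, q x * φ x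

lemma integrableOn_of_continuousOn_closure {G : Set E2} (hb : Bornology.IsBounded G) {v : E2 → ℝ}
    (hv : ContinuousOn v (closure G)) : IntegrableOn v G :=
  (hv.integrableOn_compact hb.isCompact_closure).mono_set subset_closure

lemma laplacian_moll_of_weakLap {G : Set E2} (hG : MeasurableSet G) {v q : E2 → ℝ}
    (hv : IntegrableOn v G) (h : WeakLap G v q) {ε : ℝ} (hε : 0 < ε) {x : E2}
    (hx : Metric.closedBall x ε ⊆ G) :
    pdMulti 2 0 (conv (moll ε) (G.indicator v)) x + pdMulti 0 2 (conv (moll ε) (G.indicator v)) x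
      = conv (moll ε) (G.indicator q) x := by
  have hv' : LocallyIntegrable (G.indicator v) := (hv.integrable_indicator hG).locallyIntegrable
  have hκ := moll_hasCompactSupport hε
  have key : ∀ a b : ℕ, IntegrableOn (fun t => v t * pdMulti a b (moll ε) (x - t)) G := by
    intro a b
    have hc := (hasCompactSupport_pdMulti hκ a b).convolutionExists_left
      (ContinuousLinearMap.lsmul ℝ ℝ) (contDiff_pdMulti (moll_contDiff ε) a b).continuous hv' x
    have := ((convolutionExistsAt_flip (L := ContinuousLinearMap.lsmul ℝ ℝ)).2 hc).integrable
    rw [← integrable_indicator_iff hG]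
    refine this.congr (Filter.Eventually.of_forall fun t => ?_)
    by_cases ht : t ∈ G <;> simp [ht, mul_comm]
  rw [pdMulti_conv hκ (moll_contDiff ε) hv', pdMulti_conv hκ (moll_contDiff ε) hv',
    conv_indicator hG, conv_indicator hG, conv_indicator hG, ← integral_add (key 2 0) (key 0 2),
    ← h _ (isTest_moll_shift hε hx)]
  congr 1; ext t
  rw [pdMulti_comp_sub, pdMulti_comp_sub]; ring

/-- The truncated energy inequality for smooth functions: it combines Green's identity for `ψ ∘ f`
and `f` with Poincaré's inequality for `ψ ∘ f`. -/
lemma integral_sq_comp_le_of_contDiff {f : E2 → ℝ} (hf : ContDiff ℝ ∞ f) {ψ θ : ℝ → ℝ}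
    (hψ : ∀ s, HasDerivAt ψ (θ s) s) (hθ : Continuous θ) (h0 : ∀ s, 0 ≤ θ s) (h1 : ∀ s, θ s ≤ 1)
    (hc : HasCompactSupport fun x => ψ (f x)) {y : E2} {h : ℝ}
    (hy : ∀ x, ψ (f x) ≠ 0 → |x 0 - y 0| ≤ h) :
    ∫ x, ψ (f x) ^ 2 ≤
      4 * h ^ 2 * -∫ x, ψ (f x) * (pdMulti 2 0 f x + pdMulti 0 2 f x) := by
  have hψc : ContDiff ℝ 1 ψ := by
    rw [contDiff_one_iff_deriv]
    refine ⟨fun s => (hψ s).differentiableAt, ?_⟩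
    rwa [show deriv ψ = θ from funext fun s => (hψ s).deriv]
  set F : E2 → ℝ := fun x => ψ (f x) with hF
  have hF1 : ContDiff ℝ 1 F := hψc.comp (hf.of_le (by simp))
  have hFd : ∀ x, DifferentiableAt ℝ F x := hF1.differentiable one_ne_zero
  have hpF : ∀ j x, pd j F x = θ (f x) * pd j f x := fun j x =>
    pd_scomp (ψ' := θ) (hψ _) (hf.differentiable (by simp) x) j
  have hint : ∀ g : E2 → ℝ, Continuous g → (∀ x, F x = 0 → pd 0 F x = 0 → pd 1 F x = 0 → g x = 0) →
      Integrable g := by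
    intro g hg h
    refine hg.integrable_of_hasCompactSupport (HasCompactSupport.intro hc.isCompact ?_)
    intro x hx
    have h2 : ∀ j, pd j F x = 0 := fun j => by
      by_contra h'
      exact hx (support_pd_subset F j h')
    exact h x (image_eq_zero_of_notMem_tsupport hx) (h2 0) (h2 1)
  have hcp : ∀ j, Continuous (pd j F) := continuous_pd hF1
  have hcf : ∀ j, Continuous (pd j f) := fun j => (contDiff_pd hf j).continuous
  have hFc : Continuous F := hF1.continuous
  -- Poincaré's inequality
  have hP : ∫ x, F x ^ 2 ≤ 4 * h ^ 2 * ∫ x, pd 0 F x ^ 2 := by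
    have hlin : ContDiff ℝ 1 fun x : E2 => x 0 - y 0 := by fun_prop
    have e1 := integral_mul_pd hlin (hF1.mul hF1) (hc.mul_left) 0
    have e2 : ∀ x, pd 0 (fun x : E2 => x 0 - y 0) x = 1 := by
      intro x
      have : HasFDerivAt (fun x : E2 => x 0 - y 0) (EuclideanSpace.proj (0 : Fin 2) : E2 →L[ℝ] ℝ) x :=
        ((EuclideanSpace.proj (0 : Fin 2) : E2 →L[ℝ] ℝ).hasFDerivAt).sub_const _
      unfold pd
      rw [this.fderiv]; simp
    have e3 : ∀ x, pd 0 (fun x => F x * F x) x = 2 * F x * pd 0 F x := by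
      intro x; rw [pd_mul (hFd x) (hFd x)]; ring
    simp only [e2, e3, one_mul] at e1
    have e4 : ∫ x, F x ^ 2 ≤ ∫ x, (F x ^ 2 / 2 + 2 * h ^ 2 * pd 0 F x ^ 2) := by
      have : ∫ x, F x ^ 2 = ∫ x, -((x 0 - y 0) * (2 * F x * pd 0 F x)) := by
        rw [integral_neg, e1, neg_neg]; congr 1; ext x; ring
      rw [this]
      refine integral_mono (hint _ (by fun_prop) ?_) (hint _ (by fun_prop) ?_) ?_
      · intro x a _ _; simp [a]
      · intro x a b _; simp [a, b]
      · intro x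
        simp only
        by_cases hx : F x = 0
        · simp only [hx]; nlinarith [sq_nonneg (h * pd 0 F x)]
        · have hb := sq_le_sq' (abs_le.1 (hy x hx)).1 (abs_le.1 (hy x hx)).2
          nlinarith [sq_nonneg (F x / 2 + (x 0 - y 0) * pd 0 F x),
            sq_nonneg (F x + 2 * (x 0 - y 0) * pd 0 F x),
            mul_le_mul_of_nonneg_right hb (sq_nonneg (pd 0 F x))]
    rw [integral_add, integral_div, integral_const_mul] at e4
    · linarith
    · exact hint _ (by fun_prop) fun x a _ _ => by simp [a]
    · exact hint _ (by fun_prop) fun x a b _ => by simp [b]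
  have hG : ∀ j, ∫ x, pd j f x * pd j F x = - ∫ x, pd j (pd j f) x * F x := fun j =>
    integral_mul_pd ((contDiff_pd hf j).of_le (by simp)) hF1 hc j
  have hle : ∫ x, pd 0 F x ^ 2 ≤ ∫ x, (pd 0 f x * pd 0 F x + pd 1 f x * pd 1 F x) := by
    refine integral_mono (hint _ (by fun_prop) ?_) (hint _ (by fun_prop) ?_) ?_
    · intro x _ b _; simp [b]
    · intro x _ b c; simp [b, c]
    · intro x
      simp only [hpF]
      have t0 := h0 (f x)
      have t1 := h1 (f x)
      have : θ (f x) ^ 2 ≤ θ (f x) := by nlinarith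
      nlinarith [mul_le_mul_of_nonneg_right this (sq_nonneg (pd 0 f x)),
        mul_nonneg t0 (sq_nonneg (pd 1 f x))]
  rw [integral_add, hG, hG] at hle
  · have hsum : ∫ x, F x * (pdMulti 2 0 f x + pdMulti 0 2 f x) =
        (∫ x, pd 0 (pd 0 f) x * F x) + ∫ x, pd 1 (pd 1 f) x * F x := by
      rw [← integral_add]
      · congr 1; ext x
        change F x * (pd 0 (pd 0 f) x + pd 1 (pd 1 f) x) = _
        ring
      · exact hint _ ((contDiff_pd (contDiff_pd hf 0) 0).continuous.mul hFc)
          fun x a _ _ => by simp [a]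
      · exact hint _ ((contDiff_pd (contDiff_pd hf 1) 1).continuous.mul hFc)
          fun x a _ _ => by simp [a]
    rw [hsum]
    refine hP.trans (mul_le_mul_of_nonneg_left ?_ (by positivity))
    linarith
  · exact hint _ (by fun_prop) fun x _ b _ => by simp [b]
  · exact hint _ (by fun_prop) fun x _ _ b => by simp [b]

/-- The truncated energy inequality: if `Δ v = q` and the truncation `ψ ∘ v` vanishes near the
boundary, then `‖ψ ∘ v‖²` is controlled by the pairing of `ψ ∘ v` with `-q`. No regularity of the
boundary is needed since the truncation of a mollification of `v` has compact support. -/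
lemma integral_sq_comp_le {G : Set E2} (hG : IsOpen G) (hb : Bornology.IsBounded G)
    {v q : E2 → ℝ} (hv : ContinuousOn v (closure G)) (hq : Continuous q) (hvq : WeakLap G v q)
    {ψ θ : ℝ → ℝ} (hψ : ∀ s, HasDerivAt ψ (θ s) s) (hθ : Continuous θ) (h0 : ∀ s, 0 ≤ θ s)
    (h1 : ∀ s, θ s ≤ 1) {α β : ℝ} (hα : α < 0) (hβ : 0 < β) (hψ0 : ∀ s ∈ Icc α β, ψ s = 0)
    (hfr : ∀ x ∈ frontier G, α < v x ∧ v x < β) {y : E2} {h : ℝ}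
    (hy : ∀ x ∈ G, |x 0 - y 0| ≤ h) :
    ∫ x in G, ψ (v x) ^ 2 ≤ 4 * h ^ 2 * -∫ x in G, ψ (v x) * q x := by
  have hGm := hG.measurableSet
  have hcl : IsCompact (closure G) := hb.isCompact_closure
  have hvi := integrableOn_of_continuousOn_closure hb hv
  have hqi := integrableOn_of_continuousOn_closure hb hq.continuousOn
  have hψc : Continuous ψ := continuous_iff_continuousAt.2 fun s => (hψ s).continuousAt
  set vG := G.indicator v with hvG
  set qG := G.indicator q with hqG
  have hvGm : AEStronglyMeasurable vG volume := (hvi.integrable_indicator hGm).aestronglyMeasurable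
  have hqGm : AEStronglyMeasurable qG volume := (hqi.integrable_indicator hGm).aestronglyMeasurable
  have hvGl : LocallyIntegrable vG := (hvi.integrable_indicator hGm).locallyIntegrable
  -- the closed set where the truncation may be active
  set K := {x ∈ closure G | v x ∈ Iic α ∪ Ici β} with hK
  have hKc : IsCompact K :=
    hcl.of_isClosed_subset (hv.preimage_isClosed_of_isClosed isClosed_closure
      (isClosed_Iic.union isClosed_Ici)) fun x hx => hx.1
  have hKG : K ⊆ G := by
    intro x hx
    by_contra hxG
    have : x ∈ frontier G := by rw [hG.frontier_eq]; exact ⟨hx.1, hxG⟩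
    rcases hx.2 with h | h
    · exact absurd h (not_le.2 (hfr x this).1)
    · exact absurd h (not_le.2 (hfr x this).2)
  obtain ⟨ε₀, hε₀, hthick⟩ := hKc.exists_cthickening_subset_open hG hKG
  obtain ⟨Mv, hMv⟩ := hcl.exists_bound_of_continuousOn hv
  obtain ⟨Mq, hMq⟩ := hcl.exists_bound_of_continuousOn hq.continuousOn
  have hMv0 : ∀ x, |vG x - 0| ≤ |Mv| := by
    intro x
    by_cases hx : x ∈ G
    · simpa [hvG, hx] using (hMv x (subset_closure hx)).trans (le_abs_self _)
    · simp [hvG, hx]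
  have hMq0 : ∀ x, |qG x - 0| ≤ |Mq| := by
    intro x
    by_cases hx : x ∈ G
    · simpa [hqG, hx] using (hMq x (subset_closure hx)).trans (le_abs_self _)
    · simp [hqG, hx]
  have hact : ∀ ε, 0 < ε → ε < ε₀ / 2 → ∀ x, ψ (conv (moll ε) vG x) ≠ 0 →
      x ∈ Metric.cthickening ε K ∧ Metric.closedBall x ε ⊆ G := by
    intro ε hε hε' x hx
    obtain ⟨t, ht, htK⟩ : ∃ t ∈ Metric.ball x ε, t ∈ K := by
      by_contra! hcon
      apply hx
      apply hψ0
      have := conv_moll_dist_le hvGm hε (x := x) (z := (α + β) / 2) (η := (β - α) / 2)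
        (by linarith) ?_
      · rw [abs_le] at this; constructor <;> linarith
      · intro t ht
        have htK := hcon t ht
        rw [abs_le]
        by_cases htG : t ∈ G
        · have : v t ∉ Iic α ∪ Ici β := fun h => htK ⟨subset_closure htG, h⟩
          simp only [mem_union, mem_Iic, mem_Ici, not_or, not_le] at this
          simp only [hvG, htG, indicator_of_mem]
          constructor <;> linarith
        · simp only [hvG, htG, indicator_of_notMem, not_false_eq_true]
          constructor <;> linarith
    refine ⟨Metric.mem_cthickening_of_dist_le x t ε K htK (by
      rw [dist_comm]; exact (Metric.mem_ball.1 ht).le), fun z hz => hthick ?_⟩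
    refine Metric.mem_cthickening_of_dist_le z t ε₀ K htK ?_
    have h2 := Metric.mem_closedBall.1 hz
    have h3 : dist x t < ε := by rw [dist_comm]; exact Metric.mem_ball.1 ht
    linarith [dist_triangle z x t]
  have hineq : ∀ ε, 0 < ε → ε < ε₀ / 2 →
      ∫ x in G, ψ (conv (moll ε) vG x) ^ 2 ≤
        4 * h ^ 2 * -∫ x in G, ψ (conv (moll ε) vG x) * conv (moll ε) qG x := by
    intro ε hε hε'
    have hself : ∀ x, ψ (conv (moll ε) vG x) ≠ 0 → x ∈ G := fun x hx =>
      (hact ε hε hε' x hx).2 (Metric.mem_closedBall_self hε.le)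
    rw [setIntegral_eq_integral_of_forall_compl_eq_zero, setIntegral_eq_integral_of_forall_compl_eq_zero]
    · have hcs : HasCompactSupport fun x => ψ (conv (moll ε) vG x) := by
        refine HasCompactSupport.intro (hKc.cthickening (r := ε)) ?_
        intro x hx
        by_contra hne
        exact hx (hact ε hε hε' x hne).1
      have := integral_sq_comp_le_of_contDiff (conv_contDiff (moll_hasCompactSupport hε)
        (moll_contDiff ε) hvGl) hψ hθ h0 h1 hcs (y := y) (h := h) fun x hx => hy x (hself x hx)
      convert this using 4
      ext x
      by_cases hx : ψ (conv (moll ε) vG x) = 0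
      · simp [hx]
      · rw [laplacian_moll_of_weakLap hGm hvi hvq hε (hact ε hε hε' x hx).2]
    · intro x hx
      by_contra hne
      exact hx (hself x (left_ne_zero_of_mul hne))
    · intro x hx
      by_contra hne
      exact hx (hself x fun h => hne (by simp [h]))
  -- passage to the limit
  obtain ⟨Mψ, hMψ⟩ := (isCompact_Icc (a := -|Mv|) (b := |Mv|)).exists_bound_of_continuousOn
    hψc.continuousOn
  have hbψ : ∀ ε, 0 < ε → ∀ x, |ψ (conv (moll ε) vG x)| ≤ Mψ := by
    intro ε hε x
    apply hMψ
    have := conv_moll_dist_le hvGm hε (x := x) (z := 0) (η := |Mv|) (by positivity)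
      fun t _ => hMv0 t
    rw [sub_zero] at this
    exact abs_le.1 this
  have hbq : ∀ ε, 0 < ε → ∀ x, |conv (moll ε) qG x| ≤ |Mq| := by
    intro ε hε x
    have := conv_moll_dist_le hqGm hε (x := x) (z := 0) (η := |Mq|) (by positivity)
      fun t _ => hMq0 t
    rwa [sub_zero] at this
  have hGfin : volume G < ⊤ := hb.measure_lt_top
  have hcv : ∀ ε, 0 < ε → Continuous (conv (moll ε) vG) := fun ε hε =>
    (conv_contDiff (moll_hasCompactSupport hε) (moll_contDiff ε) hvGl).continuous
  have hcq : ∀ ε, 0 < ε → Continuous (conv (moll ε) qG) := fun ε hε =>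
    (conv_contDiff (moll_hasCompactSupport hε) (moll_contDiff ε)
      (hqi.integrable_indicator hGm).locallyIntegrable).continuous
  have hpos : ∀ᶠ ε : ℝ in nhdsWithin 0 (Ioi 0), 0 < ε := self_mem_nhdsWithin
  have hlimv : ∀ x ∈ G, Filter.Tendsto (fun ε => ψ (conv (moll ε) vG x)) (nhdsWithin 0 (Ioi 0))
      (nhds (ψ (v x))) := by
    intro x hx
    have hca : ContinuousAt vG x := by
      have : ContinuousAt v x := hv.continuousAt (Filter.mem_of_superset (hG.mem_nhds hx) subset_closure)
      refine this.congr ?_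
      filter_upwards [hG.mem_nhds hx] with t ht
      simp [hvG, ht]
    have := conv_moll_tendsto hvGm hca
    rw [show vG x = v x by simp [hvG, hx]] at this
    exact (hψc.tendsto _).comp this
  have hlimq : ∀ x ∈ G, Filter.Tendsto (fun ε => conv (moll ε) qG x) (nhdsWithin 0 (Ioi 0))
      (nhds (q x)) := by
    intro x hx
    have hca : ContinuousAt qG x := by
      refine hq.continuousAt.congr ?_
      filter_upwards [hG.mem_nhds hx] with t ht
      simp [hqG, ht]
    have := conv_moll_tendsto hqGm hca
    rwa [show qG x = q x by simp [hqG, hx]] at this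
  have hlim1 : Filter.Tendsto (fun ε => ∫ x in G, ψ (conv (moll ε) vG x) ^ 2)
      (nhdsWithin 0 (Ioi 0)) (nhds (∫ x in G, ψ (v x) ^ 2)) := by
    refine tendsto_integral_filter_of_dominated_convergence (fun _ => Mψ ^ 2) ?_ ?_
      (integrableOn_const hGfin.ne) ?_
    · filter_upwards [hpos] with ε hε
      exact ((hψc.comp (hcv ε hε)).pow 2).aestronglyMeasurable
    · filter_upwards [hpos] with ε hε
      refine Filter.Eventually.of_forall fun x => ?_
      rw [Real.norm_eq_abs, abs_pow]
      exact pow_le_pow_left₀ (abs_nonneg _) (hbψ ε hε x) 2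
    · filter_upwards [ae_restrict_mem hGm] with x hx
      exact (hlimv x hx).pow 2
  have hlim2 : Filter.Tendsto (fun ε => ∫ x in G, ψ (conv (moll ε) vG x) * conv (moll ε) qG x)
      (nhdsWithin 0 (Ioi 0)) (nhds (∫ x in G, ψ (v x) * q x)) := by
    refine tendsto_integral_filter_of_dominated_convergence (fun _ => Mψ * |Mq|) ?_ ?_
      (integrableOn_const hGfin.ne) ?_
    · filter_upwards [hpos] with ε hε
      exact ((hψc.comp (hcv ε hε)).mul (hcq ε hε)).aestronglyMeasurable
    · filter_upwards [hpos] with ε hε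
      refine Filter.Eventually.of_forall fun x => ?_
      rw [Real.norm_eq_abs, abs_mul]
      exact mul_le_mul (hbψ ε hε x) (hbq ε hε x) (abs_nonneg _)
        ((abs_nonneg _).trans (hbψ ε hε x))
    · filter_upwards [ae_restrict_mem hGm] with x hx
      exact (hlimv x hx).mul (hlimq x hx)
  refine le_of_tendsto_of_tendsto hlim1 (hlim2.neg.const_mul _) ?_
  filter_upwards [Ioo_mem_nhdsGT (half_pos hε₀)] with ε hε
  exact hineq ε hε.1 hε.2

/-- The derivative of the truncation `trunc a`: zero up to `a`, one from `2 * a` on. -/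
noncomputable def truncDeriv (a s : ℝ) : ℝ := max 0 (min 1 ((s - a) / a))

/-- A continuously differentiable version of `max (s - a) 0`. -/
noncomputable def trunc (a s : ℝ) : ℝ := ∫ t in (0 : ℝ)..s, truncDeriv a t

lemma continuous_truncDeriv (a : ℝ) : Continuous (truncDeriv a) := by
  unfold truncDeriv; fun_prop

lemma truncDeriv_nonneg (a s : ℝ) : 0 ≤ truncDeriv a s := le_max_left _ _

lemma truncDeriv_le_one (a s : ℝ) : truncDeriv a s ≤ 1 := max_le zero_le_one (min_le_left _ _)

lemma truncDeriv_of_le {a s : ℝ} (ha : 0 < a) (hs : s ≤ a) : truncDeriv a s = 0 := by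
  have : (s - a) / a ≤ 0 := div_nonpos_of_nonpos_of_nonneg (by linarith) ha.le
  unfold truncDeriv
  exact max_eq_left ((min_le_right _ _).trans this)

lemma truncDeriv_of_ge {a s : ℝ} (ha : 0 < a) (hs : 2 * a ≤ s) : truncDeriv a s = 1 := by
  have : 1 ≤ (s - a) / a := by rw [le_div_iff₀ ha]; linarith
  unfold truncDeriv
  rw [min_eq_left this]; simp

lemma hasDerivAt_trunc (a s : ℝ) : HasDerivAt (trunc a) (truncDeriv a s) s :=
  intervalIntegral.integral_hasDerivAt_right ((continuous_truncDeriv a).intervalIntegrable _ _)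
    (continuous_truncDeriv a).aestronglyMeasurable.stronglyMeasurableAtFilter
    (continuous_truncDeriv a).continuousAt

lemma continuous_trunc (a : ℝ) : Continuous (trunc a) :=
  continuous_iff_continuousAt.2 fun s => (hasDerivAt_trunc a s).continuousAt

lemma trunc_monotone (a : ℝ) : Monotone (trunc a) :=
  monotone_of_deriv_nonneg (fun s => (hasDerivAt_trunc a s).differentiableAt)
    fun s => by rw [(hasDerivAt_trunc a s).deriv]; exact truncDeriv_nonneg a s

lemma trunc_of_le {a s : ℝ} (ha : 0 < a) (hs : s ≤ a) : trunc a s = 0 := by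
  unfold trunc
  rw [intervalIntegral.integral_congr (g := fun _ => 0)]
  · simp
  · intro t ht
    rw [mem_uIcc] at ht
    exact truncDeriv_of_le ha (by rcases ht with h | h <;> linarith [h.2])

lemma trunc_nonneg {a : ℝ} (ha : 0 < a) (s : ℝ) : 0 ≤ trunc a s := by
  rcases le_total s a with h | h
  · exact (trunc_of_le ha h).ge
  · rw [← trunc_of_le ha le_rfl]; exact trunc_monotone a h

lemma trunc_of_ge {a s : ℝ} (ha : 0 < a) (hs : 2 * a ≤ s) :
    trunc a s = trunc a (2 * a) + (s - 2 * a) := by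
  unfold trunc
  rw [← intervalIntegral.integral_add_adjacent_intervals (b := 2 * a)
    ((continuous_truncDeriv a).intervalIntegrable _ _)
    ((continuous_truncDeriv a).intervalIntegrable _ _)]
  congr 1
  rw [intervalIntegral.integral_congr (g := fun _ => 1)]
  · simp
  · intro t ht
    rw [uIcc_of_le hs] at ht
    exact truncDeriv_of_ge ha ht.1

lemma sub_trunc_mono (a : ℝ) : Monotone fun s => s - trunc a s := by
  refine monotone_of_deriv_nonneg (fun s => ((hasDerivAt_id s).sub
    (hasDerivAt_trunc a s)).differentiableAt) fun s => ?_
  have : HasDerivAt (fun s => s - trunc a s) (1 - truncDeriv a s) s :=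
    (hasDerivAt_id s).sub (hasDerivAt_trunc a s)
  rw [this.deriv]
  linarith [truncDeriv_le_one a s]

lemma sub_two_mul_le_trunc {a : ℝ} (ha : 0 < a) (s : ℝ) : s - 2 * a ≤ trunc a s := by
  rcases le_total s (2 * a) with h | h
  · linarith [trunc_nonneg ha s]
  · rw [trunc_of_ge ha h]; linarith [trunc_nonneg ha (2 * a)]

lemma trunc_le_self {a s : ℝ} (ha : 0 < a) (hs : 0 ≤ s) : trunc a s ≤ s := by
  have := sub_trunc_mono a hs
  simp only [trunc_of_le ha ha.le] at this
  linarith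

/-- The weak maximum principle on a bounded open set. -/
lemma WeakLap.le_of_frontier_le {G : Set E2} (hG : IsOpen G) (hb : Bornology.IsBounded G)
    {v q : E2 → ℝ} (hv : ContinuousOn v (closure G)) (hq : Continuous q) (hvq : WeakLap G v q)
    (hq0 : ∀ x ∈ G, 0 ≤ q x) {M : ℝ} (hM : 0 ≤ M) (hfr : ∀ x ∈ frontier G, v x ≤ M) :
    ∀ x ∈ closure G, v x ≤ M := by
  have hin : ∀ x ∈ G, ∀ a, M < a → v x ≤ a := by
    intro x hx a ha
    have ha0 : 0 < a := hM.trans_lt ha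
    by_contra! hxa
    obtain ⟨B, hB⟩ := hb.isCompact_closure.exists_bound_of_continuousOn hv
    obtain ⟨R, hR⟩ := hb.subset_closedBall 0
    have hcoord : ∀ z ∈ G, |z 0 - (0 : E2) 0| ≤ R := by
      intro z hz
      have h1 := hR hz
      rw [mem_closedBall_zero_iff] at h1
      have h2 := PiLp.norm_apply_le z 0
      rw [Real.norm_eq_abs] at h2
      simpa using h2.trans h1
    have key := integral_sq_comp_le hG hb hv hq hvq (hasDerivAt_trunc a) (continuous_truncDeriv a)
      (truncDeriv_nonneg a) (truncDeriv_le_one a) (α := -(|B| + 1)) (β := a) (by linarith [abs_nonneg B]) ha0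
      (fun s hs => trunc_of_le ha0 hs.2) (fun z hz => ⟨by
        have h1 := hB z (frontier_subset_closure hz)
        rw [Real.norm_eq_abs] at h1
        have := (abs_le.1 h1).1
        linarith [le_abs_self B], (hfr z hz).trans_lt ha⟩) hcoord
    have hnn : 0 ≤ ∫ x in G, trunc a (v x) * q x :=
      setIntegral_nonneg hG.measurableSet fun z hz => mul_nonneg (trunc_nonneg ha0 _) (hq0 z hz)
    have hcont : ContinuousOn (fun x => trunc a (v x) ^ 2) (closure G) :=
      ((continuous_trunc a).comp_continuousOn hv).pow 2
    have hzero : ∫ x in G, trunc a (v x) ^ 2 = 0 := by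
      refine le_antisymm (key.trans ?_) (integral_nonneg fun _ => sq_nonneg _)
      nlinarith [sq_nonneg R]
    -- the truncation is positive beyond the level `a`
    have htpos : 0 < trunc a (v x) := by
      have hd : truncDeriv a (v x) > 0 := by
        unfold truncDeriv
        exact lt_max_of_lt_right (lt_min one_pos (div_pos (by linarith) ha0))
      rcases (trunc_nonneg ha0 (v x)).eq_or_lt with h | h
      · exfalso
        have hmin : IsLocalMin (trunc a) (v x) :=
          Filter.Eventually.of_forall fun s => by
            change trunc a (v x) ≤ trunc a s
            rw [← h]; exact trunc_nonneg ha0 s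
        exact hd.ne' (hmin.hasDerivAt_eq_zero (hasDerivAt_trunc a _))
      · exact h
    have hpos := (hcont.mono subset_closure).continuousAt (hG.mem_nhds hx)
    rw [setIntegral_eq_zero_iff_of_nonneg_ae (Filter.Eventually.of_forall fun _ => sq_nonneg _)
      (integrableOn_of_continuousOn_closure hb hcont)] at hzero
    have hev : ∀ᶠ z in nhds x, trunc a (v z) ^ 2 ≠ 0 := hpos.eventually_ne (by positivity)
    obtain ⟨d, hd, hdb⟩ := Metric.eventually_nhds_iff_ball.1 (hev.and (hG.mem_nhds hx))
    have hz : volume (Metric.ball x d) = 0 := by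
      rw [Filter.EventuallyEq, ae_restrict_iff' hG.measurableSet] at hzero
      refine measure_mono_null ?_ (mem_ae_iff.1 hzero)
      intro z hz hcon
      exact (hdb z hz).1 (hcon (hdb z hz).2)
    exact (Metric.measure_ball_pos volume x hd).ne' hz
  intro x hx
  by_cases hxG : x ∈ G
  · exact le_of_forall_gt_imp_ge_of_dense fun a ha => hin x hxG a ha
  · exact hfr x (by rw [hG.frontier_eq]; exact ⟨hx, hxG⟩)

/-! ### Positive definite forms on finite-dimensional spaces -/

/-- On a finite-dimensional space a pointwise bounded family of linear functionals is bounded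
uniformly with respect to the norm of any inner product. -/
lemma exists_bound_of_posDef {V : Type*} [AddCommGroup V] [Module ℝ V] [FiniteDimensional ℝ V]
    (B : LinearMap.BilinForm ℝ V) (hsymm : ∀ v w, B v w = B w v) (hnn : ∀ v, 0 ≤ B v v)
    (hdef : ∀ v, B v v = 0 → v = 0) {ι : Type*} (l : ι → V →ₗ[ℝ] ℝ)
    (hl : ∀ v, ∃ M, ∀ i, |l i v| ≤ M) :
    ∃ C, 0 < C ∧ ∀ i v, |l i v| ≤ C * √(B v v) := by
  let core : InnerProductSpace.Core ℝ V :=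
    { inner := fun x y => B x y
      conj_inner_symm := fun x y => by simp [hsymm y x]
      re_inner_nonneg := fun x => by simpa using hnn x
      add_left := fun x y z => by simp
      smul_left := fun x y r => by simp
      definite := hdef }
  have h1 : ∀ (b : Module.Basis (Fin (Module.finrank ℝ V)) ℝ V) i v,
      l i v = ∑ j, b.repr v j * l i (b j) := by
    intro b i v
    have h := congrArg (l i) (b.sum_repr v)
    rw [map_sum] at h
    rw [← h]
    exact Finset.sum_congr rfl fun j _ => by rw [map_smul, smul_eq_mul]
  let b := Module.finBasis ℝ V
  let : NormedAddCommGroup V := core.toNormedAddCommGroup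
  let : InnerProductSpace ℝ V := InnerProductSpace.ofCore core.toCore
  have hnorm : ∀ v : V, ‖v‖ = √(B v v) := fun v => norm_eq_sqrt_real_inner v
  choose M hM using fun i => hl (b i)
  let K : ℝ := ∑ j, |M j| * ‖LinearMap.toContinuousLinearMap (b.coord j)‖
  have hK : 0 ≤ K := Finset.sum_nonneg fun j _ => by positivity
  refine ⟨K + 1, by linarith, fun i v => ?_⟩
  rw [← hnorm]
  calc |l i v| ≤ ∑ j, |b.repr v j * l i (b j)| := by
        rw [h1 b]; exact Finset.abs_sum_le_sum_abs _ _
    _ ≤ ∑ j, |M j| * ‖LinearMap.toContinuousLinearMap (b.coord j)‖ * ‖v‖ := by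
        refine Finset.sum_le_sum fun j _ => ?_
        rw [abs_mul, mul_comm, mul_assoc]
        refine mul_le_mul ((hM j i).trans (le_abs_self _)) ?_ (abs_nonneg _) (abs_nonneg _)
        exact (LinearMap.toContinuousLinearMap (b.coord j)).le_opNorm v
    _ = K * ‖v‖ := by rw [← Finset.sum_mul]
    _ ≤ (K + 1) * ‖v‖ := by nlinarith [norm_nonneg v]

/-- Representation of linear functionals by a form that is definite on a finite-dimensional
space. -/
lemma exists_representation {V : Type*} [AddCommGroup V] [Module ℝ V] [FiniteDimensional ℝ V]
    (B : LinearMap.BilinForm ℝ V) (hdef : ∀ v, B v v = 0 → v = 0) (l : V →ₗ[ℝ] ℝ) :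
    ∃ v, ∀ w, B v w = l w := by
  have hinj : Function.Injective (B : V →ₗ[ℝ] V →ₗ[ℝ] ℝ) := by
    rw [injective_iff_map_eq_zero]
    intro v hv
    exact hdef v (by rw [hv]; rfl)
  have hsurj : Function.Surjective (B : V →ₗ[ℝ] V →ₗ[ℝ] ℝ) :=
    (LinearMap.injective_iff_surjective_of_finrank_eq_finrank
      (Subspace.dual_finrank_eq (K := ℝ) (V := V)).symm).1 hinj
  obtain ⟨v, hv⟩ := hsurj l
  exact ⟨v, fun w => by rw [hv]⟩

/-! ### Polynomial functions on the plane -/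

lemma polyFun_add (q r : MvPolynomial (Fin 2) ℝ) (x : E2) :
    polyFun (q + r) x = polyFun q x + polyFun r x := by simp [polyFun]

lemma polyFun_sub (q r : MvPolynomial (Fin 2) ℝ) (x : E2) :
    polyFun (q - r) x = polyFun q x - polyFun r x := by simp [polyFun]

lemma polyFun_mul (q r : MvPolynomial (Fin 2) ℝ) (x : E2) :
    polyFun (q * r) x = polyFun q x * polyFun r x := by simp [polyFun]

lemma polyFun_smul (s : ℝ) (q : MvPolynomial (Fin 2) ℝ) (x : E2) :
    polyFun (s • q) x = s * polyFun q x := by simp [polyFun]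

lemma polyFun_C (s : ℝ) (x : E2) : polyFun (MvPolynomial.C s) x = s := by simp [polyFun]

lemma polyFun_X (j : Fin 2) (x : E2) : polyFun (MvPolynomial.X j) x = x j := by simp [polyFun]

lemma polyFun_zero (x : E2) : polyFun 0 x = 0 := by simp [polyFun]

lemma contDiff_polyFun (q : MvPolynomial (Fin 2) ℝ) : ContDiff ℝ ∞ (polyFun q) := by
  induction q using MvPolynomial.induction_on with
  | C a =>
    rw [show polyFun (MvPolynomial.C a) = fun _ => a from funext (polyFun_C a)]
    exact contDiff_const
  | add p q hp hq =>
    rw [show polyFun (p + q) = fun x => polyFun p x + polyFun q x from funext (polyFun_add p q)]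
    exact hp.add hq
  | mul_X p i hp =>
    rw [show polyFun (p * MvPolynomial.X i) = fun x => polyFun p x * x i from
      funext fun x => by rw [polyFun_mul, polyFun_X]]
    exact hp.mul (by fun_prop)

lemma continuous_polyFun (q : MvPolynomial (Fin 2) ℝ) : Continuous (polyFun q) :=
  (contDiff_polyFun q).continuous

lemma differentiable_polyFun (q : MvPolynomial (Fin 2) ℝ) : Differentiable ℝ (polyFun q) :=
  (contDiff_polyFun q).differentiable (by simp)

lemma pd_coord (i j : Fin 2) (x : E2) : pd j (fun x : E2 => x i) x = if i = j then 1 else 0 := by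
  have : HasFDerivAt (fun x : E2 => x i) (EuclideanSpace.proj i : E2 →L[ℝ] ℝ) x :=
    (EuclideanSpace.proj i : E2 →L[ℝ] ℝ).hasFDerivAt
  unfold pd
  rw [this.fderiv]
  simp

lemma pd_polyFun (j : Fin 2) (q : MvPolynomial (Fin 2) ℝ) :
    pd j (polyFun q) = polyFun (MvPolynomial.pderiv j q) := by
  induction q using MvPolynomial.induction_on with
  | C a =>
    rw [show polyFun (MvPolynomial.C a) = fun _ => a from funext (polyFun_C a)]
    ext x
    simp [pd, polyFun_zero]
  | add p q hp hq =>
    rw [show polyFun (p + q) = fun x => polyFun p x + polyFun q x from funext (polyFun_add p q)]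
    ext x
    rw [pd_add (differentiable_polyFun p x) (differentiable_polyFun q x), hp, hq, map_add,
      polyFun_add]
  | mul_X p i hp =>
    rw [show polyFun (p * MvPolynomial.X i) = fun x => polyFun p x * x i from
      funext fun x => by rw [polyFun_mul, polyFun_X]]
    ext x
    rw [pd_mul (differentiable_polyFun p x) (by fun_prop), hp, pd_coord, MvPolynomial.pderiv_mul,
      polyFun_add, polyFun_mul, polyFun_mul, polyFun_X, MvPolynomial.pderiv_X]
    congr 2
    by_cases h : i = j
    · subst h; simp [polyFun]
    · have h' : j ≠ i := fun e => h e.symm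
      simp [h, polyFun]

/-- The Laplacian of a polynomial. -/
noncomputable def lapPoly (q : MvPolynomial (Fin 2) ℝ) : MvPolynomial (Fin 2) ℝ :=
  MvPolynomial.pderiv 0 (MvPolynomial.pderiv 0 q) + MvPolynomial.pderiv 1 (MvPolynomial.pderiv 1 q)

lemma pdMulti_two_polyFun (q : MvPolynomial (Fin 2) ℝ) (x : E2) :
    pdMulti 2 0 (polyFun q) x + pdMulti 0 2 (polyFun q) x = polyFun (lapPoly q) x := by
  change pd 0 (pd 0 (polyFun q)) x + pd 1 (pd 1 (polyFun q)) x = _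
  simp only [pd_polyFun, lapPoly, polyFun_add]

lemma totalDegree_pderiv_le {k : ℕ} {q : MvPolynomial (Fin 2) ℝ} (hq : q.totalDegree ≤ k)
    (j : Fin 2) : (MvPolynomial.pderiv j q).totalDegree ≤ k - 1 := by
  refine Finset.sup_le fun m hm => ?_
  rw [MvPolynomial.mem_support_iff, MvPolynomial.coeff_pderiv] at hm
  have h1 : m + Finsupp.single j 1 ∈ q.support := by
    rw [MvPolynomial.mem_support_iff]; exact left_ne_zero_of_mul hm
  have h2 := (MvPolynomial.le_totalDegree h1).trans hq
  rw [Finsupp.sum_add_index' (by simp) (by simp), Finsupp.sum_single_index rfl] at h2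
  omega

lemma pderiv_eq_zero_of_totalDegree {q : MvPolynomial (Fin 2) ℝ} (hq : q.totalDegree ≤ 0)
    (j : Fin 2) : MvPolynomial.pderiv j q = 0 := by
  rw [MvPolynomial.totalDegree_eq_zero_iff_eq_C.1 (Nat.le_zero.1 hq), MvPolynomial.pderiv_C]

lemma lapPoly_degree {p : ℕ} {q : MvPolynomial (Fin 2) ℝ} (hq : q.totalDegree ≤ p) :
    lapPoly q = 0 ∨ (lapPoly q).totalDegree + 2 ≤ p := by
  rcases Nat.lt_or_ge p 2 with h | h
  · left
    have h1 : ∀ j, MvPolynomial.pderiv j (MvPolynomial.pderiv j q) = 0 := fun j =>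
      pderiv_eq_zero_of_totalDegree ((totalDegree_pderiv_le hq j).trans (by omega)) j
    simp [lapPoly, h1]
  · right
    have h1 : ∀ j, (MvPolynomial.pderiv j (MvPolynomial.pderiv j q)).totalDegree ≤ p - 2 := fun j =>
      (totalDegree_pderiv_le (totalDegree_pderiv_le hq j) j).trans (by omega)
    have := (MvPolynomial.totalDegree_add (MvPolynomial.pderiv 0 (MvPolynomial.pderiv 0 q))
      (MvPolynomial.pderiv 1 (MvPolynomial.pderiv 1 q))).trans (max_le (h1 0) (h1 1))
    unfold lapPoly
    omega

/-- Integration by parts against a test function. -/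
lemma setIntegral_mul_pd_of_isTest {G : Set E2} {f φ : E2 → ℝ} (hf : ContDiff ℝ ∞ f)
    (hφ : IsTest G φ) (j : Fin 2) : ∫ x in G, f x * pd j φ x = -∫ x in G, pd j f x * φ x := by
  rw [setIntegral_eq_integral_of_tsupport (hφ.pd j).2.2 (fun x hx => by simp [hx]),
    setIntegral_eq_integral_of_tsupport hφ.2.2 (fun x hx => by simp [hx])]
  exact integral_mul_pd (hf.of_le (by simp)) (hφ.1.of_le (by simp)) hφ.2.1 j

lemma IsTest.integrable_mul {G : Set E2} {f φ : E2 → ℝ} (hf : Continuous f) (hφ : IsTest G φ) :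
    Integrable fun x => f x * φ x :=
  (hf.mul hφ.1.continuous).integrable_of_hasCompactSupport hφ.2.1.mul_left

lemma weakLap_polyFun (G : Set E2) (q : MvPolynomial (Fin 2) ℝ) :
    WeakLap G (polyFun q) (polyFun (lapPoly q)) := by
  intro φ hφ
  have hq := contDiff_polyFun q
  have h : ∀ j : Fin 2, ∫ x in G, polyFun q x * pd j (pd j φ) x =
      ∫ x in G, pd j (pd j (polyFun q)) x * φ x := by
    intro j
    rw [setIntegral_mul_pd_of_isTest hq (hφ.pd j),
      setIntegral_mul_pd_of_isTest (contDiff_pd hq j) hφ, neg_neg]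
  have e1 : ∀ x, polyFun q x * (pdMulti 2 0 φ x + pdMulti 0 2 φ x) =
      polyFun q x * pd 0 (pd 0 φ) x + polyFun q x * pd 1 (pd 1 φ) x := fun x => by
    rw [← mul_add]; rfl
  have e2 : ∀ x, polyFun (lapPoly q) x * φ x =
      pd 0 (pd 0 (polyFun q)) x * φ x + pd 1 (pd 1 (polyFun q)) x * φ x := fun x => by
    rw [← pdMulti_two_polyFun, add_mul]; rfl
  simp only [e1, e2]
  have i1 : ∀ j, Integrable (fun x => polyFun q x * pd j (pd j φ) x) (volume.restrict G) :=
    fun j => (((hφ.pd j).pd j).integrable_mul hq.continuous).integrableOn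
  have i2 : ∀ j, Integrable (fun x => pd j (pd j (polyFun q)) x * φ x) (volume.restrict G) :=
    fun j => (hφ.integrable_mul (contDiff_pd (contDiff_pd hq j) j).continuous).integrableOn
  rw [integral_add (i1 0) (i1 1), integral_add (i2 0) (i2 1), h, h]

/-- A test function has compact support, so products with functions that are integrable on `G`
are integrable. -/
lemma integrableOn_mul_of_hasCompactSupport {G : Set E2} {v φ : E2 → ℝ} (hv : IntegrableOn v G)
    (hφ : Continuous φ) (hc : HasCompactSupport φ) : IntegrableOn (fun x => v x * φ x) G := by
  obtain ⟨M, hM⟩ := hc.exists_bound_of_continuous hφ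
  exact Integrable.mul_bdd (c := M) hv hφ.aestronglyMeasurable (Filter.Eventually.of_forall hM)

lemma WeakLap.add {G : Set E2} {v w q r : E2 → ℝ} (hv : IntegrableOn v G)
    (hw : IntegrableOn w G) (hq : IntegrableOn q G) (hr : IntegrableOn r G) (h1 : WeakLap G v q)
    (h2 : WeakLap G w r) : WeakLap G (fun x => v x + w x) (fun x => q x + r x) := by
  intro φ hφ
  have hc1 := hasCompactSupport_pdMulti hφ.2.1 2 0
  have hc2 := hasCompactSupport_pdMulti hφ.2.1 0 2
  have hcc : HasCompactSupport fun x => pdMulti 2 0 φ x + pdMulti 0 2 φ x := hc1.add hc2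
  have hcont : Continuous fun x => pdMulti 2 0 φ x + pdMulti 0 2 φ x :=
    (contDiff_pdMulti hφ.1 2 0).continuous.add (contDiff_pdMulti hφ.1 0 2).continuous
  simp only [add_mul]
  rw [integral_add (integrableOn_mul_of_hasCompactSupport hv hcont hcc) (integrableOn_mul_of_hasCompactSupport hw hcont hcc),
    integral_add (integrableOn_mul_of_hasCompactSupport hq hφ.1.continuous hφ.2.1)
      (integrableOn_mul_of_hasCompactSupport hr hφ.1.continuous hφ.2.1), h1 φ hφ, h2 φ hφ]

lemma WeakLap.neg {G : Set E2} {v q : E2 → ℝ} (h : WeakLap G v q) :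
    WeakLap G (fun x => -v x) (fun x => -q x) := by
  intro φ hφ
  simp only [neg_mul, integral_neg, h φ hφ]

lemma WeakLap.mono {G H : Set E2} {v q : E2 → ℝ} (h : WeakLap G v q) (hH : H ⊆ G) :
    WeakLap H v q := by
  intro φ hφ
  have h1 := h φ ⟨hφ.1, hφ.2.1, hφ.2.2.trans hH⟩
  have hs : tsupport (fun x => pdMulti 2 0 φ x + pdMulti 0 2 φ x) ⊆ H :=
    (closure_minimal (fun x hx => by
      by_contra hx'
      apply hx
      have e1 := image_eq_zero_of_notMem_tsupport fun h => hx' (tsupport_pdMulti_subset φ 2 0 h)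
      have e2 := image_eq_zero_of_notMem_tsupport fun h => hx' (tsupport_pdMulti_subset φ 0 2 h)
      simp [e1, e2]) (isClosed_tsupport φ)).trans hφ.2.2
  rw [setIntegral_eq_integral_of_tsupport (hs.trans hH) (fun x hx => by simp [hx]),
    setIntegral_eq_integral_of_tsupport (hφ.2.2.trans hH) (fun x hx => by simp [hx])] at h1
  rw [setIntegral_eq_integral_of_tsupport hs (fun x hx => by simp [hx]),
    setIntegral_eq_integral_of_tsupport hφ.2.2 (fun x hx => by simp [hx]), h1]

lemma exists_polyFun_comp_affine {k : ℕ} {q : MvPolynomial (Fin 2) ℝ} (hq : q.totalDegree ≤ k)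
    (y : E2) (h : ℝ) : ∃ q' : MvPolynomial (Fin 2) ℝ, q'.totalDegree ≤ k ∧
      ∀ x, polyFun q' x = polyFun q (y + h • x) := by
  classical
  let L : Fin 2 → MvPolynomial (Fin 2) ℝ := fun j => MvPolynomial.C (y j) +
    MvPolynomial.C h * MvPolynomial.X j
  have hL : ∀ j, (L j).totalDegree ≤ 1 := fun j => by
    refine (MvPolynomial.totalDegree_add _ _).trans (max_le (by simp) ?_)
    refine (MvPolynomial.totalDegree_mul _ _).trans ?_
    rw [MvPolynomial.totalDegree_C, MvPolynomial.totalDegree_X]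
  refine ⟨∑ d ∈ q.support, MvPolynomial.C (q.coeff d) * ∏ j, L j ^ d j, ?_, ?_⟩
  · refine MvPolynomial.totalDegree_finsetSum_le fun d hd => ?_
    refine (MvPolynomial.totalDegree_mul _ _).trans ?_
    rw [MvPolynomial.totalDegree_C, zero_add]
    refine (MvPolynomial.totalDegree_finsetProd _ _).trans ?_
    refine (Finset.sum_le_sum (g := fun j => d j) fun j _ => ?_).trans ?_
    · refine (MvPolynomial.totalDegree_pow _ _).trans ?_
      calc d j * (L j).totalDegree ≤ d j * 1 := Nat.mul_le_mul_left _ (hL j)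
        _ = d j := mul_one _
    · refine le_trans (le_of_eq ?_) ((MvPolynomial.le_totalDegree hd).trans hq)
      rw [Finsupp.sum_fintype _ _ (by simp)]
  · intro x
    unfold polyFun
    conv_rhs => rw [MvPolynomial.eval_eq']
    rw [map_sum]
    refine Finset.sum_congr rfl fun d _ => ?_
    simp [L]

/-- A polynomial that vanishes on a disc is zero. -/
lemma eq_zero_of_polyFun_ball {q : MvPolynomial (Fin 2) ℝ} {y : E2} {r : ℝ} (hr : 0 < r)
    (h : ∀ x ∈ Metric.ball y r, polyFun q x = 0) : q = 0 := by
  have hopen : IsOpen {z : Fin 2 → ℝ | WithLp.toLp 2 z ∈ Metric.ball y r} :=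
    Metric.isOpen_ball.preimage (PiLp.continuous_toLp 2 _)
  have hmem : (fun j => y j) ∈ {z : Fin 2 → ℝ | WithLp.toLp 2 z ∈ Metric.ball y r} := by
    simpa using hr
  obtain ⟨e, he, hsub⟩ := Metric.isOpen_iff.1 hopen _ hmem
  apply MvPolynomial.funext_set (fun j => Ioo (y j - e) (y j + e))
    (fun j => Ioo_infinite (by linarith))
  intro z hz
  have hz' : z ∈ Metric.ball (fun j => y j) e := by
    rw [Metric.mem_ball, dist_pi_lt_iff he]
    intro j
    have := hz j (mem_univ j)
    rw [Real.dist_eq, abs_lt]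
    constructor <;> linarith [this.1, this.2]
  have := h _ (hsub hz')
  rw [map_zero]
  exact this

/-- The area of the unit disc. -/
noncomputable def discArea : ℝ := volume.real (Metric.ball (0 : E2) 1)

lemma discArea_pos : 0 < discArea :=
  ENNReal.toReal_pos (Metric.measure_ball_pos volume _ one_pos).ne' measure_ball_lt_top.ne

lemma volume_real_ball (y : E2) {r : ℝ} (hr : 0 ≤ r) :
    volume.real (Metric.ball y r) = r ^ 2 * discArea := by
  unfold discArea Measure.real
  rw [Measure.addHaar_ball _ _ hr, finrank_E2, ENNReal.toReal_mul,
    ENNReal.toReal_ofReal (by positivity)]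

lemma volume_real_closedBall (y : E2) {r : ℝ} (hr : 0 ≤ r) :
    volume.real (Metric.closedBall y r) = r ^ 2 * discArea := by
  unfold discArea Measure.real
  rw [Measure.addHaar_closedBall _ _ hr, finrank_E2, ENNReal.toReal_mul,
    ENNReal.toReal_ofReal (by positivity)]

lemma volume_real_le_of_subset_closedBall {G : Set E2} {y : E2} {h : ℝ} (hh : 0 ≤ h)
    (hG : G ⊆ Metric.closedBall y h) : volume.real G ≤ h ^ 2 * discArea := by
  rw [← volume_real_closedBall y hh]
  exact measureReal_mono hG measure_closedBall_lt_top.ne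

/-- The Cauchy-Schwarz inequality against the constant function. -/
lemma setIntegral_abs_le_sqrt {S : Set E2} (hS : volume S < ⊤) {f : E2 → ℝ}
    (hf : IntegrableOn f S) (hf2 : IntegrableOn (fun x => f x ^ 2) S) :
    ∫ x in S, |f x| ≤ √(volume.real S) * √(∫ x in S, f x ^ 2) := by
  have hI0 : 0 ≤ ∫ x in S, |f x| := integral_nonneg fun _ => abs_nonneg _
  have key : ∀ t : ℝ, 0 ≤ (∫ x in S, f x ^ 2) - 2 * t * (∫ x in S, |f x|) + t ^ 2 * volume.real S := by
    intro t
    have h1 : 0 ≤ ∫ x in S, (f x ^ 2 - 2 * t * |f x| + t ^ 2) :=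
      integral_nonneg fun x => by
        have := sq_nonneg (|f x| - t)
        rw [sub_sq, sq_abs] at this
        simp only [Pi.zero_apply]; linarith
    have i1 : IntegrableOn (fun x => f x ^ 2 - 2 * t * |f x|) S := hf2.sub (hf.abs.const_mul _)
    have i2 : IntegrableOn (fun _ : E2 => t ^ 2) S := integrableOn_const hS.ne
    rw [integral_add i1 i2, integral_sub hf2 (hf.abs.const_mul _), integral_const_mul, setIntegral_const, smul_eq_mul] at h1
    linarith
  have hd : (∫ x in S, |f x|) ^ 2 ≤ volume.real S * ∫ x in S, f x ^ 2 := by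
    have := discrim_le_zero (a := volume.real S) (b := -2 * ∫ x in S, |f x|)
      (c := ∫ x in S, f x ^ 2) fun t => by nlinarith [key t]
    unfold discrim at this
    nlinarith
  rw [← Real.sqrt_mul measureReal_nonneg]
  exact Real.le_sqrt_of_sq_le hd

/-! ### Scaled inverse inequalities for polynomials -/

/-- A smooth cut-off function concentrated in the disc of radius `δ`. -/
noncomputable def cutoffDisc (δ : ℝ) (hδ : 0 < δ) : ContDiffBump (0 : E2) :=
  ⟨δ / 4, δ / 2, by positivity, by linarith⟩

lemma integrable_bump_mul (b : ContDiffBump (0 : E2)) {f : E2 → ℝ} (hf : Continuous f) :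
    Integrable fun x => b x * f x :=
  (b.continuous.mul hf).integrable_of_hasCompactSupport b.hasCompactSupport.mul_right

lemma integrable_bump_mul_polyFun (b : ContDiffBump (0 : E2)) (q r : MvPolynomial (Fin 2) ℝ) :
    Integrable fun x => b x * (polyFun q x * polyFun r x) :=
  integrable_bump_mul b ((continuous_polyFun q).mul (continuous_polyFun r))

/-- The inner product on polynomials of degree at most `k` with a bump as weight. -/
noncomputable def bumpForm (b : ContDiffBump (0 : E2)) (k : ℕ) :
    LinearMap.BilinForm ℝ (MvPolynomial.restrictTotalDegree (Fin 2) ℝ k) :=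
  LinearMap.mk₂ ℝ (fun q r => ∫ x, b x * (polyFun q.1 x * polyFun r.1 x))
    (fun q q' r => by
      rw [← integral_add (integrable_bump_mul_polyFun b _ _) (integrable_bump_mul_polyFun b _ _)]
      congr 1; ext x
      rw [Submodule.coe_add, polyFun_add]; ring)
    (fun s q r => by
      rw [smul_eq_mul, ← integral_const_mul]
      congr 1; ext x
      rw [Submodule.coe_smul, polyFun_smul]; ring)
    (fun q r r' => by
      rw [← integral_add (integrable_bump_mul_polyFun b _ _) (integrable_bump_mul_polyFun b _ _)]
      congr 1; ext x
      rw [Submodule.coe_add, polyFun_add]; ring)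
    (fun s q r => by
      rw [smul_eq_mul, ← integral_const_mul]
      congr 1; ext x
      rw [Submodule.coe_smul, polyFun_smul]; ring)

lemma bumpForm_self (b : ContDiffBump (0 : E2)) {k : ℕ}
    (q : MvPolynomial.restrictTotalDegree (Fin 2) ℝ k) :
    bumpForm b k q q = ∫ x, b x * polyFun q.1 x ^ 2 := by
  unfold bumpForm
  rw [LinearMap.mk₂_apply]
  congr 1; ext x; ring

lemma bumpForm_nonneg (b : ContDiffBump (0 : E2)) {k : ℕ}
    (q : MvPolynomial.restrictTotalDegree (Fin 2) ℝ k) : 0 ≤ bumpForm b k q q := by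
  rw [bumpForm_self]
  exact integral_nonneg fun x => mul_nonneg b.nonneg (sq_nonneg _)

lemma bumpForm_definite (b : ContDiffBump (0 : E2)) {k : ℕ}
    (q : MvPolynomial.restrictTotalDegree (Fin 2) ℝ k) (h : bumpForm b k q q = 0) : q = 0 := by
  rw [bumpForm_self] at h
  have hc : Continuous fun x => b x * polyFun q.1 x ^ 2 :=
    b.continuous.mul ((continuous_polyFun _).pow 2)
  rw [integral_eq_zero_iff_of_nonneg (fun x => mul_nonneg b.nonneg (sq_nonneg _))
    (integrable_bump_mul b ((continuous_polyFun _).pow 2))] at h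
  have h0 := (hc.ae_eq_iff_eq volume continuous_const).1 h
  apply Subtype.ext
  apply eq_zero_of_polyFun_ball (y := 0) b.rIn_pos
  intro x hx
  have h1 : b x * polyFun q.1 x ^ 2 = 0 := congrFun h0 x
  rw [b.one_of_mem_closedBall (Metric.ball_subset_closedBall hx), one_mul] at h1
  exact pow_eq_zero_iff (two_ne_zero) |>.1 h1

lemma exists_bumpForm_bound (b : ContDiffBump (0 : E2)) (k : ℕ) {ι : Type*}
    (l : ι → MvPolynomial.restrictTotalDegree (Fin 2) ℝ k →ₗ[ℝ] ℝ)
    (hl : ∀ v, ∃ M, ∀ i, |l i v| ≤ M) :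
    ∃ C, 0 < C ∧ ∀ i v, |l i v| ≤ C * √(∫ x, b x * polyFun v.1 x ^ 2) := by
  obtain ⟨C, hC, h⟩ := exists_bound_of_posDef (bumpForm b k)
    (fun v w => by
      unfold bumpForm
      rw [LinearMap.mk₂_apply, LinearMap.mk₂_apply]
      congr 1; ext x; ring) (bumpForm_nonneg b)
    (bumpForm_definite b) l hl
  exact ⟨C, hC, fun i v => by rw [← bumpForm_self]; exact h i v⟩

/-- Evaluation of a polynomial of degree at most `k` at a point. -/
noncomputable def evalPoly (k : ℕ) (x : E2) :
    MvPolynomial.restrictTotalDegree (Fin 2) ℝ k →ₗ[ℝ] ℝ where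
  toFun q := polyFun q.1 x
  map_add' q r := by rw [Submodule.coe_add, polyFun_add]
  map_smul' s q := by rw [Submodule.coe_smul, polyFun_smul]; rfl

/-- Evaluation of a partial derivative of a polynomial of degree at most `k` at a point. -/
noncomputable def evalPderiv (k : ℕ) (j : Fin 2) (x : E2) :
    MvPolynomial.restrictTotalDegree (Fin 2) ℝ k →ₗ[ℝ] ℝ where
  toFun q := polyFun (MvPolynomial.pderiv j q.1) x
  map_add' q r := by rw [Submodule.coe_add, map_add, polyFun_add]
  map_smul' s q := by rw [Submodule.coe_smul, Derivation.map_smul, polyFun_smul]; rfl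

lemma exists_abs_polyFun_le (q : MvPolynomial (Fin 2) ℝ) (R : ℝ) :
    ∃ M, ∀ i : Metric.closedBall (0 : E2) R, |polyFun q i| ≤ M := by
  obtain ⟨M, hM⟩ := (isCompact_closedBall (0 : E2) R).exists_bound_of_continuousOn
    (continuous_polyFun q).continuousOn
  exact ⟨M, fun i => hM i i.2⟩

/-- Inverse inequality: values and first derivatives of a polynomial on a disc of radius `h` are
controlled by its `L²` norm on the concentric disc of radius `δ h`. -/
lemma exists_poly_inverse (k : ℕ) {δ : ℝ} (hδ : 0 < δ) :
    ∃ C, 0 < C ∧ ∀ (y : E2) (h : ℝ), 0 < h → ∀ q : MvPolynomial (Fin 2) ℝ, q.totalDegree ≤ k →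
      ∀ x ∈ Metric.closedBall y h,
        |polyFun q x| ≤ C / h * √(∫ x in Metric.ball y (δ * h), polyFun q x ^ 2) ∧
        ∀ j, |polyFun (MvPolynomial.pderiv j q) x| ≤
          C / h ^ 2 * √(∫ x in Metric.ball y (δ * h), polyFun q x ^ 2) := by
  let b := cutoffDisc δ hδ
  obtain ⟨C1, hC1, h1⟩ := exists_bumpForm_bound b k
    (fun x : Metric.closedBall (0 : E2) 1 => evalPoly k x)
    fun q => exists_abs_polyFun_le q.1 1
  have h2 := fun j : Fin 2 => exists_bumpForm_bound b k
    (fun x : Metric.closedBall (0 : E2) 1 => evalPderiv k j x)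
    fun q => exists_abs_polyFun_le (MvPolynomial.pderiv j q.1) 1
  choose C2 hC2 h2 using h2
  refine ⟨C1 + C2 0 + C2 1, by linarith [hC2 0, hC2 1], ?_⟩
  intro y h hh q hq x hx
  obtain ⟨q', hq', hqq'⟩ := exists_polyFun_comp_affine hq y h
  let Q : MvPolynomial.restrictTotalDegree (Fin 2) ℝ k :=
    ⟨q', (MvPolynomial.mem_restrictTotalDegree _ _ _).2 hq'⟩
  have hxm : h⁻¹ • (x - y) ∈ Metric.closedBall (0 : E2) 1 := by
    rw [mem_closedBall_zero_iff, norm_smul, Real.norm_eq_abs, abs_of_pos (by positivity),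
      inv_mul_le_iff₀ hh, mul_one, ← dist_eq_norm]
    exact hx
  -- comparison of the reference norm with the `L²` norm on the small disc
  have hnorm : √(∫ x, b x * polyFun q' x ^ 2) ≤
      h⁻¹ * √(∫ x in Metric.ball y (δ * h), polyFun q x ^ 2) := by
    have e1 : ∫ x in Metric.ball y (δ * h), polyFun q x ^ 2 =
        h ^ 2 * ∫ x in Metric.ball (0 : E2) δ, polyFun q' x ^ 2 := by
      rw [← integral_indicator measurableSet_ball, ← integral_indicator measurableSet_ball,
        ← integral_add_left_eq_self _ y]
      have := integral_comp_smul_E2 (fun x => (Metric.ball y (δ * h)).indicator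
        (fun x => polyFun q x ^ 2) (y + x)) hh
      rw [inv_mul_eq_div, eq_div_iff (by positivity), mul_comm] at this
      rw [← this]
      congr 2; ext x
      have : y + h • x ∈ Metric.ball y (δ * h) ↔ x ∈ Metric.ball (0 : E2) δ := by
        rw [mem_ball_iff_norm, mem_ball_zero_iff, add_sub_cancel_left, norm_smul, Real.norm_eq_abs,
          abs_of_pos hh, mul_comm δ, mul_lt_mul_iff_right₀ hh]
      by_cases hx : x ∈ Metric.ball (0 : E2) δ
      · rw [indicator_of_mem (this.2 hx), indicator_of_mem hx, hqq']
      · rw [indicator_of_notMem (fun h => hx (this.1 h)), indicator_of_notMem hx]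
    rw [e1, Real.sqrt_mul (by positivity), Real.sqrt_sq hh.le, inv_mul_cancel_left₀ hh.ne']
    apply Real.sqrt_le_sqrt
    rw [← integral_indicator measurableSet_ball]
    refine integral_mono (integrable_bump_mul b ((continuous_polyFun _).pow 2)) ?_ ?_
    · rw [integrable_indicator_iff measurableSet_ball]
      exact (((continuous_polyFun q').pow 2).continuousOn.integrableOn_compact
        (isCompact_closedBall 0 δ)).mono_set Metric.ball_subset_closedBall
    · intro x
      by_cases hx : x ∈ Metric.ball (0 : E2) δ
      · simp only [indicator_of_mem hx]
        nlinarith [b.le_one (x := x), sq_nonneg (polyFun q' x)]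
      · simp only [indicator_of_notMem hx]
        have : b x = 0 := b.zero_of_le_dist (by
          have : δ ≤ dist x 0 := not_lt.1 hx
          change δ / 2 ≤ dist x 0
          linarith)
        simp [this]
  have hxe : y + h • (h⁻¹ • (x - y)) = x := by
    rw [smul_smul, mul_inv_cancel₀ hh.ne', one_smul]; abel
  have hder : ∀ j, polyFun (MvPolynomial.pderiv j q') (h⁻¹ • (x - y)) =
      h * polyFun (MvPolynomial.pderiv j q) x := by
    intro j
    rw [← pd_polyFun, ← pd_polyFun]
    have e : polyFun q' = fun x => polyFun q (h • (x - (-(h⁻¹ • y)))) := by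
      ext z; rw [hqq']; congr 1
      rw [sub_neg_eq_add, smul_add, smul_smul, mul_inv_cancel₀ hh.ne', one_smul, add_comm]
    rw [e, pd_comp_affine]
    simp only
    congr 2
    rw [sub_neg_eq_add, ← smul_add, smul_smul, mul_inv_cancel₀ hh.ne', one_smul]; abel
  have hs := Real.sqrt_nonneg (∫ x in Metric.ball y (δ * h), polyFun q x ^ 2)
  constructor
  · have := h1 ⟨_, hxm⟩ Q
    change |polyFun q' (h⁻¹ • (x - y))| ≤ _ at this
    rw [hqq', hxe] at this
    refine this.trans ?_
    calc C1 * √(∫ x, b x * polyFun q' x ^ 2)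
        ≤ C1 * (h⁻¹ * √(∫ x in Metric.ball y (δ * h), polyFun q x ^ 2)) := by gcongr
      _ = C1 / h * √(∫ x in Metric.ball y (δ * h), polyFun q x ^ 2) := by ring
      _ ≤ _ := by
        gcongr
        linarith [hC2 0, hC2 1]
  · intro j
    have := h2 j ⟨_, hxm⟩ Q
    change |polyFun (MvPolynomial.pderiv j q') (h⁻¹ • (x - y))| ≤ _ at this
    rw [hder, abs_mul, abs_of_pos hh] at this
    have h3 : h * |polyFun (MvPolynomial.pderiv j q) x| ≤
        C2 j * (h⁻¹ * √(∫ x in Metric.ball y (δ * h), polyFun q x ^ 2)) :=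
      this.trans (by gcongr; exact (hC2 j).le)
    have h4 : |polyFun (MvPolynomial.pderiv j q) x| ≤
        C2 j / h ^ 2 * √(∫ x in Metric.ball y (δ * h), polyFun q x ^ 2) := by
      rw [← le_div_iff₀' hh] at h3
      refine h3.trans (le_of_eq ?_)
      field_simp
    refine h4.trans ?_
    gcongr
    fin_cases j
    · simp only [Fin.zero_eta]; linarith [hC2 1]
    · simp only [Fin.mk_one]; linarith [hC2 0]

/-! ### The polynomial Laplacian is controlled by the function -/

lemma pd_pd_add {f g : E2 → ℝ} (hf : ContDiff ℝ ∞ f) (hg : ContDiff ℝ ∞ g) (i j : Fin 2) :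
    pd i (pd j fun x => f x + g x) = fun x => pd i (pd j f) x + pd i (pd j g) x := by
  have h1 : (pd j fun x => f x + g x) = fun x => pd j f x + pd j g x := funext fun x =>
    pd_add (hf.differentiable (by simp) x) (hg.differentiable (by simp) x) j
  rw [h1]
  exact funext fun x => pd_add ((contDiff_pd hf j).differentiable (by simp) x)
    ((contDiff_pd hg j).differentiable (by simp) x) i

lemma contDiff_bump_mul_polyFun (b : ContDiffBump (0 : E2)) (q : MvPolynomial (Fin 2) ℝ) :
    ContDiff ℝ ∞ fun x => b x * polyFun q x :=
  b.contDiff.mul (contDiff_polyFun q)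

/-- The Laplacian at `x` of a polynomial of degree at most `k` multiplied by a bump. -/
noncomputable def evalLapBump (b : ContDiffBump (0 : E2)) (k : ℕ) (x : E2) :
    MvPolynomial.restrictTotalDegree (Fin 2) ℝ k →ₗ[ℝ] ℝ where
  toFun q := pd 0 (pd 0 fun x => b x * polyFun q.1 x) x + pd 1 (pd 1 fun x => b x * polyFun q.1 x) x
  map_add' q r := by
    have h : (fun x => b x * polyFun (q + r).1 x) =
        fun x => b x * polyFun q.1 x + b x * polyFun r.1 x := by
      ext x; rw [Submodule.coe_add, polyFun_add]; ring
    rw [h, pd_pd_add (contDiff_bump_mul_polyFun b _) (contDiff_bump_mul_polyFun b _),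
      pd_pd_add (contDiff_bump_mul_polyFun b _) (contDiff_bump_mul_polyFun b _)]
    ring
  map_smul' s q := by
    have h : (fun x => b x * polyFun (s • q).1 x) = fun x => s * (b x * polyFun q.1 x) := by
      ext x; rw [Submodule.coe_smul, polyFun_smul]; ring
    rw [h]
    simp only [pd_const_mul, RingHom.id_apply, smul_eq_mul]
    ring

/-- If the distributional Laplacian of `v` is a polynomial, then its size is controlled by the
`L²` norm of `v`: test the equation with the polynomial itself times a bump. -/
lemma exists_weakLap_bound (k : ℕ) {δ : ℝ} (hδ : 0 < δ) :
    ∃ C, 0 < C ∧ ∀ (y : E2) (h : ℝ), 0 < h → ∀ q : MvPolynomial (Fin 2) ℝ, q.totalDegree ≤ k →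
      ∀ G : Set E2, IsOpen G → Bornology.IsBounded G → Metric.ball y (δ * h) ⊆ G →
      ∀ v : E2 → ℝ, ContinuousOn v (closure G) → WeakLap G v (polyFun q) →
      ∀ x ∈ Metric.closedBall y h, |polyFun q x| ≤ C / h ^ 3 * √(∫ x in G, v x ^ 2) := by
  let b := cutoffDisc δ hδ
  obtain ⟨C1, hC1, h1⟩ := exists_bumpForm_bound b k
    (fun x : Metric.closedBall (0 : E2) 1 => evalPoly k x)
    fun q => exists_abs_polyFun_le q.1 1
  obtain ⟨C2, hC2, h2⟩ := exists_bumpForm_bound b k (fun x : E2 => evalLapBump b k x) fun q => by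
    have hc := contDiff_bump_mul_polyFun b q.1
    have hs : HasCompactSupport fun x => b x * polyFun q.1 x := b.hasCompactSupport.mul_right
    obtain ⟨M, hM⟩ := ((hasCompactSupport_pd (hasCompactSupport_pd hs 0) 0).add
      (hasCompactSupport_pd (hasCompactSupport_pd hs 1) 1)).exists_bound_of_continuous
      ((contDiff_pd (contDiff_pd hc 0) 0).continuous.add
        (contDiff_pd (contDiff_pd hc 1) 1).continuous)
    exact ⟨M, hM⟩
  have hω := Real.sqrt_pos.2 discArea_pos
  refine ⟨C1 * (C2 * δ * √discArea), by positivity, ?_⟩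
  intro y h hh q hq G hGo hGb hball v hv hvq x hx
  obtain ⟨q', hq', hqq'⟩ := exists_polyFun_comp_affine hq y h
  let Q : MvPolynomial.restrictTotalDegree (Fin 2) ℝ k :=
    ⟨q', (MvPolynomial.mem_restrictTotalDegree _ _ _).2 hq'⟩
  have hxe : ∀ x : E2, y + h • (h⁻¹ • (x - y)) = x := fun x => by
    rw [smul_smul, mul_inv_cancel₀ hh.ne', one_smul]; abel
  have hxm : h⁻¹ • (x - y) ∈ Metric.closedBall (0 : E2) 1 := by
    rw [mem_closedBall_zero_iff, norm_smul, Real.norm_eq_abs, abs_of_pos (by positivity),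
      inv_mul_le_iff₀ hh, mul_one, ← dist_eq_norm]
    exact hx
  set β := ∫ x, b x * polyFun q' x ^ 2 with hβ
  have hβ0 : 0 ≤ β := integral_nonneg fun x => mul_nonneg b.nonneg (sq_nonneg _)
  set F : E2 → ℝ := fun x => b x * polyFun q' x with hF
  have hFc : ContDiff ℝ ∞ F := contDiff_bump_mul_polyFun b q'
  set φ : E2 → ℝ := fun x => F (h⁻¹ • (x - y)) with hφ
  have hφsupp : tsupport φ ⊆ Metric.ball y (δ * h) := by
    refine subset_trans (closure_minimal (t := Metric.closedBall y (δ / 2 * h)) ?_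
      Metric.isClosed_closedBall) (Metric.closedBall_subset_ball (by nlinarith))
    intro z hz
    have hb : b (h⁻¹ • (z - y)) ≠ 0 := fun h0 => hz (by simp [hφ, hF, h0])
    have hb' : h⁻¹ • (z - y) ∈ Metric.ball (0 : E2) (δ / 2) := by
      have := b.support_eq
      have hm : h⁻¹ • (z - y) ∈ Function.support b := hb
      rw [this] at hm
      exact hm
    rw [mem_ball_zero_iff, norm_smul, Real.norm_eq_abs, abs_of_pos (by positivity),
      inv_mul_lt_iff₀ hh] at hb'
    rw [mem_closedBall_iff_norm]
    linarith
  have hφtest : IsTest G φ := ⟨hFc.comp ((contDiff_id.sub contDiff_const).const_smul h⁻¹),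
    (isCompact_closedBall y (δ * h)).of_isClosed_subset (isClosed_tsupport _)
      (hφsupp.trans Metric.ball_subset_closedBall), hφsupp.trans hball⟩
  have hpp : ∀ j z, pd j (pd j φ) z = (h⁻¹) ^ 2 * pd j (pd j F) (h⁻¹ • (z - y)) := by
    intro j z
    rw [hφ, pd_comp_affine, pd_const_mul, pd_comp_affine]
    ring
  have hlap : ∀ z, |pdMulti 2 0 φ z + pdMulti 0 2 φ z| ≤ (h⁻¹) ^ 2 * (C2 * √β) := by
    intro z
    change |pd 0 (pd 0 φ) z + pd 1 (pd 1 φ) z| ≤ _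
    rw [hpp, hpp, ← mul_add, abs_mul, abs_of_pos (by positivity : (0:ℝ) < (h⁻¹) ^ 2)]
    exact mul_le_mul_of_nonneg_left (h2 (h⁻¹ • (z - y)) Q) (by positivity)
  have hmain := hvq φ hφtest
  have hright : ∫ x in G, polyFun q x * φ x = h ^ 2 * β := by
    rw [setIntegral_eq_integral_of_tsupport hφtest.2.2 (fun x hx => by simp [hx])]
    have e1 : ∀ x, polyFun q x * φ x = (fun z => b z * polyFun q' z ^ 2) (h⁻¹ • (x - y)) := by
      intro z
      simp only [hφ, hF]
      rw [hqq', hxe]; ring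
    simp only [e1]
    rw [integral_sub_right_eq_self (fun x => b (h⁻¹ • x) * polyFun q' (h⁻¹ • x) ^ 2) y,
      integral_comp_smul_E2 (fun z => b z * polyFun q' z ^ 2) (inv_pos.2 hh)]
    rw [inv_pow, inv_inv]
  set S := Metric.ball y (δ * h)
  have hvi : IntegrableOn v G := integrableOn_of_continuousOn_closure hGb hv
  have hv2 : IntegrableOn (fun x => v x ^ 2) G := integrableOn_of_continuousOn_closure hGb (hv.pow 2)
  have hleft : |∫ x in G, v x * (pdMulti 2 0 φ x + pdMulti 0 2 φ x)| ≤
      (h⁻¹) ^ 2 * (C2 * √β) * (√((δ * h) ^ 2 * discArea) * √(∫ x in G, v x ^ 2)) := by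
    rw [setIntegral_eq_of_subset_of_forall_sdiff_eq_zero hGo.measurableSet hball]
    · calc |∫ x in S, v x * (pdMulti 2 0 φ x + pdMulti 0 2 φ x)|
          ≤ ∫ x in S, (h⁻¹) ^ 2 * (C2 * √β) * |v x| := by
            rw [← Real.norm_eq_abs]
            refine norm_integral_le_of_norm_le ((hvi.mono_set hball).abs.const_mul _)
              (Filter.Eventually.of_forall fun x => ?_)
            rw [Real.norm_eq_abs, abs_mul, mul_comm]
            exact mul_le_mul_of_nonneg_right (hlap x) (abs_nonneg _)
        _ = (h⁻¹) ^ 2 * (C2 * √β) * ∫ x in S, |v x| := integral_const_mul _ _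
        _ ≤ (h⁻¹) ^ 2 * (C2 * √β) * (√(volume.real S) * √(∫ x in S, v x ^ 2)) := by
            gcongr
            exact setIntegral_abs_le_sqrt measure_ball_lt_top (hvi.mono_set hball)
              (hv2.mono_set hball)
        _ ≤ _ := by
            rw [volume_real_ball y (by positivity)]
            gcongr
            · exact Filter.Eventually.of_forall fun x => sq_nonneg _
    · intro z hz
      have h0 : ∀ a b, pdMulti a b φ z = 0 := fun a b => image_eq_zero_of_notMem_tsupport fun h' =>
        hz.2 (hφsupp (tsupport_pdMulti_subset φ a b h'))
      simp [h0]
  rw [hmain, hright, abs_of_nonneg (by positivity), Real.sqrt_mul (by positivity),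
    Real.sqrt_sq (by positivity)] at hleft
  have hsβ : √β ≤ C2 * δ * √discArea / h ^ 3 * √(∫ x in G, v x ^ 2) := by
    rcases (Real.sqrt_nonneg β).eq_or_lt with h0 | h0
    · rw [← h0]; positivity
    · have e : h ^ 2 * β = h ^ 2 * √β * √β := by rw [mul_assoc, Real.mul_self_sqrt hβ0]
      rw [e] at hleft
      have : h ^ 2 * √β ≤ (h⁻¹) ^ 2 * C2 * (δ * h * √discArea * √(∫ x in G, v x ^ 2)) := by
        refine le_of_mul_le_mul_right ?_ h0
        linarith
      have h3 : √β ≤ ((h⁻¹) ^ 2 * C2 * (δ * h * √discArea * √(∫ x in G, v x ^ 2))) / h ^ 2 := by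
        rw [le_div_iff₀ (by positivity)]; linarith
      refine h3.trans (le_of_eq ?_)
      field_simp
  have := h1 ⟨_, hxm⟩ Q
  change |polyFun q' (h⁻¹ • (x - y))| ≤ C1 * √β at this
  rw [hqq', hxe] at this
  calc |polyFun q x| ≤ C1 * √β := this
    _ ≤ C1 * (C2 * δ * √discArea / h ^ 3 * √(∫ x in G, v x ^ 2)) := by gcongr
    _ = _ := by ring

/-! ### Domains that are star-shaped with respect to a disc -/

/-- `G` is a non-empty open set inside the disc of radius `h` about `y`, star-shaped with respect to
every point of the disc of radius `r` about `y`. -/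
structure StarDisc (G : Set E2) (y : E2) (h r : ℝ) : Prop where
  isOpen : IsOpen G
  nonempty : G.Nonempty
  h_pos : 0 < h
  r_pos : 0 < r
  star : ∀ z ∈ Metric.ball y r, StarConvex ℝ z G
  subset : G ⊆ Metric.closedBall y h

/-- The image of `G` under the dilation with centre `y` and ratio `a`. -/
def dil (y : E2) (a : ℝ) (G : Set E2) : Set E2 := {x | y + a⁻¹ • (x - y) ∈ G}

namespace StarDisc

variable {G : Set E2} {y : E2} {h r : ℝ}

lemma ball_subset (S : StarDisc G y h r) : Metric.ball y r ⊆ G := fun z hz => by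
  obtain ⟨x, hx⟩ := S.nonempty
  exact S.star z hz hx zero_le_one le_rfl (by norm_num) |> fun h => by simpa using h

lemma isBounded (S : StarDisc G y h r) : Bornology.IsBounded G :=
  Metric.isBounded_closedBall.subset S.subset

lemma isOpen_dil (S : StarDisc G y h r) (a : ℝ) : IsOpen (dil y a G) :=
  S.isOpen.preimage (by fun_prop)

lemma add_mem_dil (S : StarDisc G y h r) {a b : ℝ} (ha : 0 < a) (hab : a < b) {x e : E2}
    (hx : x ∈ dil y a G) (he : ‖e‖ < (b - a) * r) : x + e ∈ dil y b G := by
  have hb : 0 < b := ha.trans hab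
  have hba : 0 < b - a := by linarith
  have hz : y + (b - a)⁻¹ • e ∈ Metric.ball y r := by
    rw [mem_ball_iff_norm, add_sub_cancel_left, norm_smul, Real.norm_eq_abs,
      abs_of_pos (by positivity), inv_mul_lt_iff₀ hba]
    exact he
  have := S.star _ hz hx (a := 1 - a / b) (b := a / b)
    (by rw [sub_nonneg, div_le_one hb]; exact hab.le) (by positivity) (by ring)
  change y + b⁻¹ • (x + e - y) ∈ G
  convert this using 1
  have e1 : (1 - a / b) * (b - a)⁻¹ = b⁻¹ := by field_simp
  have e2 : a / b * a⁻¹ = b⁻¹ := by field_simp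
  rw [smul_add, smul_add, smul_smul, smul_smul, e1, e2, sub_smul, one_smul, add_sub_assoc,
    add_comm x, smul_sub, smul_add, smul_sub]
  abel_nf

lemma dil_subset_dil (S : StarDisc G y h r) {a b : ℝ} (ha : 0 < a) (hab : a ≤ b) :
    dil y a G ⊆ dil y b G := by
  rcases hab.eq_or_lt with rfl | hab
  · exact subset_rfl
  · intro x hx
    have := S.add_mem_dil ha hab hx (e := 0) (by
      rw [norm_zero]; exact mul_pos (by linarith) S.r_pos)
    simpa using this

lemma dil_one : dil y 1 G = G := by
  ext x; simp [dil]

lemma dil_subset (S : StarDisc G y h r) {a : ℝ} (ha : 0 < a) (ha1 : a ≤ 1) : dil y a G ⊆ G := by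
  have := S.dil_subset_dil ha ha1
  rwa [dil_one] at this

lemma closedBall_subset_dil (S : StarDisc G y h r) {a b ε : ℝ} (ha : 0 < a) (hab : a < b)
    (hε : ε < (b - a) * r) {x : E2} (hx : x ∈ dil y a G) :
    Metric.closedBall x ε ⊆ dil y b G := by
  intro z hz
  have := S.add_mem_dil ha hab hx (e := z - x) (lt_of_le_of_lt (mem_closedBall_iff_norm.1 hz) hε)
  simpa using this

lemma closure_dil_subset (S : StarDisc G y h r) {a b : ℝ} (ha : 0 < a) (hab : a < b) :
    closure (dil y a G) ⊆ dil y b G := by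
  intro z hz
  obtain ⟨x, hx, hxz⟩ := Metric.mem_closure_iff.1 hz ((b - a) * r / 2)
    (by have := mul_pos (sub_pos.2 hab) S.r_pos; positivity)
  refine S.closedBall_subset_dil ha hab (ε := (b - a) * r / 2) ?_ hx (Metric.mem_closedBall.2 hxz.le)
  have := mul_pos (sub_pos.2 hab) S.r_pos
  linarith

lemma exists_subset_dil (S : StarDisc G y h r) {K : Set E2} (hK : IsCompact K) (hKG : K ⊆ G) :
    ∃ a, 0 < a ∧ a < 1 ∧ K ⊆ dil y a G := by
  have : Nonempty (Ioo (0 : ℝ) 1) := ⟨⟨1 / 2, by norm_num, by norm_num⟩⟩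
  have hcov : K ⊆ ⋃ a : Ioo (0 : ℝ) 1, dil y a G := by
    intro x hx
    have hc : ContinuousAt (fun a : ℝ => y + a⁻¹ • (x - y)) 1 := by
      have : ContinuousAt (fun a : ℝ => a⁻¹) 1 := continuousAt_inv₀ one_ne_zero
      fun_prop
    have hmem : G ∈ nhds (y + (1 : ℝ)⁻¹ • (x - y)) := by
      simpa using S.isOpen.mem_nhds (hKG hx)
    have h1 : ∀ᶠ a in nhdsWithin (1 : ℝ) (Iio 1), y + a⁻¹ • (x - y) ∈ G :=
      (hc.eventually hmem).filter_mono nhdsWithin_le_nhds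
    have h2 : ∀ᶠ a in nhdsWithin (1 : ℝ) (Iio 1), a ∈ Ioo (0 : ℝ) 1 := Ioo_mem_nhdsLT zero_lt_one
    obtain ⟨a, ha1, ha2⟩ := (h1.and h2).exists
    exact mem_iUnion.2 ⟨⟨a, ha2⟩, ha1⟩
  have hdir : Directed (· ⊆ ·) fun a : Ioo (0 : ℝ) 1 => dil y a G := by
    intro a b
    rcases le_total a.1 b.1 with hab | hab
    · exact ⟨b, S.dil_subset_dil a.2.1 hab, subset_rfl⟩
    · exact ⟨a, subset_rfl, S.dil_subset_dil b.2.1 hab⟩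
  obtain ⟨a, ha⟩ := hK.elim_directed_cover (fun a : Ioo (0 : ℝ) 1 => dil y a G)
    (fun a => S.isOpen_dil a) hcov hdir
  exact ⟨a, a.2.1, a.2.2, ha⟩

lemma volume_lt_top (S : StarDisc G y h r) : volume G < ⊤ := S.isBounded.measure_lt_top

lemma volume_real_le (S : StarDisc G y h r) : volume.real G ≤ h ^ 2 * discArea :=
  volume_real_le_of_subset_closedBall S.h_pos.le S.subset

open scoped Pointwise in
lemma volume_real_dil (G : Set E2) (y : E2) {a : ℝ} (ha : 0 < a) :
    volume.real (dil y a G) = a ^ 2 * volume.real G := by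
  have e : dil y a G = (fun x => y + x) '' (a • ((fun x => -y + x) '' G)) := by
    ext x
    simp only [dil, mem_ofPred_eq, image_add_left, mem_preimage, neg_neg]
    rw [Set.mem_smul_set_iff_inv_smul_mem₀ ha.ne', mem_preimage, ← sub_eq_neg_add]
  unfold Measure.real
  rw [e, image_add_left, measure_preimage_add, Measure.addHaar_smul, image_add_left,
    measure_preimage_add, finrank_E2, ENNReal.toReal_mul, ENNReal.toReal_ofReal (abs_nonneg _),
    abs_of_pos (by positivity)]

/-- Cut-off functions whose gradients have an `L¹` norm bounded in terms of the size of the domain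
only: mollify the indicator function of a slightly shrunk copy of the domain. -/
lemma exists_cutoff : ∃ C, 0 < C ∧ ∀ (G : Set E2) (y : E2) (h r : ℝ), StarDisc G y h r →
    ∀ K, IsCompact K → K ⊆ G → ∃ η, IsTest G η ∧ (∀ x, 0 ≤ η x ∧ η x ≤ 1) ∧
      (∀ x ∈ K, η x = 1 ∧ ∀ j, pd j η x = 0) ∧ ∀ j, ∫ x, |pd j η x| ≤ C * h ^ 2 / r := by
  have hc0 : ∀ j, 0 ≤ ∫ x, |pd j moll0 x| := fun j => integral_nonneg fun x => abs_nonneg _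
  have hω := discArea_pos
  refine ⟨16 * ((∫ x, |pd 0 moll0 x|) + (∫ x, |pd 1 moll0 x|) + 1) * discArea,
    by have := hc0 0; have := hc0 1; positivity, ?_⟩
  intro G y h r S K hK hKG
  obtain ⟨a, ha, ha1, hKa⟩ := S.exists_subset_dil hK hKG
  have hr := S.r_pos
  have h1a : 0 < 1 - a := by linarith
  have hra : 0 < (1 - a) * r := mul_pos h1a hr
  set b := (a + 1) / 2 with hb
  set b' := (b + 1) / 2 with hb'
  set ε := (1 - a) * r / 8 with hε
  have hεpos : 0 < ε := by positivity
  set A := dil y b G with hA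
  have hAm : MeasurableSet A := (S.isOpen_dil b).measurableSet
  have hAG : A ⊆ G := S.dil_subset (by linarith) (by linarith)
  have hAi : Integrable (A.indicator fun _ => (1 : ℝ)) :=
    (integrable_indicator_iff hAm).2
      (integrableOn_const ((measure_mono hAG).trans_lt S.volume_lt_top).ne)
  set η := conv (moll ε) (A.indicator fun _ => (1 : ℝ)) with hη
  have hηc : ContDiff ℝ ∞ η :=
    conv_contDiff (moll_hasCompactSupport hεpos) (moll_contDiff ε) hAi.locallyIntegrable
  have hone : ∀ x ∈ dil y a G, η x = 1 := by
    intro x hx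
    have := conv_moll_dist_le hAi.aestronglyMeasurable hεpos (x := x) (z := 1) (η := 0) le_rfl ?_
    · exact sub_eq_zero.1 (abs_eq_zero.1 (le_antisymm this (abs_nonneg _)))
    · intro t ht
      have : t ∈ A := S.closedBall_subset_dil ha (b := b) (by linarith) (ε := ε) (by
        rw [hε, hb]; nlinarith) hx (Metric.ball_subset_closedBall ht)
      simp [this]
  have hsupp : Function.support η ⊆ dil y b' G := by
    intro x hx
    by_contra hxb
    apply hx
    have := conv_moll_dist_le hAi.aestronglyMeasurable hεpos (x := x) (z := 0) (η := 0) le_rfl ?_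
    · exact sub_eq_zero.1 (abs_eq_zero.1 (le_antisymm this (abs_nonneg _)))
    · intro t ht
      have : t ∉ A := fun htA => hxb (S.closedBall_subset_dil (by linarith) (b := b') (by linarith)
        (ε := ε) (by rw [hε, hb', hb]; nlinarith) htA (by
          rw [Metric.mem_closedBall, dist_comm]; exact (Metric.mem_ball.1 ht).le))
      simp [this]
  have htsupp : tsupport η ⊆ G := by
    have := (closure_mono hsupp).trans (S.closure_dil_subset (a := b') (b := 1) (by linarith)
      (by linarith))
    rwa [dil_one] at this
  have htest : IsTest G η := ⟨hηc, (Metric.isCompact_of_isClosed_isBounded (isClosed_tsupport _)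
    (S.isBounded.subset htsupp)), htsupp⟩
  have hpd0 : ∀ x ∈ dil y a G, ∀ j, pd j η x = 0 := by
    intro x hx j
    have : η =ᶠ[nhds x] fun _ => 1 := by
      filter_upwards [(S.isOpen_dil a).mem_nhds hx] with z hz using hone z hz
    unfold pd
    rw [this.fderiv_eq]; simp
  have hpd : ∀ j x, |pd j η x| ≤ ε⁻¹ * ∫ x, |pd j moll0 x| := by
    intro j x
    rw [hη, pd_conv (moll_hasCompactSupport hεpos) (moll_contDiff ε) hAi.locallyIntegrable,
      ← integral_abs_pd_moll hεpos, conv_apply, ← Real.norm_eq_abs]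
    have hcs := hasCompactSupport_pd (moll_hasCompactSupport hεpos) j
    have hcc := (contDiff_pd (moll_contDiff ε) j).continuous
    refine norm_integral_le_of_norm_le (hcc.integrable_of_hasCompactSupport hcs).abs
      (Filter.Eventually.of_forall fun t => ?_)
    rw [Real.norm_eq_abs, abs_mul]
    refine mul_le_of_le_one_right (abs_nonneg _) ?_
    by_cases ht : x - t ∈ A <;> simp [ht]
  refine ⟨η, htest, ?_, fun x hx => ⟨hone x (hKa hx), hpd0 x (hKa hx)⟩, ?_⟩
  · intro x
    have := conv_moll_dist_le hAi.aestronglyMeasurable hεpos (x := x) (z := 1 / 2) (η := 1 / 2)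
      (by norm_num) ?_
    · rw [abs_le] at this; constructor <;> linarith
    · intro t _
      by_cases ht : t ∈ A
      · simp only [indicator_of_mem ht]; norm_num [abs_le]
      · simp only [indicator_of_notMem ht]; norm_num [abs_le]
  · intro j
    have haG : dil y a G ⊆ G := S.dil_subset ha ha1.le
    have ham : MeasurableSet (dil y a G) := (S.isOpen_dil a).measurableSet
    have hfin : volume (G \ dil y a G) < ⊤ := (measure_mono sdiff_subset).trans_lt S.volume_lt_top
    have e1 : ∫ x, |pd j η x| = ∫ x in G \ dil y a G, |pd j η x| := by
      symm
      apply setIntegral_eq_integral_of_forall_compl_eq_zero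
      intro x hx
      rw [abs_eq_zero]
      by_cases hxG : x ∈ G
      · exact hpd0 x (by by_contra hxa; exact hx ⟨hxG, hxa⟩) j
      · exact image_eq_zero_of_notMem_tsupport fun h => hxG (htsupp (tsupport_pd_subset η j h))
    have hvol : volume.real (G \ dil y a G) ≤ 2 * (1 - a) * (h ^ 2 * discArea) := by
      rw [measureReal_sdiff haG ham S.volume_lt_top.ne, volume_real_dil G y ha]
      have h2 : volume.real G - a ^ 2 * volume.real G ≤ 2 * (1 - a) * volume.real G := by
        have := measureReal_nonneg (μ := (volume : Measure E2)) (s := G)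
        nlinarith [mul_nonneg (sq_nonneg (1 - a)) this]
      exact h2.trans (mul_le_mul_of_nonneg_left S.volume_real_le (by linarith))
    rw [e1]
    calc ∫ x in G \ dil y a G, |pd j η x|
        ≤ ∫ _ in G \ dil y a G, ε⁻¹ * ∫ x, |pd j moll0 x| := by
          refine integral_mono ?_ (integrableOn_const hfin.ne) fun x => hpd j x
          exact ((contDiff_pd hηc j).continuous.integrable_of_hasCompactSupport
            (hasCompactSupport_pd htest.2.1 j)).abs.integrableOn
      _ = volume.real (G \ dil y a G) * (ε⁻¹ * ∫ x, |pd j moll0 x|) := by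
          rw [setIntegral_const, smul_eq_mul]
      _ ≤ (2 * (1 - a) * (h ^ 2 * discArea)) *
            (ε⁻¹ * ((∫ x, |pd 0 moll0 x|) + (∫ x, |pd 1 moll0 x|) + 1)) := by
          gcongr
          have := hc0 0; have := hc0 1
          fin_cases j
          · simp only [Fin.zero_eta]; linarith
          · simp only [Fin.mk_one]; linarith
      _ = _ := by rw [hε]; field_simp; ring

/-- A quantitative substitute for Green's formula: the boundary term is controlled by the size of
`v` on the boundary, without any regularity of the boundary or of the trace of `v`. -/
lemma exists_green_bound : ∃ C, 0 < C ∧ ∀ (G : Set E2) (y : E2) (h r : ℝ), StarDisc G y h r →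
    ∀ (v : E2 → ℝ) (g : Fin 2 → E2 → ℝ), ContinuousOn v (closure G) →
    (∀ j, IntegrableOn (g j) G) →
    (∀ j φ, IsTest G φ → ∫ x in G, v x * pd j φ x = -∫ x in G, g j x * φ x) →
    ∀ M, (∀ x ∈ frontier G, |v x| < M) → ∀ (q : MvPolynomial (Fin 2) ℝ) (B : ℝ),
    (∀ j, ∀ x ∈ G, |polyFun (MvPolynomial.pderiv j q) x| ≤ B) → 0 ≤ M → 0 ≤ B →
    |(∫ x in G, ∑ j, g j x * polyFun (MvPolynomial.pderiv j q) x) +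
      ∫ x in G, v x * polyFun (lapPoly q) x| ≤ C * h ^ 2 / r * M * B := by
  obtain ⟨C, hC, hcut⟩ := exists_cutoff
  refine ⟨2 * C, by positivity, ?_⟩
  intro G y h r S v g hv hg hw M hM q B hB hM0 hB0
  have hGm := S.isOpen.measurableSet
  have hvi := integrableOn_of_continuousOn_closure S.isBounded hv
  have hr := S.r_pos
  -- the compact set where `v` is not small
  set K := {x ∈ closure G | |v x| ∈ Ici M} with hK
  have hKc : IsCompact K := S.isBounded.isCompact_closure.of_isClosed_subset
    (hv.abs.preimage_isClosed_of_isClosed isClosed_closure isClosed_Ici) fun x hx => hx.1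
  have hKG : K ⊆ G := by
    intro x hx
    by_contra hxG
    exact absurd hx.2 (not_le.2 (hM x (by rw [S.isOpen.frontier_eq]; exact ⟨hx.1, hxG⟩)))
  let t : ℕ → ℝ := fun n => 1 - 1 / ((n : ℝ) + 2)
  have ht0 : ∀ n, 0 < t n := fun n => by
    have : 1 / ((n : ℝ) + 2) < 1 := by rw [div_lt_one (by positivity)]; linarith [n.cast_nonneg (α := ℝ)]
    simp only [t]; linarith
  have ht1 : ∀ n, t n < 1 := fun n => by
    have : 0 < 1 / ((n : ℝ) + 2) := by positivity
    simp only [t]; linarith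
  have hKn : ∀ n, IsCompact (closure (dil y (t n) G)) := fun n =>
    (S.isBounded.subset (S.dil_subset (ht0 n) (ht1 n).le)).isCompact_closure
  have hKnG : ∀ n, closure (dil y (t n) G) ⊆ G := fun n => by
    have := S.closure_dil_subset (ht0 n) (ht1 n)
    rwa [dil_one] at this
  choose η hη1 hη2 hη3 hη4 using fun n => hcut G y h r S (K ∪ closure (dil y (t n) G))
    (hKc.union (hKn n)) (union_subset hKG (hKnG n))
  have hpq : ∀ j, ContDiff ℝ ∞ (polyFun (MvPolynomial.pderiv j q)) := fun j => contDiff_polyFun _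
  have hbd : ∀ (q' : MvPolynomial (Fin 2) ℝ), ∃ c, ∀ x ∈ G, |polyFun q' x| ≤ c := fun q' => by
    obtain ⟨c, hc⟩ := S.isBounded.isCompact_closure.exists_bound_of_continuousOn
      (continuous_polyFun q').continuousOn
    exact ⟨c, fun x hx => hc x (subset_closure hx)⟩
  have hmulint : ∀ (f : E2 → ℝ) (q' : MvPolynomial (Fin 2) ℝ), IntegrableOn f G →
      IntegrableOn (fun x => f x * polyFun q' x) G := fun f q' hf => by
    obtain ⟨c, hc⟩ := hbd q'
    exact Integrable.mul_bdd (c := c) hf (continuous_polyFun q').aestronglyMeasurable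
      ((ae_restrict_iff' hGm).2 (Filter.Eventually.of_forall hc))
  set D : E2 → ℝ := fun x => (∑ j, g j x * polyFun (MvPolynomial.pderiv j q) x) +
    v x * polyFun (lapPoly q) x with hD
  have hsumi : IntegrableOn (fun x => ∑ j, g j x * polyFun (MvPolynomial.pderiv j q) x) G :=
    integrable_finsetSum _ fun j _ => hmulint _ _ (hg j)
  have hDi : IntegrableOn D G := hsumi.add (hmulint _ _ hvi)
  have hlim : Filter.Tendsto (fun n => ∫ x in G, D x * η n x) Filter.atTop
      (nhds (∫ x in G, D x)) := by
    refine tendsto_integral_of_dominated_convergence (fun x => |D x|) ?_ hDi.abs ?_ ?_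
    · intro n
      exact hDi.aestronglyMeasurable.mul (hη1 n).1.continuous.aestronglyMeasurable
    · intro n
      refine Filter.Eventually.of_forall fun x => ?_
      rw [Real.norm_eq_abs, abs_mul, abs_of_nonneg (hη2 n x).1]
      exact mul_le_of_le_one_right (abs_nonneg _) (hη2 n x).2
    · filter_upwards [ae_restrict_mem hGm] with x hx
      obtain ⟨a, ha, ha1, hxa⟩ := S.exists_subset_dil (isCompact_singleton (x := x)) (by simpa using hx)
      refine tendsto_const_nhds.congr' ?_
      have hlt : Filter.Tendsto t Filter.atTop (nhds 1) := by
        have h1 : Filter.Tendsto (fun n : ℕ => (n : ℝ) + 2) Filter.atTop Filter.atTop :=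
          Filter.tendsto_atTop_add_const_right _ _ tendsto_natCast_atTop_atTop
        have h2 := (h1.inv_tendsto_atTop).const_sub 1
        simpa [t] using h2
      filter_upwards [hlt.eventually (lt_mem_nhds ha1)] with n hn
      have : x ∈ closure (dil y (t n) G) :=
        subset_closure (S.dil_subset_dil ha hn.le (hxa rfl))
      rw [(hη3 n x (Or.inr this)).1, mul_one]
  have hint : (∫ x in G, ∑ j, g j x * polyFun (MvPolynomial.pderiv j q) x) +
      ∫ x in G, v x * polyFun (lapPoly q) x = ∫ x in G, D x :=
    (integral_add hsumi (hmulint _ _ hvi)).symm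
  rw [hint]
  refine le_of_tendsto hlim.abs (Filter.Eventually.of_forall fun n => ?_)
  have htst : ∀ j, IsTest G fun x => polyFun (MvPolynomial.pderiv j q) x * η n x := fun j =>
    (hη1 n).mul_left (hpq j)
  have hηc := (hη1 n).1
  have i1 : ∀ j, IntegrableOn (fun x => v x * (polyFun (MvPolynomial.pderiv j q) x * pd j (η n) x)) G :=
    fun j => integrableOn_mul_of_hasCompactSupport hvi
      ((hpq j).continuous.mul (contDiff_pd hηc j).continuous)
      (hasCompactSupport_pd (hη1 n).2.1 j).mul_left
  have i2 : ∀ j, IntegrableOn (fun x => v x *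
      (polyFun (MvPolynomial.pderiv j (MvPolynomial.pderiv j q)) x * η n x)) G :=
    fun j => integrableOn_mul_of_hasCompactSupport hvi
      ((continuous_polyFun _).mul hηc.continuous) (hη1 n).2.1.mul_left
  have i3 : ∀ j, IntegrableOn (fun x => g j x * (polyFun (MvPolynomial.pderiv j q) x * η n x)) G :=
    fun j => integrableOn_mul_of_hasCompactSupport (hg j)
      ((continuous_polyFun _).mul hηc.continuous) (hη1 n).2.1.mul_left
  -- the equation tested with the truncated derivatives of `q`
  have hj : ∀ j, (∫ x in G, g j x * (polyFun (MvPolynomial.pderiv j q) x * η n x)) +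
      (∫ x in G, v x * (polyFun (MvPolynomial.pderiv j (MvPolynomial.pderiv j q)) x * η n x)) =
      -∫ x in G, v x * (polyFun (MvPolynomial.pderiv j q) x * pd j (η n) x) := by
    intro j
    have h1 := hw j _ (htst j)
    have e : ∀ x, v x * pd j (fun x => polyFun (MvPolynomial.pderiv j q) x * η n x) x =
        v x * (polyFun (MvPolynomial.pderiv j (MvPolynomial.pderiv j q)) x * η n x) +
        v x * (polyFun (MvPolynomial.pderiv j q) x * pd j (η n) x) := fun x => by
      rw [pd_mul (differentiable_polyFun _ x) (hηc.differentiable (by simp) x), pd_polyFun]; ring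
    simp only [e] at h1
    rw [integral_add (i2 j) (i1 j)] at h1
    linarith
  have hDn : ∫ x in G, D x * η n x =
      -∑ j, ∫ x in G, v x * (polyFun (MvPolynomial.pderiv j q) x * pd j (η n) x) := by
    have e : ∀ x, D x * η n x =
        ∑ j, (g j x * (polyFun (MvPolynomial.pderiv j q) x * η n x) +
        v x * (polyFun (MvPolynomial.pderiv j (MvPolynomial.pderiv j q)) x * η n x)) := fun x => by
      simp only [hD, lapPoly, polyFun_add, Fin.sum_univ_two]; ring
    simp only [e]
    have i4 : ∀ j, IntegrableOn (fun x => g j x * (polyFun (MvPolynomial.pderiv j q) x * η n x) +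
        v x * (polyFun (MvPolynomial.pderiv j (MvPolynomial.pderiv j q)) x * η n x)) G :=
      fun j => (i3 j).add (i2 j)
    rw [integral_finsetSum _ fun j _ => i4 j, ← Finset.sum_neg_distrib]
    refine Finset.sum_congr rfl fun j _ => ?_
    rw [← hj j, ← integral_add (i3 j) (i2 j)]
  have hone : ∀ j, |∫ x in G, v x * (polyFun (MvPolynomial.pderiv j q) x * pd j (η n) x)| ≤
      M * B * (C * h ^ 2 / r) := by
    intro j
    have hpi : Integrable fun x => |pd j (η n) x| :=
      ((contDiff_pd hηc j).continuous.integrable_of_hasCompactSupport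
        (hasCompactSupport_pd (hη1 n).2.1 j)).abs
    have h1 : |∫ x in G, v x * (polyFun (MvPolynomial.pderiv j q) x * pd j (η n) x)| ≤
        ∫ x in G, M * B * |pd j (η n) x| := by
      rw [← Real.norm_eq_abs]
      refine norm_integral_le_of_norm_le (hpi.integrableOn.const_mul _) ?_
      filter_upwards [ae_restrict_mem hGm] with x hx
      rw [Real.norm_eq_abs, abs_mul, abs_mul, ← mul_assoc]
      by_cases hxK : x ∈ K
      · rw [(hη3 n x (Or.inl hxK)).2 j]; simp
      · have : |v x| < M := by
          by_contra hcon
          exact hxK ⟨subset_closure hx, not_lt.1 hcon⟩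
        exact mul_le_mul_of_nonneg_right (mul_le_mul this.le (hB j x hx) (abs_nonneg _) hM0)
          (abs_nonneg _)
    refine h1.trans ?_
    rw [integral_const_mul]
    refine mul_le_mul_of_nonneg_left ?_ (by positivity)
    refine le_trans ?_ (hη4 n j)
    exact setIntegral_le_integral hpi (Filter.Eventually.of_forall fun x => abs_nonneg _)
  rw [hDn, abs_neg, Fin.sum_univ_two]
  refine (abs_add_le _ _).trans ?_
  have := hone 0
  have := hone 1
  calc _ ≤ M * B * (C * h ^ 2 / r) + M * B * (C * h ^ 2 / r) := by gcongr
    _ = _ := by ring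

end StarDisc

/-! ### Polynomial approximation on star-shaped domains -/

/-- `F z x` is a polynomial of degree at most `k` in `x` with coefficients continuous in `z`. -/
def PolyKernel (k : ℕ) (F : E2 → E2 → ℝ) : Prop :=
  ∃ (ι : Type) (_ : Fintype ι) (c : ι → E2 → ℝ) (m : ι → MvPolynomial (Fin 2) ℝ),
    (∀ i, Continuous (c i)) ∧ (∀ i, (m i).totalDegree ≤ k) ∧ ∀ z x, F z x = ∑ i, c i z * polyFun (m i) x

namespace PolyKernel

lemma mono {k l : ℕ} {F : E2 → E2 → ℝ} (hF : PolyKernel k F) (hkl : k ≤ l) : PolyKernel l F := by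
  obtain ⟨ι, _, c, m, h1, h2, h3⟩ := hF
  exact ⟨ι, _, c, m, h1, fun i => (h2 i).trans hkl, h3⟩

lemma mul {k l : ℕ} {F H : E2 → E2 → ℝ} (hF : PolyKernel k F) (hH : PolyKernel l H) :
    PolyKernel (k + l) fun z x => F z x * H z x := by
  obtain ⟨ι, _, c, m, h1, h2, h3⟩ := hF
  obtain ⟨κ, _, d, n, g1, g2, g3⟩ := hH
  refine ⟨ι × κ, inferInstance, fun i z => c i.1 z * d i.2 z, fun i => m i.1 * n i.2,
    fun i => (h1 _).mul (g1 _),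
    fun i => (MvPolynomial.totalDegree_mul _ _).trans (add_le_add (h2 _) (g2 _)), fun z x => ?_⟩
  change F z x * H z x = _
  rw [h3, g3, Finset.sum_mul_sum, Fintype.sum_prod_type]
  refine Finset.sum_congr rfl fun i _ => Finset.sum_congr rfl fun j _ => ?_
  rw [polyFun_mul]; ring

lemma sum {k : ℕ} {κ : Type} [Fintype κ] {F : κ → E2 → E2 → ℝ} (hF : ∀ w, PolyKernel k (F w)) :
    PolyKernel k fun z x => ∑ w, F w z x := by
  choose ι hι c m h1 h2 h3 using hF
  refine ⟨Σ w, ι w, inferInstance, fun i => c i.1 i.2, fun i => m i.1 i.2, fun i => h1 _ _,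
    fun i => h2 _ _, fun z x => ?_⟩
  rw [Fintype.sum_sigma]
  exact Finset.sum_congr rfl fun w _ => h3 w z x

lemma coef {c : E2 → ℝ} (hc : Continuous c) : PolyKernel 0 fun z _ => c z :=
  ⟨Unit, inferInstance, fun _ => c, fun _ => 1, fun _ => hc, fun _ => by simp, fun z x => by
    simp [polyFun]⟩

lemma coord_sub (j : Fin 2) : PolyKernel 1 fun z x => x j - z j := by
  refine ⟨Bool, inferInstance, fun i z => if i then 1 else -z j,
    fun i => if i then MvPolynomial.X j else 1, ?_, ?_, ?_⟩
  · intro i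
    cases i
    · simp only [Bool.false_eq_true, if_false]; fun_prop
    · simp only [if_true]; fun_prop
  · intro i
    cases i <;> simp
  · intro z x
    simp [polyFun]; ring

lemma prod_coord_sub {k : ℕ} (w : Fin k → Fin 2) : PolyKernel k fun z x => ∏ i, (x (w i) - z (w i)) := by
  induction k with
  | zero => simpa using coef (c := fun _ => 1) continuous_const
  | succ k ih =>
    have := (coord_sub (w 0)).mul (ih (fun i => w i.succ))
    simp only [Fin.prod_univ_succ]
    exact this.mono (by omega)

lemma continuous_left {k : ℕ} {F : E2 → E2 → ℝ} (hF : PolyKernel k F) (x : E2) :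
    Continuous fun z => F z x := by
  obtain ⟨ι, _, c, m, h1, h2, h3⟩ := hF
  simp only [h3]
  exact continuous_finsetSum _ fun i _ => (h1 i).mul continuous_const

/-- Averages in `z` of polynomials in `x` are polynomials in `x`. -/
lemma exists_integral {k : ℕ} {F : E2 → E2 → ℝ} (hF : PolyKernel k F) {B : Set E2}
    (hB : Bornology.IsBounded B) (s : ℝ) : ∃ q : MvPolynomial (Fin 2) ℝ, q.totalDegree ≤ k ∧
      ∀ x, polyFun q x = s * ∫ z in B, F z x := by
  obtain ⟨ι, _, c, m, h1, h2, h3⟩ := hF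
  refine ⟨∑ i, (s * ∫ z in B, c i z) • m i, MvPolynomial.totalDegree_finsetSum_le fun i _ =>
    (MvPolynomial.totalDegree_smul_le _ _).trans (h2 i), fun x => ?_⟩
  simp only [h3]
  rw [integral_finsetSum _ fun i _ =>
    (integrableOn_of_continuousOn_closure hB (h1 i).continuousOn).mul_const _, Finset.mul_sum]
  unfold polyFun
  rw [map_sum]
  refine Finset.sum_congr rfl fun i _ => ?_
  rw [integral_mul_const, MvPolynomial.smul_eval]
  ring

end PolyKernel

/-- An iterated directional derivative along coordinate directions is a partial derivative. -/
lemma exists_iteratedFDeriv_eq_pdMulti {f : E2 → ℝ} (hf : ContDiff ℝ ∞ f) (k : ℕ)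
    (w : Fin k → Fin 2) : ∃ a b, a + b = k ∧ ∀ x,
      iteratedFDeriv ℝ k f x (fun i => EuclideanSpace.single (w i) 1) = pdMulti a b f x := by
  induction k with
  | zero => exact ⟨0, 0, rfl, fun x => by simp [pdMulti]⟩
  | succ k ih =>
    obtain ⟨a, b, hab, h⟩ := ih (fun i => w i.succ)
    have key : ∀ x, iteratedFDeriv ℝ (k + 1) f x (fun i => EuclideanSpace.single (w i) 1) =
        pd (w 0) (pdMulti a b f) x := by
      intro x
      rw [iteratedFDeriv_succ_apply_left]
      have hd : DifferentiableAt ℝ (iteratedFDeriv ℝ k f) x :=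
        (hf.differentiable_iteratedFDeriv (by exact_mod_cast WithTop.coe_lt_top k)) x
      have : pdMulti a b f = fun x => iteratedFDeriv ℝ k f x
          (fun i => EuclideanSpace.single (w i.succ) 1) := funext fun x => (h x).symm
      rw [this]
      unfold pd
      have h2 := (hd.hasFDerivAt.continuousMultilinear_apply_const
        (fun i => EuclideanSpace.single (w i.succ) (1 : ℝ))).fderiv
      rw [h2]
      rfl
    have h01 : w 0 = 0 ∨ w 0 = 1 := by
      generalize w 0 = j
      fin_cases j <;> simp
    rcases h01 with h0 | h0
    · exact ⟨a + 1, b, by omega, fun x => by rw [key, h0, pd_zero_pdMulti]⟩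
    · exact ⟨a, b + 1, by omega, fun x => by rw [key, h0, pd_one_pdMulti hf]⟩

lemma iteratedFDeriv_diag_expand {f : E2 → ℝ} (k : ℕ) (x v : E2) :
    iteratedFDeriv ℝ k f x (fun _ => v) = ∑ w : Fin k → Fin 2, (∏ i, v (w i)) *
      iteratedFDeriv ℝ k f x (fun i => EuclideanSpace.single (w i) 1) := by
  have hv : v = ∑ j : Fin 2, v j • (EuclideanSpace.single j 1 : E2) := by
    ext i
    fin_cases i <;> simp
  conv_lhs => rw [hv]
  rw [ContinuousMultilinearMap.map_sum]
  refine Finset.sum_congr rfl fun w _ => ?_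
  rw [ContinuousMultilinearMap.map_smul_univ, smul_eq_mul]

/-- The averaged remainder integral, bounded by an `L²` norm. The change of variables
`z ↦ z + t (x - z)` produces the factor `(1 - t)⁻²`, which the weight compensates. -/
lemma integral_integral_segment_le {S : Set E2} (hSm : MeasurableSet S)
    (hSb : Bornology.IsBounded S) {g : E2 → ℝ} (hg : Continuous g) {β : ℝ} (hβ : 0 < β)
    (hgβ : ∫ x in S, g x ^ 2 ≤ β ^ 2) {y x : E2} {r : ℝ} (hr : 0 < r)
    (hS : ∀ z ∈ Metric.ball y r, ∀ t ∈ Ico (0 : ℝ) 1, z + t • (x - z) ∈ S) {n : ℕ} (hn : 1 ≤ n) :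
    ∫ z in Metric.ball y r, ∫ t in (0 : ℝ)..1, (1 - t) ^ n * |g (z + t • (x - z))| ≤
      √(volume.real (Metric.ball y r)) * β := by
  set B := Metric.ball y r with hB
  set V := volume.real B with hV
  have hVpos : 0 < V := by
    rw [hV, volume_real_ball y hr.le]; have := discArea_pos; positivity
  have hcl : IsCompact (Metric.closedBall y r ×ˢ Icc (0 : ℝ) 1) :=
    (isCompact_closedBall y r).prod isCompact_Icc
  have hpi : ∀ F : E2 × ℝ → ℝ, Continuous F →
      Integrable F ((volume.restrict B).prod (volume.restrict (Ioc (0 : ℝ) 1))) := by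
    intro F hF
    rw [Measure.prod_restrict]
    exact (hF.continuousOn.integrableOn_compact hcl).mono_set
      (prod_mono Metric.ball_subset_closedBall Ioc_subset_Icc_self)
  have hinner : ∀ t ∈ Ico (0 : ℝ) 1, ∫ z in B, (1 - t) ^ 2 * g (z + t • (x - z)) ^ 2 ≤ β ^ 2 := by
    intro t ht
    have h1t : 0 < 1 - t := by linarith [ht.2]
    set F : E2 → ℝ := S.indicator fun x => g x ^ 2 with hF
    have hFi : Integrable F := (integrable_indicator_iff hSm).2
      (integrableOn_of_continuousOn_closure hSb (hg.pow 2).continuousOn)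
    have e1 : ∀ z, z + t • (x - z) = (1 - t) • z + t • x := fun z => by
      rw [smul_sub, sub_smul, one_smul]; abel
    have hFi2 : Integrable fun z => F ((1 - t) • z + t • x) :=
      (hFi.comp_add_right (t • x)).comp_smul h1t.ne'
    have e2 : ∫ z, F ((1 - t) • z + t • x) = ((1 - t) ^ 2)⁻¹ * ∫ z, F z := by
      rw [integral_comp_smul_E2 (fun z => F (z + t • x)) h1t, integral_add_right_eq_self]
    rw [integral_const_mul]
    calc (1 - t) ^ 2 * ∫ z in B, g (z + t • (x - z)) ^ 2
        ≤ (1 - t) ^ 2 * ∫ z in B, F ((1 - t) • z + t • x) := by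
          refine mul_le_mul_of_nonneg_left ?_ (by positivity)
          refine setIntegral_mono_on ?_ hFi2.integrableOn measurableSet_ball ?_
          · exact integrableOn_of_continuousOn_closure Metric.isBounded_ball
              (Continuous.continuousOn (by fun_prop))
          · intro z hz
            rw [← e1, hF, indicator_of_mem (hS z hz t ht)]
      _ ≤ (1 - t) ^ 2 * ∫ z, F ((1 - t) • z + t • x) := by
          refine mul_le_mul_of_nonneg_left ?_ (by positivity)
          exact setIntegral_le_integral hFi2 (Filter.Eventually.of_forall fun z =>
            indicator_nonneg (fun _ _ => sq_nonneg _) _)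
      _ = ∫ z in S, g z ^ 2 := by
          rw [e2, ← mul_assoc, mul_inv_cancel₀ (by positivity), one_mul, hF,
            integral_indicator hSm]
      _ ≤ β ^ 2 := hgβ
  -- balance the two terms of the elementary inequality `2 a ≤ κ a² + κ⁻¹`
  set κ := √V / β with hκ
  have hκpos : 0 < κ := div_pos (Real.sqrt_pos.2 hVpos) hβ
  have hstep : ∫ z in B, ∫ t in Ioc (0 : ℝ) 1, (1 - t) ^ n * |g (z + t • (x - z))| ≤
      ∫ z in B, ∫ t in Ioc (0 : ℝ) 1,
        (κ / 2 * ((1 - t) ^ 2 * g (z + t • (x - z)) ^ 2) + κ⁻¹ / 2) := by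
    have c1 : Continuous fun p : E2 × ℝ => (1 - p.2) ^ n * |g (p.1 + p.2 • (x - p.1))| := by fun_prop
    have c2 : Continuous fun p : E2 × ℝ =>
        κ / 2 * ((1 - p.2) ^ 2 * g (p.1 + p.2 • (x - p.1)) ^ 2) + κ⁻¹ / 2 := by fun_prop
    refine integral_mono (hpi _ c1).integral_prod_left (hpi _ c2).integral_prod_left fun z => ?_
    have d1 : Continuous fun t : ℝ => (1 - t) ^ n * |g (z + t • (x - z))| := by fun_prop
    have d2 : Continuous fun t : ℝ =>
        κ / 2 * ((1 - t) ^ 2 * g (z + t • (x - z)) ^ 2) + κ⁻¹ / 2 := by fun_prop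
    refine setIntegral_mono_on (d1.integrableOn_Ioc) (d2.integrableOn_Ioc) measurableSet_Ioc ?_
    intro t ht
    have h1 : 0 ≤ 1 - t := by linarith [ht.2]
    have h2 : (1 - t) ^ n ≤ (1 - t) ^ 1 := pow_le_pow_of_le_one h1 (by linarith [ht.1]) hn
    rw [pow_one] at h2
    set s := |g (z + t • (x - z))|
    have hs : g (z + t • (x - z)) ^ 2 = s ^ 2 := (sq_abs _).symm
    rw [hs]
    have h3 : (1 - t) ^ n * s ≤ (1 - t) * s := mul_le_mul_of_nonneg_right h2 (abs_nonneg _)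
    have h4 : 0 ≤ κ⁻¹ / 2 * (κ * ((1 - t) * s) - 1) ^ 2 := by positivity
    have h5 : κ⁻¹ / 2 * (κ * ((1 - t) * s) - 1) ^ 2 =
        κ / 2 * ((1 - t) ^ 2 * s ^ 2) + κ⁻¹ / 2 - (1 - t) * s := by
      field_simp; ring
    linarith
  have e0 : ∀ z, ∫ t in (0 : ℝ)..1, (1 - t) ^ n * |g (z + t • (x - z))| =
      ∫ t in Ioc (0 : ℝ) 1, (1 - t) ^ n * |g (z + t • (x - z))| := fun z =>
    intervalIntegral.integral_of_le zero_le_one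
  simp only [e0]
  refine hstep.trans ?_
  have c2 : Continuous fun p : E2 × ℝ =>
      κ / 2 * ((1 - p.2) ^ 2 * g (p.1 + p.2 • (x - p.1)) ^ 2) + κ⁻¹ / 2 := by fun_prop
  rw [integral_integral_swap
    (f := fun z t => κ / 2 * ((1 - t) ^ 2 * g (z + t • (x - z)) ^ 2) + κ⁻¹ / 2) (hpi _ c2)]
  have hBfin : volume B < ⊤ := measure_ball_lt_top
  have hfinal : ∫ t in Ioc (0 : ℝ) 1, ∫ z in B,
      (κ / 2 * ((1 - t) ^ 2 * g (z + t • (x - z)) ^ 2) + κ⁻¹ / 2) ≤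
      ∫ _ in Ioc (0 : ℝ) 1, (κ / 2 * β ^ 2 + κ⁻¹ / 2 * V) := by
    refine integral_mono_ae (hpi _ c2).integral_prod_right (by simp) ?_
    have hne : ∀ᵐ t : ℝ ∂volume.restrict (Ioc 0 1), t ≠ 1 :=
      ae_restrict_of_ae (Measure.ae_ne volume 1)
    filter_upwards [ae_restrict_mem measurableSet_Ioc, hne] with t ht ht1
    have htI : t ∈ Ico (0 : ℝ) 1 := ⟨ht.1.le, lt_of_le_of_ne ht.2 ht1⟩
    have i1 : IntegrableOn (fun z => κ / 2 * ((1 - t) ^ 2 * g (z + t • (x - z)) ^ 2)) B :=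
      integrableOn_of_continuousOn_closure Metric.isBounded_ball
        (Continuous.continuousOn (by fun_prop))
    have i2 : IntegrableOn (fun _ : E2 => κ⁻¹ / 2) B := integrableOn_const hBfin.ne
    rw [integral_add i1 i2, integral_const_mul, setIntegral_const, smul_eq_mul, mul_comm V]
    gcongr
    exact hinner t htI
  refine hfinal.trans (le_of_eq ?_)
  rw [setIntegral_const]
  simp only [Real.volume_real_Ioc, sub_zero, max_eq_left zero_le_one, one_smul]
  have hsV : √V ^ 2 = V := Real.sq_sqrt hVpos.le
  have : 0 < √V := Real.sqrt_pos.2 hVpos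
  rw [hκ]
  field_simp
  rw [hsV]; ring

namespace StarDisc

variable {G : Set E2} {y : E2} {h r : ℝ}

/-- Approximation of a smooth function by its averaged Taylor polynomial. -/
lemma exists_poly_approx_of_contDiff (S : StarDisc G y h r) {f : E2 → ℝ} (hf : ContDiff ℝ ∞ f)
    {n : ℕ} (hn : 1 ≤ n) {β : ℝ} (hβ : 0 < β)
    (hfβ : ∀ a b, a + b = n + 1 → ∫ x in G, pdMulti a b f x ^ 2 ≤ β ^ 2) :
    ∃ q : MvPolynomial (Fin 2) ℝ, q.totalDegree ≤ n ∧
      ∀ x ∈ G, |f x - polyFun q x| ≤ 4 ^ (n + 1) * h ^ (n + 1) / (√discArea * r) * β := by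
  have hr := S.r_pos
  have hh := S.h_pos
  set B := Metric.ball y r with hB
  set V := volume.real B with hV
  have hω := discArea_pos
  have hVe : V = r ^ 2 * discArea := volume_real_ball y hr.le
  have hVpos : 0 < V := by rw [hVe]; positivity
  have hBfin : volume B < ⊤ := measure_ball_lt_top
  -- the Taylor polynomial at `z`, as a polynomial kernel
  set F : E2 → E2 → ℝ := fun z x => ∑ k ∈ Finset.range (n + 1),
    ((k.factorial : ℝ))⁻¹ • iteratedFDeriv ℝ k f z (fun _ => x - z) with hF
  have hFk : PolyKernel n F := by
    have : F = fun z x => ∑ k : Fin (n + 1), ∑ w : Fin k → Fin 2,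
        (((k : ℕ).factorial : ℝ)⁻¹ * iteratedFDeriv ℝ k f z
          (fun i => EuclideanSpace.single (w i) 1)) * ∏ i, (x (w i) - z (w i)) := by
      ext z x
      change (∑ k ∈ Finset.range (n + 1), ((k.factorial : ℝ))⁻¹ •
        iteratedFDeriv ℝ k f z (fun _ => x - z)) = _
      rw [← Fin.sum_univ_eq_sum_range (fun k => ((k.factorial : ℝ))⁻¹ •
        iteratedFDeriv ℝ k f z (fun _ => x - z)) (n + 1)]
      refine Finset.sum_congr rfl fun k _ => ?_
      rw [iteratedFDeriv_diag_expand, smul_eq_mul, Finset.mul_sum]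
      refine Finset.sum_congr rfl fun w _ => ?_
      simp only [PiLp.sub_apply]
      ring
    rw [this]
    refine PolyKernel.sum fun k => PolyKernel.sum fun w => ?_
    have hc : Continuous fun z => ((k : ℕ).factorial : ℝ)⁻¹ * iteratedFDeriv ℝ k f z
        (fun i => EuclideanSpace.single (w i) 1) := by
      obtain ⟨a, b, _, h⟩ := exists_iteratedFDeriv_eq_pdMulti hf k w
      simp only [h]
      exact continuous_const.mul (contDiff_pdMulti hf a b).continuous
    exact ((PolyKernel.coef hc).mul (PolyKernel.prod_coord_sub w)).mono (by omega)
  obtain ⟨q, hq, hqe⟩ := hFk.exists_integral (B := B) Metric.isBounded_ball V⁻¹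
  refine ⟨q, hq, fun x hx => ?_⟩
  set g : (Fin (n + 1) → Fin 2) → E2 → ℝ := fun w p =>
    iteratedFDeriv ℝ (n + 1) f p (fun i => EuclideanSpace.single (w i) 1) with hg
  have hgc : ∀ w, Continuous (g w) := fun w => by
    obtain ⟨a, b, _, h⟩ := exists_iteratedFDeriv_eq_pdMulti hf (n + 1) w
    simp only [hg, h]
    exact (contDiff_pdMulti hf a b).continuous
  have hgβ : ∀ w, ∫ x in G, g w x ^ 2 ≤ β ^ 2 := fun w => by
    obtain ⟨a, b, hab, h⟩ := exists_iteratedFDeriv_eq_pdMulti hf (n + 1) w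
    simp only [hg, h]
    exact hfβ a b hab
  have hseg : ∀ z ∈ B, ∀ t ∈ Ico (0 : ℝ) 1, z + t • (x - z) ∈ G := by
    intro z hz t ht
    have := S.star z hz hx (a := 1 - t) (b := t) (by linarith [ht.2]) ht.1 (by ring)
    convert this using 1
    rw [smul_sub, sub_smul, one_smul]; abel
  have hrem : ∀ z ∈ B, |f x - F z x| ≤ (2 * h) ^ (n + 1) *
      ∑ w, ∫ t in (0 : ℝ)..1, (1 - t) ^ n * |g w (z + t • (x - z))| := by
    intro z hz
    have hT := map_add_eq_sum_add_integral_iteratedFDeriv (f := f) (x := z) (y := x - z) (n := n)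
      fun t _ => (hf.of_le (by exact_mod_cast le_top)).contDiffAt
    rw [add_sub_cancel] at hT
    have hFz : f x - F z x = ((n.factorial : ℝ))⁻¹ • ∫ t in (0 : ℝ)..1,
        (1 - t) ^ n • iteratedFDeriv ℝ (n + 1) f (z + t • (x - z)) (fun _ => x - z) := by
      rw [hT]; simp only [hF]; ring
    have hcoord : ∀ j, |(x - z) j| ≤ 2 * h := by
      intro j
      have h1 := PiLp.norm_apply_le (x - z) j
      rw [Real.norm_eq_abs] at h1
      have h2 := Metric.mem_closedBall.1 (S.subset hx)
      have h3 := Metric.mem_closedBall.1 (S.subset (S.ball_subset hz))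
      have h4 := dist_triangle_right x z y
      rw [dist_eq_norm x z] at h4
      linarith
    have hpt : ∀ p, |iteratedFDeriv ℝ (n + 1) f p (fun _ => x - z)| ≤
        (2 * h) ^ (n + 1) * ∑ w, |g w p| := by
      intro p
      rw [iteratedFDeriv_diag_expand, Finset.mul_sum]
      refine (Finset.abs_sum_le_sum_abs _ _).trans (Finset.sum_le_sum fun w _ => ?_)
      rw [abs_mul, Finset.abs_prod]
      refine mul_le_mul_of_nonneg_right ?_ (abs_nonneg _)
      refine (Finset.prod_le_prod (fun i _ => abs_nonneg _) fun i _ => hcoord (w i)).trans ?_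
      simp
    have hci : ∀ w, IntervalIntegrable (fun t : ℝ => (1 - t) ^ n * |g w (z + t • (x - z))|)
        volume 0 1 := fun w => by
      have := hgc w
      exact Continuous.intervalIntegrable (by fun_prop) _ _
    rw [hFz, smul_eq_mul, abs_mul, abs_of_nonneg (by positivity), ← intervalIntegral.integral_finsetSum
      fun w _ => hci w, ← intervalIntegral.integral_const_mul]
    have hfac : ((n.factorial : ℝ))⁻¹ ≤ 1 :=
      inv_le_one_of_one_le₀ (by exact_mod_cast Nat.one_le_iff_ne_zero.2 (Nat.factorial_ne_zero n))
    refine (mul_le_of_le_one_left (abs_nonneg _) hfac).trans ?_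
    rw [← Real.norm_eq_abs]
    refine intervalIntegral.norm_integral_le_of_norm_le zero_le_one ?_ ?_
    · refine Filter.Eventually.of_forall fun t ht => ?_
      have h1 : 0 ≤ 1 - t := by linarith [ht.2]
      rw [Real.norm_eq_abs, smul_eq_mul, abs_mul, abs_of_nonneg (pow_nonneg h1 n)]
      refine (mul_le_mul_of_nonneg_left (hpt _) (pow_nonneg h1 n)).trans (le_of_eq ?_)
      rw [← Finset.mul_sum]; ring
    · refine Continuous.intervalIntegrable ?_ _ _
      refine continuous_const.mul (continuous_finsetSum _ fun w _ => ?_)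
      have := hgc w
      fun_prop
  -- average the Taylor expansion over the disc
  have hFc : Continuous fun z => F z x := hFk.continuous_left x
  have hFi : IntegrableOn (fun z => F z x) B :=
    integrableOn_of_continuousOn_closure Metric.isBounded_ball hFc.continuousOn
  have hdiff : f x - polyFun q x = V⁻¹ * ∫ z in B, (f x - F z x) := by
    have i0 : IntegrableOn (fun _ : E2 => f x) B := integrableOn_const hBfin.ne
    rw [integral_sub i0 hFi, setIntegral_const, smul_eq_mul, mul_sub,
      ← hqe, ← mul_assoc, inv_mul_cancel₀ hVpos.ne', one_mul]
  have hpi : ∀ w, IntegrableOn (fun z => ∫ t in (0 : ℝ)..1, (1 - t) ^ n * |g w (z + t • (x - z))|) B := by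
    intro w
    have := hgc w
    refine integrableOn_of_continuousOn_closure Metric.isBounded_ball (Continuous.continuousOn ?_)
    exact intervalIntegral.continuous_parametric_intervalIntegral_of_continuous' (by fun_prop) _ _
  have hle : |∫ z in B, (f x - F z x)| ≤ (2 * h) ^ (n + 1) * ∑ _w : Fin (n + 1) → Fin 2, (√V * β) := by
    calc |∫ z in B, (f x - F z x)|
        ≤ ∫ z in B, (2 * h) ^ (n + 1) *
            ∑ w, ∫ t in (0 : ℝ)..1, (1 - t) ^ n * |g w (z + t • (x - z))| := by
          rw [← Real.norm_eq_abs]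
          refine norm_integral_le_of_norm_le ((integrable_finsetSum _ fun w _ => hpi w).const_mul _) ?_
          filter_upwards [ae_restrict_mem measurableSet_ball] with z hz using hrem z hz
      _ = (2 * h) ^ (n + 1) * ∑ w, ∫ z in B, ∫ t in (0 : ℝ)..1,
            (1 - t) ^ n * |g w (z + t • (x - z))| := by
          rw [integral_const_mul, integral_finsetSum _ fun w _ => hpi w]
      _ ≤ _ := by
          gcongr with w
          exact integral_integral_segment_le S.isOpen.measurableSet S.isBounded (hgc w) hβ (hgβ w)
            hr hseg hn
  rw [hdiff, abs_mul, abs_of_pos (inv_pos.2 hVpos)]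
  refine (mul_le_mul_of_nonneg_left hle (by positivity)).trans (le_of_eq ?_)
  have hsV : √V = r * √discArea := by
    rw [hVe, Real.sqrt_mul (by positivity), Real.sqrt_sq hr.le]
  have hV2 : V = (r * √discArea) * (r * √discArea) := by rw [← hsV, Real.mul_self_sqrt hVpos.le]
  have hcard : Fintype.card (Fin (n + 1) → Fin 2) = 2 ^ (n + 1) := by simp
  rw [Finset.sum_const, Finset.card_univ, hcard, nsmul_eq_mul, hsV, hV2]
  have : 0 < √discArea := Real.sqrt_pos.2 hω
  push_cast
  rw [show (4 : ℝ) = 2 * 2 by norm_num, mul_pow 2 h, mul_pow 2 2]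
  field_simp

end StarDisc

/-- Mollification does not increase the `L²` norm. -/
lemma setIntegral_sq_conv_moll_le {F : E2 → ℝ} (hF : Integrable F)
    (hF2 : Integrable fun x => F x ^ 2) {ε : ℝ} (hε : 0 < ε) {S : Set E2} (hSm : MeasurableSet S)
    (hS : Bornology.IsBounded S) : ∫ x in S, conv (moll ε) F x ^ 2 ≤ ∫ x, F x ^ 2 := by
  have hκc : Continuous (moll ε) := (moll_contDiff ε).continuous
  have hκs := moll_hasCompactSupport hε
  have hκ : Integrable (moll ε) := hκc.integrable_of_hasCompactSupport hκs
  have hbd : ∃ A, ∀ t, ‖moll ε t‖ ≤ A := hκs.exists_bound_of_continuous hκc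
  obtain ⟨A, hA⟩ := hbd
  have hint : ∀ (H : E2 → ℝ), Integrable H → ∀ x, Integrable fun t => moll ε t * H (x - t) := by
    intro H hH x
    exact (hH.comp_sub_left x).bdd_mul hκc.aestronglyMeasurable
      (Filter.Eventually.of_forall hA)
  have hpt : ∀ x, conv (moll ε) F x ^ 2 ≤ conv (moll ε) (fun x => F x ^ 2) x := by
    intro x
    set m := conv (moll ε) F x with hm
    have i1 := hint _ hF2 x
    have i2 : Integrable fun t => 2 * m * (moll ε t * F (x - t)) := (hint _ hF x).const_mul _
    have i3 : Integrable fun t => m ^ 2 * moll ε t := hκ.const_mul _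
    have h0 : 0 ≤ ∫ t, moll ε t * (F (x - t) - m) ^ 2 :=
      integral_nonneg fun t => mul_nonneg (moll_nonneg ε t) (sq_nonneg _)
    have e : ∀ t, moll ε t * (F (x - t) - m) ^ 2 =
        moll ε t * F (x - t) ^ 2 - 2 * m * (moll ε t * F (x - t)) + m ^ 2 * moll ε t := fun t => by
      ring
    simp only [e] at h0
    have i12 : Integrable fun t => moll ε t * F (x - t) ^ 2 - 2 * m * (moll ε t * F (x - t)) :=
      i1.sub i2
    rw [integral_add i12 i3, integral_sub i1 i2, integral_const_mul, integral_const_mul,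
      moll_integral hε, ← conv_apply (moll ε) F x, ← hm] at h0
    rw [conv_apply]
    nlinarith
  have hci : Integrable (conv (moll ε) fun x => F x ^ 2) := hκ.integrable_convolution _ hF2
  calc ∫ x in S, conv (moll ε) F x ^ 2 ≤ ∫ x in S, conv (moll ε) (fun x => F x ^ 2) x := by
        refine setIntegral_mono_on ?_ hci.integrableOn hSm fun x _ => hpt x
        exact integrableOn_of_continuousOn_closure hS
          (((conv_contDiff hκs (moll_contDiff ε) hF.locallyIntegrable).continuous).pow 2).continuousOn
    _ ≤ ∫ x, conv (moll ε) (fun x => F x ^ 2) x :=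
        setIntegral_le_integral hci (Filter.Eventually.of_forall fun x => (sq_nonneg _).trans (hpt x))
    _ = ∫ x, F x ^ 2 := by
        have := integral_convolution (ContinuousLinearMap.lsmul ℝ ℝ) hκ hF2
        unfold conv
        rw [this, moll_integral hε]
        simp

namespace StarDisc

variable {G : Set E2} {y : E2} {h r : ℝ}

lemma dil (S : StarDisc G y h r) {a : ℝ} (ha : 0 < a) : StarDisc (dil y a G) y (a * h) (a * r) where
  isOpen := S.isOpen_dil a
  nonempty := by
    obtain ⟨x, hx⟩ := S.nonempty
    refine ⟨y + a • (x - y), ?_⟩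
    change y + a⁻¹ • (y + a • (x - y) - y) ∈ G
    rwa [add_sub_cancel_left, smul_smul, inv_mul_cancel₀ ha.ne', one_smul, add_sub_cancel]
  h_pos := mul_pos ha S.h_pos
  r_pos := mul_pos ha S.r_pos
  star := by
    intro z hz x hx s t hs ht hst
    have hz' : y + a⁻¹ • (z - y) ∈ Metric.ball y r := by
      rw [mem_ball_iff_norm, add_sub_cancel_left, norm_smul, Real.norm_eq_abs,
        abs_of_pos (by positivity), inv_mul_lt_iff₀ ha]
      exact mem_ball_iff_norm.1 hz
    have := S.star _ hz' hx hs ht hst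
    change y + a⁻¹ • (s • z + t • x - y) ∈ G
    convert this using 1
    have : t = 1 - s := by linarith
    subst this
    module
  subset := by
    intro x hx
    have := S.subset hx
    rw [mem_closedBall_iff_norm, add_sub_cancel_left, norm_smul, Real.norm_eq_abs,
        abs_of_pos (by positivity), inv_mul_le_iff₀ ha] at this
    exact mem_closedBall_iff_norm.2 this

/-- Approximation on a slightly smaller copy of the domain, by mollification. -/
lemma exists_poly_approx_dil (S : StarDisc G y h r) {u : E2 → ℝ} (hu : ContinuousOn u (closure G))
    {n : ℕ} (hn : 1 ≤ n) {β : ℝ} (hβ : 0 < β)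
    (huβ : ∀ a b, a + b = n + 1 → ∃ g, IsWeakDeriv G a b u g ∧ ∫ x in G, g x ^ 2 ≤ β ^ 2)
    {η : ℝ} (hη : 0 < η) {a : ℝ} (ha : 0 < a) (ha1 : a < 1) :
    ∃ q : MvPolynomial (Fin 2) ℝ, q.totalDegree ≤ n ∧ ∀ x ∈ VEM.dil y a G,
      |u x - polyFun q x| ≤ 4 ^ (n + 1) * h ^ (n + 1) / (√discArea * r) * β + η := by
  have hGm := S.isOpen.measurableSet
  have hcomp : IsCompact (closure G) := S.isBounded.isCompact_closure
  obtain ⟨ε₁, hε₁, huc⟩ := Metric.uniformContinuousOn_iff.1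
    (hcomp.uniformContinuousOn_of_continuous hu) η hη
  have h1a : 0 < 1 - a := by linarith
  have hr := S.r_pos
  have hh := S.h_pos
  have hω := Real.sqrt_pos.2 discArea_pos
  set ε := min ε₁ ((1 - a) * r / 2) with hε
  have hεpos : 0 < ε := lt_min hε₁ (by positivity)
  have hεr : ε < (1 - a) * r :=
    lt_of_le_of_lt (min_le_right _ _) (by have := mul_pos h1a hr; linarith)
  have hball : ∀ x ∈ VEM.dil y a G, Metric.closedBall x ε ⊆ G := by
    intro x hx
    have := S.closedBall_subset_dil ha ha1 hεr hx
    rwa [dil_one] at this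
  have hui : IntegrableOn u G := integrableOn_of_continuousOn_closure S.isBounded hu
  have huI : Integrable (G.indicator u) := (integrable_indicator_iff hGm).2 hui
  set f := conv (moll ε) (G.indicator u) with hf
  have hfs : ContDiff ℝ ∞ f := conv_contDiff (moll_hasCompactSupport hεpos) (moll_contDiff ε)
    huI.locallyIntegrable
  have Sd := S.dil ha
  obtain ⟨q, hq, hqe⟩ := Sd.exists_poly_approx_of_contDiff hfs hn hβ (fun i j hij => by
    obtain ⟨g, ⟨hg2, hgw⟩, hgβ⟩ := huβ i j hij
    have hfin : IsFiniteMeasure (volume.restrict G) :=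
      ⟨by rw [Measure.restrict_apply_univ]; exact S.volume_lt_top⟩
    have hgi : IntegrableOn g G := hg2.integrable (by norm_num)
    have hgs : IntegrableOn (fun x => g x ^ 2) G := hg2.integrable_sq
    have hgI : Integrable (G.indicator g) := (integrable_indicator_iff hGm).2 hgi
    have e2 : (fun x => G.indicator g x ^ 2) = G.indicator fun x => g x ^ 2 := by
      ext x
      by_cases hx : x ∈ G <;> simp [hx]
    have hgI2 : Integrable fun x => G.indicator g x ^ 2 := by
      rw [e2]; exact (integrable_indicator_iff hGm).2 hgs
    calc ∫ x in VEM.dil y a G, pdMulti i j f x ^ 2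
        = ∫ x in VEM.dil y a G, conv (moll ε) (G.indicator g) x ^ 2 := by
          refine setIntegral_congr_fun Sd.isOpen.measurableSet fun x hx => ?_
          simp only [hf]
          rw [pdMulti_moll_of_weak hGm hui hgw hεpos (hball x hx)]
      _ ≤ ∫ x, G.indicator g x ^ 2 :=
          setIntegral_sq_conv_moll_le hgI hgI2 hεpos Sd.isOpen.measurableSet Sd.isBounded
      _ = ∫ x in G, g x ^ 2 := by rw [e2, integral_indicator hGm]
      _ ≤ β ^ 2 := hgβ)
  refine ⟨q, hq, fun x hx => ?_⟩
  have hxG : x ∈ G := hball x hx (Metric.mem_closedBall_self hεpos.le)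
  have h1 : |f x - u x| ≤ η := by
    refine conv_moll_dist_le huI.aestronglyMeasurable hεpos hη.le fun t ht => ?_
    have htG : t ∈ G := hball x hx (Metric.ball_subset_closedBall ht)
    rw [indicator_of_mem htG, ← Real.dist_eq]
    exact (huc t (subset_closure htG) x (subset_closure hxG)
      (lt_of_lt_of_le (Metric.mem_ball.1 ht) (min_le_left _ _))).le
  have h2 := hqe x hx
  have h3 : 4 ^ (n + 1) * (a * h) ^ (n + 1) / (√discArea * (a * r)) * β ≤
      4 ^ (n + 1) * h ^ (n + 1) / (√discArea * r) * β := by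
    have e : 4 ^ (n + 1) * (a * h) ^ (n + 1) / (√discArea * (a * r)) * β =
        a ^ n * (4 ^ (n + 1) * h ^ (n + 1) / (√discArea * r) * β) := by
      rw [mul_pow, pow_succ a]; field_simp
    rw [e]
    exact mul_le_of_le_one_left (by positivity) (pow_le_one₀ ha.le ha1.le)
  have h4 := abs_sub_le (u x) (f x) (polyFun q x)
  rw [abs_sub_comm (f x)] at h1
  linarith

end StarDisc

/-- The Bramble–Hilbert lemma in the maximum norm, on domains star-shaped with respect to a disc of
comparable size, with a constant independent of the domain. -/
theorem exists_poly_approx {n : ℕ} (hn : 1 ≤ n) {δ : ℝ} (hδ : 0 < δ) :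
    ∃ C, 0 < C ∧ ∀ (G : Set E2) (y : E2) (h : ℝ), StarDisc G y h (δ * h) → ∀ u : E2 → ℝ,
      ContinuousOn u (closure G) → ∀ β : ℝ, 0 < β →
      (∀ a b, a + b = n + 1 → ∃ g, IsWeakDeriv G a b u g ∧ ∫ x in G, g x ^ 2 ≤ β ^ 2) →
      ∃ q : MvPolynomial (Fin 2) ℝ, q.totalDegree ≤ n ∧
        ∀ x ∈ closure G, |u x - polyFun q x| ≤ C * h ^ n * β := by
  obtain ⟨Ci, hCi, hinv⟩ := exists_poly_inverse n (half_pos hδ)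
  have hω := Real.sqrt_pos.2 discArea_pos
  set C₁ : ℝ := 4 ^ (n + 1) / (√discArea * δ) + 1 with hC₁
  have hC₁p : 0 < C₁ := by positivity
  refine ⟨C₁ + Ci * (2 * C₁ * (δ / 2 * √discArea)), by positivity, ?_⟩
  intro G y h S u hu β hβ huβ
  have hh := S.h_pos
  set A := C₁ * h ^ n * β with hA
  have hAp : 0 < A := by positivity
  have hex : ∀ a, 0 < a → a < 1 → ∃ q : MvPolynomial (Fin 2) ℝ, q.totalDegree ≤ n ∧
      ∀ x ∈ dil y a G, |u x - polyFun q x| ≤ A := by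
    intro a ha ha1
    obtain ⟨q, hq, h1⟩ := S.exists_poly_approx_dil hu hn hβ huβ (η := h ^ n * β) (by positivity) ha ha1
    refine ⟨q, hq, fun x hx => (h1 x hx).trans (le_of_eq ?_)⟩
    rw [hA, hC₁, pow_succ h]
    field_simp
  obtain ⟨q, hq, hqe⟩ := hex (1 / 2) (by norm_num) (by norm_num)
  refine ⟨q, hq, ?_⟩
  have hG : ∀ x ∈ G, |u x - polyFun q x| ≤ (C₁ + Ci * (2 * C₁ * (δ / 2 * √discArea))) * h ^ n * β := by
    intro x hx
    obtain ⟨a₀, ha₀, ha₀1, hxa₀⟩ := S.exists_subset_dil (isCompact_singleton (x := x))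
      (singleton_subset_iff.2 hx)
    set a := max a₀ (1 / 2) with ha
    have hap : 0 < a := lt_max_of_lt_left ha₀
    have ha1 : a < 1 := max_lt ha₀1 (by norm_num)
    have hxa : x ∈ dil y a G :=
      S.dil_subset_dil ha₀ (le_max_left _ _) (singleton_subset_iff.1 hxa₀)
    obtain ⟨qa, hqa, hqae⟩ := hex a hap ha1
    have hball : ∀ z ∈ Metric.ball y (δ / 2 * h), |polyFun (qa - q) z| ≤ 2 * A := by
      intro z hz
      have hz2 : z ∈ dil y (1 / 2) G := by
        refine (S.dil (a := 1 / 2) (by norm_num)).ball_subset ?_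
        convert hz using 2; ring
      have hza := S.dil_subset_dil (by norm_num : (0 : ℝ) < 1 / 2) (le_max_right a₀ (1 / 2)) hz2
      have h1 := hqe z hz2
      have h2 := hqae z hza
      rw [polyFun_sub]
      rw [abs_le] at *
      constructor <;> linarith [h1.1, h1.2, h2.1, h2.2]
    have hdeg : (qa - q).totalDegree ≤ n := (MvPolynomial.totalDegree_sub _ _).trans (max_le hqa hq)
    have h3 := (hinv y h hh (qa - q) hdeg x (S.subset hx)).1
    have h4 : √(∫ z in Metric.ball y (δ / 2 * h), polyFun (qa - q) z ^ 2) ≤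
        2 * A * (δ / 2 * h * √discArea) := by
      refine Real.sqrt_le_iff.2 ⟨by positivity, ?_⟩
      have i2 : IntegrableOn (fun _ : E2 => (2 * A) ^ 2) (Metric.ball y (δ / 2 * h)) :=
        integrableOn_const measure_ball_lt_top.ne
      refine (setIntegral_mono_on (integrableOn_of_continuousOn_closure Metric.isBounded_ball
        ((continuous_polyFun _).pow 2).continuousOn) i2 measurableSet_ball fun z hz => ?_).trans
        (le_of_eq ?_)
      · change polyFun (qa - q) z ^ 2 ≤ (2 * A) ^ 2
        rw [← sq_abs]; exact pow_le_pow_left₀ (abs_nonneg _) (hball z hz) 2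
      · rw [setIntegral_const, volume_real_ball y (by positivity), smul_eq_mul, mul_pow (2 * A),
          mul_pow (δ / 2 * h), Real.sq_sqrt discArea_pos.le]
        ring
    have h5 : |polyFun (qa - q) x| ≤ Ci * (2 * C₁ * (δ / 2 * √discArea)) * h ^ n * β := by
      refine h3.trans ((mul_le_mul_of_nonneg_left h4 (by positivity)).trans (le_of_eq ?_))
      rw [hA]; field_simp
    have h6 := hqae x hxa
    rw [polyFun_sub] at h5
    have h7 := abs_sub_le (u x) (polyFun qa x) (polyFun q x)
    calc |u x - polyFun q x| ≤ _ := h7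
      _ ≤ A + Ci * (2 * C₁ * (δ / 2 * √discArea)) * h ^ n * β := add_le_add h6 h5
      _ = _ := by rw [hA]; ring
  intro x hx
  have hcont : ContinuousOn (fun x => |u x - polyFun q x|) (closure G) :=
    (hu.sub (continuous_polyFun q).continuousOn).abs
  exact le_on_closure hG hcont continuousOn_const hx

/-! ### Polynomials on an edge -/

/-- A polynomial of degree at most `p` and its derivative are controlled on `[0, 1]` by the values
at any `p + 1` points, by Lagrange interpolation. -/
lemma exists_bound_of_nodes (p : ℕ) (s : Finset ℝ) (hs : p < s.card) :
    ∃ C, 1 ≤ C ∧ ∀ g : Polynomial ℝ, g.natDegree ≤ p → ∀ M : ℝ, (∀ t ∈ s, |g.eval t| ≤ M) →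
      ∀ t ∈ Icc (0 : ℝ) 1, |g.eval t| ≤ C * M ∧ |g.derivative.eval t| ≤ C * M := by
  have hb : ∀ i : ℝ, ∃ B : ℝ, 0 ≤ B ∧ ∀ t ∈ Icc (0 : ℝ) 1, |(Lagrange.basis s id i).eval t| ≤ B ∧
      |(Lagrange.basis s id i).derivative.eval t| ≤ B := by
    intro i
    obtain ⟨B₁, h1⟩ := (isCompact_Icc (a := (0 : ℝ)) (b := 1)).exists_bound_of_continuousOn
      (Lagrange.basis s id i).continuous.continuousOn
    obtain ⟨B₂, h2⟩ := (isCompact_Icc (a := (0 : ℝ)) (b := 1)).exists_bound_of_continuousOn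
      (Lagrange.basis s id i).derivative.continuous.continuousOn
    refine ⟨max (max B₁ B₂) 0, le_max_right _ _, fun t ht => ⟨?_, ?_⟩⟩
    · exact (h1 t ht).trans ((le_max_left _ _).trans (le_max_left _ _))
    · exact (h2 t ht).trans ((le_max_right _ _).trans (le_max_left _ _))
  choose B hB0 hB using hb
  have hS : 0 ≤ ∑ i ∈ s, B i := Finset.sum_nonneg fun i _ => hB0 i
  refine ⟨1 + ∑ i ∈ s, B i, by linarith, fun g hg M hM t ht => ?_⟩
  have hdeg : g.degree < s.card :=
    lt_of_le_of_lt Polynomial.degree_le_natDegree (by exact_mod_cast lt_of_le_of_lt hg hs)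
  have hne : s.Nonempty := Finset.card_pos.1 (by omega)
  have hM0 : 0 ≤ M := by
    obtain ⟨t, ht⟩ := hne
    exact (abs_nonneg _).trans (hM t ht)
  have e := Lagrange.eq_interpolate (s := s) (v := id) (fun _ _ _ _ h => h) hdeg
  rw [Lagrange.interpolate_apply] at e
  have key : ∀ b : ℝ → ℝ, (∀ i, |b i| ≤ B i) →
      |∑ i ∈ s, g.eval (id i) * b i| ≤ (1 + ∑ i ∈ s, B i) * M := by
    intro b hb
    calc |∑ i ∈ s, g.eval (id i) * b i| ≤ ∑ i ∈ s, M * B i := by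
          refine (Finset.abs_sum_le_sum_abs _ _).trans (Finset.sum_le_sum fun i hi => ?_)
          rw [abs_mul]
          exact mul_le_mul (hM i hi) (hb i) (abs_nonneg _) hM0
      _ ≤ _ := by rw [← Finset.mul_sum]; nlinarith
  constructor
  · rw [e]
    simp only [Polynomial.eval_finsetSum, Polynomial.eval_mul, Polynomial.eval_C]
    exact key _ fun i => (hB i t ht).1
  · rw [e]
    simp only [Polynomial.derivative_sum, Polynomial.derivative_C_mul, Polynomial.eval_finsetSum,
      Polynomial.eval_mul, Polynomial.eval_C]
    exact key _ fun i => (hB i t ht).2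

/-- Rolle's theorem for several roots. -/
lemma exists_derivative_roots (g : Polynomial ℝ) {k : ℕ} (s : Finset ℝ) (hs : s.card = k + 1)
    (h01 : ∀ t ∈ s, t ∈ Icc (0 : ℝ) 1) (hg : ∀ t ∈ s, g.eval t = 0) :
    ∃ s' : Finset ℝ, s'.card = k ∧ ∀ t ∈ s', t ∈ Ioo (0 : ℝ) 1 ∧ g.derivative.eval t = 0 := by
  set f := s.orderEmbOfFin hs with hf
  have hmem : ∀ i, f i ∈ s := fun i => s.orderEmbOfFin_mem hs i
  have hex : ∀ i : Fin k, ∃ t ∈ Ioo (f i.castSucc) (f i.succ), g.derivative.eval t = 0 := by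
    intro i
    obtain ⟨t, ht, h0⟩ := exists_deriv_eq_zero (f := fun x => g.eval x)
      (f.strictMono (Fin.castSucc_lt_succ (i := i))) g.continuous.continuousOn
      (by rw [hg _ (hmem _), hg _ (hmem _)])
    exact ⟨t, ht, by rwa [Polynomial.deriv] at h0⟩
  choose c hc hc0 using hex
  have hmono : StrictMono c := by
    intro i j hij
    have h1 : f i.succ ≤ f j.castSucc := f.monotone (by
      rw [Fin.le_def]; simp only [Fin.val_succ, Fin.val_castSucc]; exact hij)
    exact lt_of_lt_of_le (hc i).2 (h1.trans (hc j).1.le)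
  refine ⟨Finset.univ.image c, ?_, ?_⟩
  · rw [Finset.card_image_of_injective _ hmono.injective]; simp
  · intro t ht
    obtain ⟨i, -, rfl⟩ := Finset.mem_image.1 ht
    exact ⟨⟨lt_of_le_of_lt (h01 _ (hmem _)).1 (hc i).1, lt_of_lt_of_le (hc i).2 (h01 _ (hmem _)).2⟩,
      hc0 i⟩

/-- The derivatives of `X ^ p * (1 - X) ^ p` of order `k ≤ p` have `k` zeros in `(0, 1)`. -/
lemma exists_iterate_derivative_roots (p : ℕ) : ∀ k, k ≤ p → ∃ s : Finset ℝ, s.card = k ∧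
    ∀ t ∈ s, t ∈ Ioo (0 : ℝ) 1 ∧
      (Polynomial.derivative^[k] ((Polynomial.X : Polynomial ℝ) ^ p * (1 - Polynomial.X) ^ p)).eval t = 0 := by
  intro k
  induction k with
  | zero => exact fun _ => ⟨∅, rfl, by simp⟩
  | succ k ih =>
    intro hk
    obtain ⟨s, hs, h⟩ := ih (by omega)
    set g := Polynomial.derivative^[k] ((Polynomial.X : Polynomial ℝ) ^ p * (1 - Polynomial.X) ^ p)
    have h0 : g.eval 0 = 0 := by
      have : (Polynomial.X : Polynomial ℝ) ^ (p - k) ∣ g :=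
        Polynomial.pow_sub_dvd_iterate_derivative_of_pow_dvd k (Dvd.intro _ rfl)
      obtain ⟨r, hr⟩ := this
      rw [hr, Polynomial.eval_mul, Polynomial.eval_pow, Polynomial.eval_X, zero_pow (by omega),
        zero_mul]
    have h1 : g.eval 1 = 0 := by
      have : (1 - Polynomial.X : Polynomial ℝ) ^ (p - k) ∣ g :=
        Polynomial.pow_sub_dvd_iterate_derivative_of_pow_dvd k (Dvd.intro_left _ rfl)
      obtain ⟨r, hr⟩ := this
      rw [hr, Polynomial.eval_mul, Polynomial.eval_pow, Polynomial.eval_sub, Polynomial.eval_one,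
        Polynomial.eval_X, sub_self, zero_pow (by omega), zero_mul]
    obtain ⟨s', hs', h'⟩ := exists_derivative_roots g (k := k + 1) (insert 0 (insert 1 s)) (by
        have n1 : (1 : ℝ) ∉ s := fun hm => (h 1 hm).1.2.false
        have n0 : (0 : ℝ) ∉ insert 1 s := by
          rw [Finset.mem_insert]
          rintro (h | hm)
          · norm_num at h
          · exact (h 0 hm).1.1.false
        rw [Finset.card_insert_of_notMem n0, Finset.card_insert_of_notMem n1, hs]) (by
        intro t ht
        rcases Finset.mem_insert.1 ht with rfl | ht
        · norm_num
        rcases Finset.mem_insert.1 ht with rfl | ht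
        · norm_num
        · exact Ioo_subset_Icc_self (h t ht).1) (by
        intro t ht
        rcases Finset.mem_insert.1 ht with rfl | ht
        · exact h0
        rcases Finset.mem_insert.1 ht with rfl | ht
        · exact h1
        · exact (h t ht).2)
    refine ⟨s', hs', fun t ht => ?_⟩
    rw [Function.iterate_succ_apply']
    exact h' t ht

/-- There are at least `p + 1` Gauss–Lobatto nodes in `[0, 1]`. -/
lemma exists_lobatto_nodes {p : ℕ} (hp : 1 ≤ p) : ∃ s : Finset ℝ, p < s.card ∧
    ∀ t ∈ s, t ∈ Icc (0 : ℝ) 1 ∧ IsLobatto p t := by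
  obtain ⟨s, hs, h⟩ := exists_iterate_derivative_roots p p le_rfl
  set L := (Polynomial.shiftedLegendre p).map (Int.castRingHom ℝ) with hL
  have hfac : (p.factorial : Polynomial ℝ) * L =
      Polynomial.derivative^[p] ((Polynomial.X : Polynomial ℝ) ^ p * (1 - Polynomial.X) ^ p) := by
    have := congrArg (Polynomial.map (Int.castRingHom ℝ))
      (Polynomial.factorial_mul_shiftedLegendre_eq p)
    rw [Polynomial.map_mul, ← Polynomial.iterate_derivative_map] at this
    simpa using this
  have hLroot : ∀ t ∈ s, L.eval t = 0 := by
    intro t ht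
    have h1 := (h t ht).2
    rw [← hfac, Polynomial.eval_mul, Polynomial.eval_natCast] at h1
    exact (mul_eq_zero.1 h1).resolve_left (by exact_mod_cast p.factorial_ne_zero)
  obtain ⟨s', hs', h'⟩ := exists_derivative_roots L (k := p - 1) s (by omega)
    (fun t ht => Ioo_subset_Icc_self (h t ht).1) hLroot
  refine ⟨insert 0 (insert 1 s'), ?_, ?_⟩
  · have n1 : (1 : ℝ) ∉ s' := fun hm => (h' 1 hm).1.2.false
    have n0 : (0 : ℝ) ∉ insert 1 s' := by
      rw [Finset.mem_insert]
      rintro (h | hm)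
      · norm_num at h
      · exact (h' 0 hm).1.1.false
    rw [Finset.card_insert_of_notMem n0, Finset.card_insert_of_notMem n1, hs']
    omega
  · intro t ht
    rcases Finset.mem_insert.1 ht with rfl | ht
    · exact ⟨by norm_num, Or.inl rfl⟩
    rcases Finset.mem_insert.1 ht with rfl | ht
    · exact ⟨by norm_num, Or.inr (Or.inl rfl)⟩
    · exact ⟨Ioo_subset_Icc_self (h' t ht).1, Or.inr (Or.inr (h' t ht).2)⟩

/-- The maximum of a polynomial on `[0, 1]` is comparable with its absolute value on a whole
interval about some point of the middle third. -/
lemma exists_middle_point (p : ℕ) : ∃ C, 1 ≤ C ∧ ∀ g : Polynomial ℝ, g.natDegree ≤ p →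
    ∃ t₀ ∈ Icc (1 / 3 : ℝ) (2 / 3), (∀ t ∈ Icc (0 : ℝ) 1, |g.eval t| ≤ C * |g.eval t₀|) ∧
      ∀ t ∈ Icc (0 : ℝ) 1, |t - t₀| ≤ 1 / (2 * C) → |g.eval t - g.eval t₀| ≤ |g.eval t₀| / 2 := by
  set s : Finset ℝ := (Finset.range (p + 1)).image fun i : ℕ => 1 / 3 + (i : ℝ) / (3 * (p + 1)) with hs
  have hcard : p < s.card := by
    rw [hs, Finset.card_image_of_injective, Finset.card_range]
    · omega
    · intro i j hij
      have h3 : (0 : ℝ) < 3 * (p + 1) := by positivity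
      have : (i : ℝ) / (3 * (p + 1)) = j / (3 * (p + 1)) := by simpa using hij
      rw [div_left_inj' h3.ne'] at this
      exact_mod_cast this
  have hmem : ∀ t ∈ s, t ∈ Icc (1 / 3 : ℝ) (2 / 3) := by
    intro t ht
    obtain ⟨i, hi, rfl⟩ := Finset.mem_image.1 ht
    have hi' : (i : ℝ) ≤ p + 1 := by exact_mod_cast (Finset.mem_range.1 hi).le
    have h1 : (i : ℝ) / (3 * (p + 1)) ≤ 1 / 3 := by
      rw [div_le_div_iff₀ (by positivity) (by norm_num)]; linarith
    have h2 : 0 ≤ (i : ℝ) / (3 * (p + 1)) := by positivity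
    exact ⟨by linarith, by linarith⟩
  obtain ⟨C, hC1, hC⟩ := exists_bound_of_nodes p s hcard
  refine ⟨C, hC1, fun g hg => ?_⟩
  obtain ⟨t₀, ht₀, hmax⟩ := (isCompact_Icc (a := (1 / 3 : ℝ)) (b := 2 / 3)).exists_isMaxOn
    (nonempty_Icc.2 (by norm_num)) (g.continuous.abs.continuousOn)
  have hb := hC g hg |g.eval t₀| fun t ht => hmax (hmem t ht)
  refine ⟨t₀, ht₀, fun t ht => (hb t ht).1, fun t ht htt => ?_⟩
  have ht₀' : t₀ ∈ Icc (0 : ℝ) 1 := ⟨by linarith [ht₀.1], by linarith [ht₀.2]⟩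
  have hlip := (convex_Icc (0 : ℝ) 1).norm_image_sub_le_of_norm_deriv_le (f := fun x => g.eval x)
    (C := C * |g.eval t₀|) (fun x _ => g.differentiable.differentiableAt)
    (fun x hx => by rw [Polynomial.deriv]; exact (hb x hx).2) ht₀' ht
  refine (show |g.eval t - g.eval t₀| ≤ _ from hlip).trans ?_
  rw [Real.norm_eq_abs]
  have h0 := abs_nonneg (g.eval t₀)
  calc C * |g.eval t₀| * |t - t₀| ≤ C * |g.eval t₀| * (1 / (2 * C)) := by gcongr
    _ = |g.eval t₀| / 2 := by field_simp

/-! ### An element near the middle third of an edge -/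

lemma StarDisc.openSegment_subset {G : Set E2} {y : E2} {h r : ℝ} (S : StarDisc G y h r) {b x : E2}
    (hb : b ∈ Metric.ball y r) (hx : x ∈ closure G) : openSegment ℝ b x ⊆ G := by
  rintro w ⟨s, t, hs, ht, hst, rfl⟩
  obtain ⟨e, he, hball⟩ := Metric.isOpen_iff.1 Metric.isOpen_ball b hb
  obtain ⟨x', hx', hd⟩ := Metric.mem_closure_iff.1 hx (e * s / t) (by positivity)
  have hb' : b + (t / s) • (x - x') ∈ Metric.ball y r := by
    refine hball ?_
    rw [mem_ball_iff_norm, add_sub_cancel_left, norm_smul, Real.norm_eq_abs,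
      abs_of_pos (by positivity), ← dist_eq_norm]
    calc t / s * dist x x' < t / s * (e * s / t) := by gcongr
      _ = e := by field_simp
  have := S.star _ hb' hx' hs.le ht.le hst
  convert this using 1
  have e1 : s * (t / s) = t := by field_simp
  rw [smul_add, smul_smul, e1, smul_sub]
  abel

/-- A unit normal to a non-zero vector, pointing to a prescribed side. -/
lemma exists_unit_normal {e : E2} (he : e ≠ 0) (w : E2) : ∃ ν : E2, ‖ν‖ = 1 ∧ inner ℝ e ν = 0 ∧
    0 ≤ inner ℝ w ν ∧ ∀ x : E2, inner ℝ x ν = 0 → ∃ s : ℝ, x = s • e := by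
  have hL : 0 < ‖e‖ := norm_pos_iff.2 he
  have hL2 : ‖e‖ ^ 2 = e 0 ^ 2 + e 1 ^ 2 := by
    rw [EuclideanSpace.norm_sq_eq]; simp
  have main : ∃ ν : E2, ‖ν‖ = 1 ∧ inner ℝ e ν = 0 ∧
      ∀ x : E2, inner ℝ x ν = 0 → ∃ s : ℝ, x = s • e := by
    refine ⟨‖e‖⁻¹ • !₂[-e 1, e 0], ?_, ?_, ?_⟩
    · have : ‖(!₂[-e 1, e 0] : E2)‖ ^ 2 = ‖e‖ ^ 2 := by
        rw [EuclideanSpace.norm_sq_eq, hL2]; simp; ring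
      have h2 : ‖(!₂[-e 1, e 0] : E2)‖ = ‖e‖ :=
        (pow_left_inj₀ (norm_nonneg _) (norm_nonneg _) two_ne_zero).1 this
      rw [norm_smul, h2, norm_inv, norm_norm, inv_mul_cancel₀ hL.ne']
    · rw [inner_smul_right]
      simp [PiLp.inner_apply]
      right; ring
    · intro x hx
      rw [inner_smul_right] at hx
      have hx' : inner ℝ x (!₂[-e 1, e 0] : E2) = 0 :=
        (mul_eq_zero.1 hx).resolve_left (inv_ne_zero hL.ne')
      simp [PiLp.inner_apply] at hx'
      refine ⟨(x 0 * e 0 + x 1 * e 1) / ‖e‖ ^ 2, ?_⟩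
      have hne : e 0 ^ 2 + e 1 ^ 2 ≠ 0 := by rw [← hL2]; positivity
      ext j
      rw [PiLp.smul_apply, smul_eq_mul, hL2]
      fin_cases j
      · simp only [Fin.zero_eta]
        rw [div_mul_eq_mul_div, eq_div_iff hne]
        linear_combination (-e 1) * hx'
      · simp only [Fin.mk_one]
        rw [div_mul_eq_mul_div, eq_div_iff hne]
        linear_combination (e 0) * hx'
  obtain ⟨ν, h1, h2, h3⟩ := main
  rcases le_total 0 (inner ℝ w ν) with h | h
  · exact ⟨ν, h1, h2, h, h3⟩
  · refine ⟨-ν, by rwa [norm_neg], by rw [inner_neg_right, h2, neg_zero],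
      by rw [inner_neg_right]; linarith, fun x hx => h3 x ?_⟩
    rwa [inner_neg_right, neg_eq_zero] at hx

/-- Near a point in the middle third of a boundary segment the domain is a half-disc. -/
lemma StarDisc.exists_halfDisc {G : Set E2} {y : E2} {h δ : ℝ} (hδ : 0 < δ) (S : StarDisc G y h (δ * h))
    {c : ℝ} {P Q : E2} (hseg : segment ℝ P Q ⊆ frontier G) (hL : c * h ≤ dist P Q) (hPQ : P ≠ Q)
    {t₀ : ℝ} (ht₀ : t₀ ∈ Icc (1 / 3 : ℝ) (2 / 3)) {R : ℝ} (hR : 0 < R) (hR1 : R ≤ δ * h / 2)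
    (hRh : R ≤ h) (hR2 : R * (1 + 4 / δ) ≤ c * h / 3) :
    ∃ ν : E2, ‖ν‖ = 1 ∧
      (∀ x ∈ Metric.closedBall (AffineMap.lineMap P Q t₀) R,
        0 < inner ℝ (x - AffineMap.lineMap P Q t₀) ν → x ∈ G) ∧
      (∀ x ∈ Metric.closedBall (AffineMap.lineMap P Q t₀) R, x ∈ closure G →
        0 ≤ inner ℝ (x - AffineMap.lineMap P Q t₀) ν) ∧
      ∀ x ∈ Metric.closedBall (AffineMap.lineMap P Q t₀) R,
        inner ℝ (x - AffineMap.lineMap P Q t₀) ν = 0 → ∃ t ∈ Icc (0 : ℝ) 1,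
          x = AffineMap.lineMap P Q t ∧ |t - t₀| * dist P Q ≤ R := by
  have hh := S.h_pos
  have hr := S.r_pos
  set z : E2 := AffineMap.lineMap P Q t₀ with hz
  have hline : ∀ t : ℝ, (AffineMap.lineMap P Q t : E2) = z + (t - t₀) • (Q - P) := by
    intro t
    rw [hz, AffineMap.lineMap_apply_module', AffineMap.lineMap_apply_module']
    module
  have hmemseg : ∀ t ∈ Icc (0 : ℝ) 1, (AffineMap.lineMap P Q t : E2) ∈ segment ℝ P Q := by
    intro t ht
    rw [segment_eq_image_lineMap]
    exact mem_image_of_mem _ ht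
  have hnotG : ∀ t ∈ Icc (0 : ℝ) 1, (AffineMap.lineMap P Q t : E2) ∉ G := by
    intro t ht hG
    have := hseg (hmemseg t ht)
    rw [S.isOpen.frontier_eq] at this
    exact this.2 hG
  have hcl : ∀ t ∈ Icc (0 : ℝ) 1, (AffineMap.lineMap P Q t : E2) ∈ closure G := fun t ht =>
    frontier_subset_closure (hseg (hmemseg t ht))
  have he : Q - P ≠ 0 := sub_ne_zero.2 (Ne.symm hPQ)
  obtain ⟨ν, hν1, hνe, hνy, hνx⟩ := exists_unit_normal he (y - z)
  have hdist : dist P Q = ‖Q - P‖ := by rw [dist_comm, dist_eq_norm]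
  have hLpos : 0 < dist P Q := dist_pos.2 hPQ
  have hnorm : ∀ x : E2, inner ℝ x ν ≤ ‖x‖ := fun x => by
    simpa [hν1] using real_inner_le_norm x ν
  have hnorm' : ∀ x : E2, -‖x‖ ≤ inner ℝ x ν := fun x => by
    have := hnorm (-x)
    rw [inner_neg_left, norm_neg] at this
    linarith
  have hνν : inner ℝ ν ν = 1 := by rw [real_inner_self_eq_norm_sq, hν1, one_pow]
  have honline : ∀ x : E2, inner ℝ (x - z) ν = 0 → ∃ t : ℝ, x = AffineMap.lineMap P Q t ∧
      |t - t₀| * dist P Q = ‖x - z‖ := by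
    intro x hx
    obtain ⟨s, hs⟩ := hνx _ hx
    refine ⟨t₀ + s, ?_, ?_⟩
    · rw [hline, add_sub_cancel_left, ← hs, add_sub_cancel]
    · rw [hs, norm_smul, hdist, Real.norm_eq_abs, add_sub_cancel_left]
  have hclose : ∀ x : E2, inner ℝ (x - z) ν = 0 → ‖x - z‖ ≤ c * h / 3 → ∃ t ∈ Icc (0 : ℝ) 1,
      x = AffineMap.lineMap P Q t ∧ |t - t₀| * dist P Q = ‖x - z‖ := by
    intro x hx hxz
    obtain ⟨t, ht, htL⟩ := honline x hx
    have h1 : |t - t₀| ≤ 1 / 3 := by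
      have : |t - t₀| * dist P Q ≤ 1 / 3 * dist P Q := by rw [htL]; linarith
      exact le_of_mul_le_mul_right this hLpos
    rw [abs_le] at h1
    exact ⟨t, ⟨by linarith [ht₀.1, h1.1], by linarith [ht₀.2, h1.2]⟩, ht, htL⟩
  -- the disc of centres lies on one side of the line through the edge
  have hdy : δ * h ≤ inner ℝ (y - z) ν := by
    by_contra! hlt
    set b := y - (inner ℝ (y - z) ν : ℝ) • ν with hb
    have hbB : b ∈ Metric.ball y (δ * h) := by
      rw [mem_ball_iff_norm, hb, sub_sub_cancel_left, norm_neg, norm_smul, hν1, mul_one,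
        Real.norm_eq_abs, abs_of_nonneg hνy]
      exact hlt
    have hb0 : inner ℝ (b - z) ν = 0 := by
      rw [hb, sub_right_comm, inner_sub_left, inner_smul_left, hνν]
      simp
    obtain ⟨t, ht, -⟩ := honline b hb0
    have hbG := S.ball_subset hbB
    have key : ∀ a ∈ Icc (0 : ℝ) 1, ∀ a' ∈ Icc (0 : ℝ) 1, ∀ τ : ℝ, 0 < τ → τ < 1 →
        a = (1 - τ) * t + τ * a' → False := by
      intro a ha a' ha' τ h0 h1 hτ
      refine hnotG a ha (S.openSegment_subset hbB (hcl a' ha') ⟨1 - τ, τ, by linarith, h0, by ring, ?_⟩)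
      rw [ht, hline, hline, hline, hτ]
      module
    rcases lt_or_ge t 0 with h0 | h0
    · refine key 0 (by simp) 1 (by simp) (-t / (1 - t)) (div_pos (by linarith) (by linarith)) ?_ ?_
      · rw [div_lt_one (by linarith)]; linarith
      · have : (1 - t) ≠ 0 := by linarith
        field_simp; ring
    · rcases le_or_gt t 1 with h1 | h1
      · exact hnotG t ⟨h0, h1⟩ (ht ▸ hbG)
      · refine key 1 (by simp) 0 (by simp) ((t - 1) / t) (div_pos (by linarith) (by linarith)) ?_ ?_
        · rw [div_lt_one (by linarith)]; linarith
        · have : t ≠ 0 := by linarith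
          field_simp; ring
  have hzcl : z ∈ closure G := hcl t₀ ⟨by linarith [ht₀.1], by linarith [ht₀.2]⟩
  have hyz : ‖y - z‖ ≤ h := by
    rw [← dist_eq_norm, dist_comm]
    exact closure_minimal S.subset Metric.isClosed_closedBall hzcl
  -- the ray from `y` through a point `x` near `z` meets the edge
  have hray : ∀ x ∈ Metric.closedBall z R, ∃ t ∈ Icc (0 : ℝ) 1,
      (AffineMap.lineMap P Q t : E2) = y + (inner ℝ (y - z) ν / (inner ℝ (y - z) ν - inner ℝ (x - z) ν)) •
        (x - y) := by
    intro x hx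
    rw [mem_closedBall_iff_norm] at hx
    set dy : ℝ := inner ℝ (y - z) ν
    set dx : ℝ := inner ℝ (x - z) ν with hdx
    have hdx1 : dx ≤ R := (hnorm _).trans hx
    have hdx2 : -R ≤ dx := by linarith [hnorm' (x - z)]
    have hpos : δ * h / 2 ≤ dy - dx := by linarith
    have hpos' : 0 < dy - dx := by linarith
    set e := y + (dy / (dy - dx)) • (x - y) with he
    have e1 : e - z = (x - z) + (dx / (dy - dx)) • (x - y) := by
      have : dy / (dy - dx) = 1 + dx / (dy - dx) := by field_simp; ring
      rw [he, this]; module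
    have hxy : inner ℝ (x - y) ν = dx - dy := by
      rw [show x - y = (x - z) - (y - z) by abel, inner_sub_left]
    have e0 : inner ℝ (e - z) ν = 0 := by
      rw [e1, inner_add_left, inner_smul_left, hxy, ← hdx]
      simp only [conj_trivial]
      field_simp; ring
    have hxyn : ‖x - y‖ ≤ 2 * h := by
      rw [show x - y = (x - z) - (y - z) by abel]
      linarith [norm_sub_le (x - z) (y - z)]
    have hfrac : |dx / (dy - dx)| ≤ R / (δ * h / 2) := by
      rw [abs_div, abs_of_pos hpos']
      exact div_le_div₀ hR.le (abs_le.2 ⟨hdx2, hdx1⟩) (by positivity) hpos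
    have hez : ‖e - z‖ ≤ c * h / 3 := by
      rw [e1]
      refine (norm_add_le _ _).trans ?_
      rw [norm_smul, Real.norm_eq_abs]
      have : |dx / (dy - dx)| * ‖x - y‖ ≤ R / (δ * h / 2) * (2 * h) :=
        mul_le_mul hfrac hxyn (norm_nonneg _) (by positivity)
      have e2 : R / (δ * h / 2) * (2 * h) = R * (4 / δ) := by field_simp; ring
      linarith [hR2]
    obtain ⟨t, ht, hte, -⟩ := hclose e e0 hez
    exact ⟨t, ht, hte.symm⟩
  have hyball : y ∈ Metric.ball y (δ * h) := Metric.mem_ball_self hr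
  refine ⟨ν, hν1, ?_, ?_, ?_⟩
  · intro x hx hpos
    obtain ⟨t, ht, hte⟩ := hray x hx
    rw [mem_closedBall_iff_norm] at hx
    have hdx1 := (hnorm (x - z)).trans hx
    set dy : ℝ := inner ℝ (y - z) ν
    set dx : ℝ := inner ℝ (x - z) ν
    have hlt : 0 < dy - dx := by linarith
    have hdy0 : 0 < dy := by linarith
    refine S.openSegment_subset hyball (hcl t ht) ⟨dx / dy, (dy - dx) / dy, by positivity,
      by positivity, by field_simp; ring, ?_⟩
    rw [hte, smul_add, smul_smul]
    have e1 : (dy - dx) / dy * (dy / (dy - dx)) = 1 := by field_simp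
    have e2 : dx / dy = 1 - (dy - dx) / dy := by field_simp; ring
    rw [e1, e2]
    module
  · intro x hx hxG
    by_contra! hneg
    obtain ⟨t, ht, hte⟩ := hray x hx
    set dy : ℝ := inner ℝ (y - z) ν
    set dx : ℝ := inner ℝ (x - z) ν
    have hdy0 : 0 < dy := by linarith
    have hlt : 0 < dy - dx := by linarith
    refine hnotG t ht ?_
    rw [hte]
    refine S.openSegment_subset hyball hxG ⟨-dx / (dy - dx), dy / (dy - dx),
      div_pos (by linarith) hlt, by positivity, by field_simp; ring, ?_⟩
    have e2 : -dx / (dy - dx) = 1 - dy / (dy - dx) := by field_simp; ring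
    rw [e2]
    module
  · intro x hx h0
    rw [mem_closedBall_iff_norm] at hx
    have h1 : R ≤ c * h / 3 := by
      have : 0 ≤ R * (4 / δ) := by positivity
      linarith
    obtain ⟨t, ht, hte, hL'⟩ := hclose x h0 (hx.trans h1)
    exact ⟨t, ht, hte, hL'.trans_le hx⟩

/-! ### The inverse estimate for virtual element functions -/

/-- The polynomial `a + b |x - z|² + c ⟨x - z, ν⟩² + d ⟨x - z, ν⟩`. -/
noncomputable def quadPoly (z ν : E2) (a b c d : ℝ) : MvPolynomial (Fin 2) ℝ :=
  let X := MvPolynomial.X 0 - MvPolynomial.C (z 0)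
  let Y := MvPolynomial.X 1 - MvPolynomial.C (z 1)
  let L := MvPolynomial.C (ν 0) * X + MvPolynomial.C (ν 1) * Y
  MvPolynomial.C a + MvPolynomial.C b * (X * X + Y * Y) + MvPolynomial.C c * (L * L) +
    MvPolynomial.C d * L

lemma polyFun_quadPoly (z ν : E2) (a b c d : ℝ) (x : E2) : polyFun (quadPoly z ν a b c d) x =
    a + b * ‖x - z‖ ^ 2 + c * inner ℝ (x - z) ν ^ 2 + d * inner ℝ (x - z) ν := by
  rw [EuclideanSpace.norm_sq_eq]
  simp [polyFun, quadPoly, PiLp.inner_apply]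
  ring

lemma polyFun_lapPoly_quadPoly (z : E2) {ν : E2} (hν : ‖ν‖ = 1) (a b c d : ℝ) (x : E2) :
    polyFun (lapPoly (quadPoly z ν a b c d)) x = 4 * b + 2 * c := by
  have h : ν 0 ^ 2 + ν 1 ^ 2 = 1 := by
    have := EuclideanSpace.norm_sq_eq ν
    rw [hν] at this
    simpa using this.symm
  simp [polyFun, lapPoly, quadPoly, MvPolynomial.pderiv_X]
  linear_combination 2 * c * h

/-- Adding a quadratic polynomial to a function with a given weak Laplacian. -/
lemma WeakLap.quadPoly_sub {G : Set E2} (hb : Bornology.IsBounded G) {v q : E2 → ℝ}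
    (hv : ContinuousOn v (closure G)) (hq : Continuous q) (hvq : WeakLap G v q) (z : E2) {ν : E2}
    (hν : ‖ν‖ = 1) (a b c d : ℝ) :
    WeakLap G (fun x => polyFun (quadPoly z ν a b c d) x + -v x) fun x => 4 * b + 2 * c + -q x := by
  have h1 := weakLap_polyFun G (quadPoly z ν a b c d)
  have h2 := WeakLap.add (integrableOn_of_continuousOn_closure hb (continuous_polyFun _).continuousOn)
    (integrableOn_of_continuousOn_closure hb hv.neg)
    (integrableOn_of_continuousOn_closure hb (continuous_polyFun _).continuousOn)
    (integrableOn_of_continuousOn_closure hb hq.neg.continuousOn) h1 hvq.neg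
  simpa only [polyFun_lapPoly_quadPoly z hν, Pi.neg_apply] using h2

/-- The maximum principle with a bounded right-hand side. -/
lemma WeakLap.abs_le_of_frontier {G : Set E2} (hG : IsOpen G) {y : E2} {h : ℝ}
    (hGh : G ⊆ Metric.closedBall y h) {v q : E2 → ℝ} (hv : ContinuousOn v (closure G))
    (hq : Continuous q) (hvq : WeakLap G v q) {K M : ℝ} (hK : 0 ≤ K) (hqK : ∀ x ∈ G, |q x| ≤ K)
    (hM : 0 ≤ M) (hfr : ∀ x ∈ frontier G, |v x| ≤ M) :
    ∀ x ∈ closure G, |v x| ≤ M + K * h ^ 2 / 4 := by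
  have hb : Bornology.IsBounded G := Metric.isBounded_closedBall.subset hGh
  have main : ∀ w r : E2 → ℝ, ContinuousOn w (closure G) → Continuous r → WeakLap G w r →
      (∀ x ∈ G, |r x| ≤ K) → (∀ x ∈ frontier G, |w x| ≤ M) →
      ∀ x ∈ closure G, -w x ≤ M + K * h ^ 2 / 4 := by
    intro w r hw hr hwr hrK hwM x hx
    have hν : ‖(EuclideanSpace.single 0 1 : E2)‖ = 1 := by simp
    have h1 := WeakLap.quadPoly_sub hb hw hr hwr y hν (-(K * h ^ 2 / 4)) (K / 4) 0 0
    have h2 := h1.le_of_frontier_le hG hb ((continuous_polyFun _).continuousOn.add hw.neg)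
      (by fun_prop) (fun x hx => by have := (abs_le.1 (hrK x hx)).2; linarith) hM (fun x hx => by
        have hxh := mem_closedBall_iff_norm.1
          (closure_minimal hGh Metric.isClosed_closedBall (frontier_subset_closure hx))
        have h3 := (abs_le.1 (hwM x hx)).1
        have h4 : ‖x - y‖ ^ 2 ≤ h ^ 2 := pow_le_pow_left₀ (norm_nonneg _) hxh 2
        change polyFun _ x + -w x ≤ M
        rw [polyFun_quadPoly]
        nlinarith) x hx
    change polyFun _ x + -w x ≤ M at h2
    rw [polyFun_quadPoly] at h2
    have : 0 ≤ K / 4 * ‖x - y‖ ^ 2 := by positivity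
    linarith
  intro x hx
  have h1 := main v q hv hq hvq hqK hfr x hx
  have h2 := main (fun x => -v x) (fun x => -q x) hv.neg hq.neg hvq.neg
    (fun x hx => by rw [abs_neg]; exact hqK x hx) (fun x hx => by rw [abs_neg]; exact hfr x hx) x hx
  rw [abs_le]
  constructor <;> linarith

/-- A lower barrier in a half-disc. The function
`(|x - z|² - 2 ⟨x - z, ν⟩²) / R² + 3 ⟨x - z, ν⟩ / R` is harmonic, at least `|x - z|² / R²` on the
half-disc, and small near `z`. -/
lemma le_of_halfDisc {G : Set E2} (hG : IsOpen G) (hb : Bornology.IsBounded G) {v q : E2 → ℝ}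
    (hv : ContinuousOn v (closure G)) (hq : Continuous q) (hvq : WeakLap G v q) {K : ℝ} (hK : 0 ≤ K)
    (hqK : ∀ x ∈ G, |q x| ≤ K) {z ν : E2} (hν : ‖ν‖ = 1) {R κ M : ℝ} (hR : 0 < R) (hκ : 0 ≤ κ)
    (hM : 0 ≤ M) (hd : ∀ x ∈ Metric.closedBall z R, x ∈ closure G → 0 ≤ inner ℝ (x - z) ν)
    (hfr : ∀ x ∈ Metric.closedBall z R, x ∈ frontier G → κ ≤ v x)
    (hvM : ∀ x ∈ closure G, -M ≤ v x) :
    ∀ x ∈ G ∩ Metric.ball z R,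
      κ - (M + κ) * (‖x - z‖ ^ 2 / R ^ 2 + 3 * ‖x - z‖ / R) - K * R ^ 2 / 4 ≤ v x := by
  set A := M + κ with hA
  have hA0 : 0 ≤ A := by positivity
  set D := G ∩ Metric.ball z R with hD
  have hDo : IsOpen D := hG.inter Metric.isOpen_ball
  have hDb : Bornology.IsBounded D := hb.subset inter_subset_left
  have hDcl : closure D ⊆ closure G := closure_mono inter_subset_left
  have hDball : closure D ⊆ Metric.closedBall z R :=
    closure_minimal (inter_subset_right.trans Metric.ball_subset_closedBall) Metric.isClosed_closedBall
  have hnorm : ∀ x : E2, inner ℝ x ν ≤ ‖x‖ := fun x => by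
    simpa [hν] using real_inner_le_norm x ν
  set ψ := quadPoly z ν (κ - K * R ^ 2 / 4) (K / 4 - A / R ^ 2) (2 * A / R ^ 2) (-(3 * A / R)) with hψ
  have hψe : ∀ x, polyFun ψ x = κ - K * (R ^ 2 - ‖x - z‖ ^ 2) / 4 -
      A * ((‖x - z‖ ^ 2 - 2 * inner ℝ (x - z) ν ^ 2) / R ^ 2 + 3 * inner ℝ (x - z) ν / R) := by
    intro x
    rw [hψ, polyFun_quadPoly]
    field_simp; ring
  have hlow : ∀ x ∈ closure D, ‖x - z‖ ^ 2 / R ^ 2 ≤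
      (‖x - z‖ ^ 2 - 2 * inner ℝ (x - z) ν ^ 2) / R ^ 2 + 3 * inner ℝ (x - z) ν / R := by
    intro x hx
    have h0 := hd x (hDball hx) (hDcl hx)
    have h1 := (hnorm (x - z)).trans (mem_closedBall_iff_norm.1 (hDball hx))
    set d : ℝ := inner ℝ (x - z) ν
    have : 3 * d / R = 3 * d * R / R ^ 2 := by field_simp
    rw [this, ← add_div]
    gcongr
    nlinarith
  have hw := WeakLap.quadPoly_sub hDb (hv.mono hDcl) hq (hvq.mono inter_subset_left) z hν
    (κ - K * R ^ 2 / 4) (K / 4 - A / R ^ 2) (2 * A / R ^ 2) (-(3 * A / R))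
  have key := hw.le_of_frontier_le hDo hDb
    ((continuous_polyFun _).continuousOn.add (hv.mono hDcl).neg) (by fun_prop) (fun x hx => by
      have h1 := (abs_le.1 (hqK x hx.1)).2
      have : 4 * (K / 4 - A / R ^ 2) + 2 * (2 * A / R ^ 2) = K := by ring
      linarith) le_rfl (fun x hx => by
      change polyFun ψ x + -v x ≤ 0
      rw [hψe]
      have hxcl := frontier_subset_closure hx
      have hxR := mem_closedBall_iff_norm.1 (hDball hxcl)
      have h1 := hlow x hxcl
      have h2 : ‖x - z‖ ^ 2 ≤ R ^ 2 := pow_le_pow_left₀ (norm_nonneg _) hxR 2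
      have h3 : 0 ≤ K * (R ^ 2 - ‖x - z‖ ^ 2) / 4 := by
        have := mul_nonneg hK (sub_nonneg.2 h2); linarith
      have h4 : 0 ≤ ‖x - z‖ ^ 2 / R ^ 2 := by positivity
      have hxD : x ∉ D := by
        rw [hDo.frontier_eq] at hx
        exact hx.2
      by_cases hxG : x ∈ G
      · have hxz : ‖x - z‖ = R := by
          by_contra hne
          exact hxD ⟨hxG, mem_ball_iff_norm.2 (lt_of_le_of_ne hxR hne)⟩
        rw [hxz, div_self (by positivity)] at h1
        have h5 := hvM x (hDcl hxcl)
        have h6 := mul_le_mul_of_nonneg_left h1 hA0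
        rw [hxz] at h3 ⊢
        linarith
      · have hxf : x ∈ frontier G := by
          rw [hG.frontier_eq]; exact ⟨hDcl hxcl, hxG⟩
        have h5 := hfr x (hDball hxcl) hxf
        have h6 := mul_nonneg hA0 (h4.trans h1)
        linarith)
  intro x hx
  have h1 := key x (subset_closure hx)
  change polyFun ψ x + -v x ≤ 0 at h1
  rw [hψe] at h1
  have hx1 : (‖x - z‖ ^ 2 - 2 * inner ℝ (x - z) ν ^ 2) / R ^ 2 + 3 * inner ℝ (x - z) ν / R ≤
      ‖x - z‖ ^ 2 / R ^ 2 + 3 * ‖x - z‖ / R := by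
    have := hnorm (x - z)
    gcongr
    nlinarith [sq_nonneg (inner ℝ (x - z) ν : ℝ)]
  have h2 := mul_le_mul_of_nonneg_left hx1 hA0
  have h3 : K * (R ^ 2 - ‖x - z‖ ^ 2) / 4 ≤ K * R ^ 2 / 4 := by
    have : 0 ≤ K * ‖x - z‖ ^ 2 := by positivity
    linarith
  linarith

/-- A lower bound on a flat piece of the boundary forces the `L²` norm to be large. -/
lemma le_sqrt_of_halfDisc {G : Set E2} (hG : IsOpen G) (hb : Bornology.IsBounded G) {v q : E2 → ℝ}
    (hv : ContinuousOn v (closure G)) (hq : Continuous q) (hvq : WeakLap G v q) {K : ℝ} (hK : 0 ≤ K)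
    (hqK : ∀ x ∈ G, |q x| ≤ K) {z ν : E2} (hν : ‖ν‖ = 1) {R κ M : ℝ} (hR : 0 < R) (hκ : 0 ≤ κ)
    (hM : 0 ≤ M) (hd : ∀ x ∈ Metric.closedBall z R, x ∈ closure G → 0 ≤ inner ℝ (x - z) ν)
    (hdG : ∀ x ∈ Metric.closedBall z R, 0 < inner ℝ (x - z) ν → x ∈ G)
    (hfr : ∀ x ∈ Metric.closedBall z R, x ∈ frontier G → κ ≤ v x)
    (hvM : ∀ x ∈ closure G, -M ≤ v x) {τ : ℝ} (hτ : 0 < τ) (hτ1 : τ ≤ 1) :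
    κ ≤ 4 * τ * (M + κ) + K * R ^ 2 / 4 + 2 / (τ * R * √discArea) * √(∫ x in G, v x ^ 2) := by
  have hω := Real.sqrt_pos.2 discArea_pos
  set m := κ - 4 * τ * (M + κ) - K * R ^ 2 / 4 with hm
  have h0 : 0 ≤ 2 / (τ * R * √discArea) * √(∫ x in G, v x ^ 2) := by positivity
  rcases le_or_gt m 0 with hm0 | hm0
  · linarith
  set ρ := τ * R / 2 with hρ
  have hρ0 : 0 < ρ := by positivity
  set b := Metric.ball (z + ρ • ν) ρ with hbdef
  have hτR : τ * R ≤ R := mul_le_of_le_one_left hR.le hτ1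
  have hsub : ∀ x ∈ b, ‖x - z‖ ≤ τ * R ∧ x ∈ G ∩ Metric.ball z R := by
    intro x hx
    rw [hbdef, mem_ball_iff_norm] at hx
    have e : x - z = (x - (z + ρ • ν)) + ρ • ν := by abel
    have h1 : ‖x - z‖ < τ * R := by
      rw [e]
      refine lt_of_le_of_lt (norm_add_le _ _) ?_
      rw [norm_smul, hν, Real.norm_eq_abs, abs_of_pos hρ0]
      have : τ * R = ρ + ρ := by rw [hρ]; ring
      linarith
    have h2 : 0 < inner ℝ (x - z) ν := by
      rw [e, inner_add_left, inner_smul_left, real_inner_self_eq_norm_sq, hν]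
      have h3 := real_inner_le_norm (-(x - (z + ρ • ν))) ν
      rw [inner_neg_left, norm_neg, hν, mul_one] at h3
      simp only [conj_trivial, one_pow, mul_one]
      linarith
    have h3 : x ∈ Metric.ball z R := mem_ball_iff_norm.2 (h1.trans_le hτR)
    exact ⟨h1.le, hdG x (Metric.ball_subset_closedBall h3) h2, h3⟩
  have hbm : ∀ x ∈ b, m ≤ v x := by
    intro x hx
    obtain ⟨h1, h2⟩ := hsub x hx
    refine le_trans ?_ (le_of_halfDisc hG hb hv hq hvq hK hqK hν hR hκ hM hd hfr hvM x h2)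
    have h3 : ‖x - z‖ / R ≤ τ := by rw [div_le_iff₀ hR]; exact h1
    have h4 : ‖x - z‖ ^ 2 / R ^ 2 + 3 * ‖x - z‖ / R ≤ 4 * τ := by
      rw [← div_pow, mul_div_assoc]
      have h5 : 0 ≤ ‖x - z‖ / R := by positivity
      nlinarith
    have h6 := mul_le_mul_of_nonneg_left h4 (add_nonneg hM hκ)
    linarith
  have hvi : IntegrableOn (fun x => v x ^ 2) G := integrableOn_of_continuousOn_closure hb (hv.pow 2)
  have hbG : b ⊆ G := fun x hx => (hsub x hx).2.1
  have hint : (m * (ρ * √discArea)) ^ 2 ≤ ∫ x in G, v x ^ 2 := by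
    have i1 : IntegrableOn (fun _ : E2 => m ^ 2) b := integrableOn_const measure_ball_lt_top.ne
    calc (m * (ρ * √discArea)) ^ 2 = ∫ _ in b, m ^ 2 := by
          rw [setIntegral_const, volume_real_ball _ hρ0.le, smul_eq_mul, mul_pow, mul_pow,
            Real.sq_sqrt discArea_pos.le]
          ring
      _ ≤ ∫ x in b, v x ^ 2 := setIntegral_mono_on i1 (hvi.mono_set hbG) measurableSet_ball
          fun x hx => pow_le_pow_left₀ hm0.le (hbm x hx) 2
      _ ≤ _ := setIntegral_mono_set hvi (Filter.Eventually.of_forall fun x => sq_nonneg _)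
          hbG.eventuallyLE
  have h1 : m * (ρ * √discArea) ≤ √(∫ x in G, v x ^ 2) := Real.le_sqrt_of_sq_le hint
  have h2 : m ≤ 2 / (τ * R * √discArea) * √(∫ x in G, v x ^ 2) := by
    rw [div_mul_eq_mul_div, le_div_iff₀ (by positivity)]
    calc m * (τ * R * √discArea) = 2 * (m * (ρ * √discArea)) := by rw [hρ]; ring
      _ ≤ _ := by gcongr
  linarith

namespace PolygonalElement

lemma edgePoint_mem_frontier (E : PolygonalElement) (i : Fin (E.n + 3)) {t : ℝ}
    (ht : t ∈ Icc (0 : ℝ) 1) : E.edgePoint i t ∈ frontier E.carrier := by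
  rw [E.frontier_carrier, mem_iUnion]
  refine ⟨i, ?_⟩
  rw [segment_eq_image_lineMap]
  exact mem_image_of_mem _ ht

lemma exists_edgePoint (E : PolygonalElement) {x : E2} (hx : x ∈ frontier E.carrier) :
    ∃ i, ∃ t ∈ Icc (0 : ℝ) 1, x = E.edgePoint i t := by
  rw [E.frontier_carrier, mem_iUnion] at hx
  obtain ⟨i, hi⟩ := hx
  rw [segment_eq_image_lineMap] at hi
  obtain ⟨t, ht, rfl⟩ := hi
  exact ⟨i, t, ht, rfl⟩

end PolygonalElement

/-- The traces of `v` on the edges are polynomials of degree at most `p`. -/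
def PolyTrace (E : PolygonalElement) (p : ℕ) (v : E2 → ℝ) : Prop :=
  ∀ i, ∃ g : Polynomial ℝ, g.natDegree ≤ p ∧ ∀ t ∈ Icc (0 : ℝ) 1, v (E.edgePoint i t) = g.eval t

/-- The inverse estimate between the maximum norm and the `L²` norm, uniformly over shape-regular
elements. -/
theorem exists_inverse_estimate (p : ℕ) {δ c : ℝ} (hδ : 0 < δ) (hc : 0 < c) :
    ∃ C, 0 < C ∧ ∀ (E : PolygonalElement) (y : E2) (h : ℝ), StarDisc E.carrier y h (δ * h) →
      (∀ i, c * h ≤ E.edgeLength i) → ∀ v, ContinuousOn v (closure E.carrier) → PolyTrace E p v →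
      ∀ q : MvPolynomial (Fin 2) ℝ, q.totalDegree ≤ p → WeakLap E.carrier v (polyFun q) →
      ∀ x ∈ closure E.carrier, |v x| ≤ C / h * √(∫ x in E.carrier, v x ^ 2) := by
  obtain ⟨C₁, hC₁, hmid⟩ := exists_middle_point p
  obtain ⟨C₂, hC₂, hlap⟩ := exists_weakLap_bound p hδ
  have hω := Real.sqrt_pos.2 discArea_pos
  have hC₁0 : 0 < C₁ := by linarith
  -- the radius of the half-disc and the size of the small disc, relative to `h` and to the radius
  set r₀ := min (min 1 (δ / 2)) (min (c / 3 / (1 + 4 / δ)) (c / (2 * C₁))) with hr₀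
  have hr₀pos : 0 < r₀ := by positivity
  set τ := 1 / (16 * (C₁ + 1 / 2)) with hτ
  have hτpos : 0 < τ := by positivity
  have hτ1 : τ ≤ 1 := by rw [hτ, div_le_one (by positivity)]; linarith
  set C₃ := 4 * (C₂ + 2 / (τ * r₀ * √discArea)) with hC₃
  have hC₃0 : 0 < C₃ := by positivity
  refine ⟨C₁ * C₃ + C₂, by positivity, ?_⟩
  intro E y h S hedge v hv htr q hq hvq
  have hh := S.h_pos
  set G := E.carrier with hG
  set N := √(∫ x in G, v x ^ 2) with hN
  have hN0 : 0 ≤ N := Real.sqrt_nonneg _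
  set K := C₂ / h ^ 3 * N with hK
  have hK0 : 0 ≤ K := by positivity
  have hKq : ∀ x ∈ G, |polyFun q x| ≤ K := fun x hx =>
    hlap y h hh q hq G S.isOpen S.isBounded S.ball_subset v hv hvq x (S.subset hx)
  have hfrc : IsCompact (frontier G) := S.isBounded.isCompact_closure.of_isClosed_subset
    isClosed_frontier frontier_subset_closure
  have hfrne : (frontier G).Nonempty := ⟨_, E.edgePoint_mem_frontier 0 (t := 0) (by simp)⟩
  obtain ⟨x₀, hx₀, hmax⟩ := hfrc.exists_isMaxOn hfrne (hv.mono frontier_subset_closure).abs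
  obtain ⟨i, s, hs, hxi⟩ := E.exists_edgePoint hx₀
  obtain ⟨g, hg, hgv⟩ := htr i
  obtain ⟨t₀, ht₀, hC, hnear⟩ := hmid g hg
  set κ := |g.eval t₀| with hκ
  have hκ0 : 0 ≤ κ := abs_nonneg _
  have hM : ∀ x ∈ frontier G, |v x| ≤ C₁ * κ := by
    intro x hx
    refine (hmax hx).trans ?_
    change |v x₀| ≤ _
    rw [hxi, hgv s hs]
    exact hC s hs
  have hall := hvq.abs_le_of_frontier S.isOpen S.subset hv (continuous_polyFun q) hK0 hKq
    (by positivity) hM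
  set R := r₀ * h with hR
  have hRpos : 0 < R := by positivity
  have hr1 : r₀ ≤ 1 := (min_le_left _ _).trans (min_le_left _ _)
  have hr2 : r₀ ≤ δ / 2 := (min_le_left _ _).trans (min_le_right _ _)
  have hr3 : r₀ ≤ c / 3 / (1 + 4 / δ) := (min_le_right _ _).trans (min_le_left _ _)
  have hr4 : r₀ ≤ c / (2 * C₁) := (min_le_right _ _).trans (min_le_right _ _)
  have hlen : 0 < E.edgeLength i := lt_of_lt_of_le (by positivity) (hedge i)
  have hPQ : E.vertex i ≠ E.vertex (i + 1) := dist_pos.1 hlen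
  have hsegfr : segment ℝ (E.vertex i) (E.vertex (i + 1)) ⊆ frontier G := by
    rw [hG, E.frontier_carrier]
    exact subset_iUnion (fun i => segment ℝ (E.vertex i) (E.vertex (i + 1))) i
  obtain ⟨ν, hν, hd1, hd2, hd3⟩ := S.exists_halfDisc hδ hsegfr (hedge i) hPQ ht₀ hRpos
    (by rw [hR]; nlinarith) (by rw [hR]; nlinarith) (by
      rw [le_div_iff₀ (by positivity)] at hr3
      rw [hR]; nlinarith)
  have hfrv : ∀ x ∈ Metric.closedBall (E.edgePoint i t₀) R, x ∈ frontier G →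
      |v x - g.eval t₀| ≤ κ / 2 := by
    intro x hx hxf
    have h0 : inner ℝ (x - E.edgePoint i t₀) ν = 0 := by
      refine le_antisymm ?_ (hd2 x hx (frontier_subset_closure hxf))
      by_contra! hpos
      rw [S.isOpen.frontier_eq] at hxf
      exact hxf.2 (hd1 x hx hpos)
    obtain ⟨t, ht, rfl, htL⟩ := hd3 x hx h0
    have e : v (AffineMap.lineMap (E.vertex i) (E.vertex (i + 1)) t) = g.eval t := hgv t ht
    rw [e]
    refine hnear t ht ?_
    have h1 : |t - t₀| * (c * h) ≤ r₀ * h :=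
      (mul_le_mul_of_nonneg_left (hedge i) (abs_nonneg _)).trans htL
    have h2 : |t - t₀| * c ≤ r₀ := by
      have : |t - t₀| * c * h ≤ r₀ * h := by linarith
      exact le_of_mul_le_mul_right this hh
    have h3 : |t - t₀| * c ≤ 1 / (2 * C₁) * c := by
      refine h2.trans (hr4.trans (le_of_eq ?_)); ring
    exact le_of_mul_le_mul_right h3 hc
  have hκN : κ / 2 ≤ 4 * τ * (C₁ * κ + K * h ^ 2 / 4 + κ / 2) + K * R ^ 2 / 4 +
      2 / (τ * R * √discArea) * N := by
    rcases le_total 0 (g.eval t₀) with hpos | hneg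
    · refine le_sqrt_of_halfDisc S.isOpen S.isBounded hv (continuous_polyFun q) hvq hK0 hKq hν hRpos
        (by positivity) (by positivity) hd2 hd1 (fun x hx hxf => ?_) (fun x hx => ?_) hτpos hτ1
      · have := (abs_le.1 (hfrv x hx hxf)).1
        rw [hκ, abs_of_nonneg hpos] at this ⊢
        linarith
      · exact (abs_le.1 (hall x hx)).1
    · have := le_sqrt_of_halfDisc S.isOpen S.isBounded hv.neg (continuous_polyFun q).neg hvq.neg hK0
        (fun x hx => by rw [Pi.neg_apply, abs_neg]; exact hKq x hx) hν hRpos (κ := κ / 2)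
        (M := C₁ * κ + K * h ^ 2 / 4)
        (by positivity) (by positivity) hd2 hd1 (fun x hx hxf => by
          have := (abs_le.1 (hfrv x hx hxf)).2
          rw [hκ, abs_of_nonpos hneg] at this ⊢
          simp only [Pi.neg_apply]
          linarith) (fun x hx => by
          have := (abs_le.1 (hall x hx)).2
          simp only [Pi.neg_apply]
          linarith) hτpos hτ1
      simpa only [Pi.neg_apply, neg_sq] using this
  have hκC : κ ≤ C₃ / h * N := by
    have e1 : 4 * τ * (C₁ * κ + K * h ^ 2 / 4 + κ / 2) = κ / 4 + τ * (K * h ^ 2) := by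
      rw [hτ]; field_simp; ring
    have e2 : τ * (K * h ^ 2) ≤ 1 / 2 * (K * h ^ 2) := by
      have : τ ≤ 1 / 2 := by
        rw [hτ, div_le_div_iff₀ (by positivity) (by norm_num)]; linarith
      gcongr
    have e3 : K * R ^ 2 ≤ K * h ^ 2 := by
      have : R ≤ h := by rw [hR]; nlinarith
      gcongr
    have e4 : K * h ^ 2 = C₂ / h * N := by rw [hK]; field_simp
    have e5 : 2 / (τ * R * √discArea) * N = 2 / (τ * r₀ * √discArea) / h * N := by
      rw [hR]; field_simp
    have e6 : C₃ / h * N = 4 * (C₂ / h * N) + 4 * (2 / (τ * r₀ * √discArea) / h * N) := by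
      rw [hC₃]; ring
    have e7 : 0 ≤ C₂ / h * N := by positivity
    rw [e6]
    rw [e1, e5] at hκN
    linarith
  intro x hx
  refine (hall x hx).trans ?_
  have e4 : K * h ^ 2 = C₂ / h * N := by rw [hK]; field_simp
  have e7 : 0 ≤ C₂ / h * N := by positivity
  calc C₁ * κ + K * h ^ 2 / 4 ≤ C₁ * (C₃ / h * N) + C₂ / h * N := by
        rw [e4]
        have := mul_le_mul_of_nonneg_left hκC hC₁0.le
        linarith
    _ = _ := by ring

/-! ### Boundary integrals and the gradient projection -/

/-- The restriction of a polynomial to a line is a polynomial of at most the same degree. -/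
lemma exists_polyFun_lineMap {p : ℕ} {q : MvPolynomial (Fin 2) ℝ} (hq : q.totalDegree ≤ p)
    (P Q : E2) : ∃ g : Polynomial ℝ, g.natDegree ≤ p ∧
      ∀ t : ℝ, polyFun q (AffineMap.lineMap P Q t) = g.eval t := by
  classical
  let L : Fin 2 → Polynomial ℝ := fun j => Polynomial.C (P j) + Polynomial.C (Q j - P j) * Polynomial.X
  have hL : ∀ j, (L j).natDegree ≤ 1 := fun j =>
    (Polynomial.natDegree_add_le _ _).trans (max_le (by simp) ((Polynomial.natDegree_C_mul_le _ _).trans (by simp)))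
  refine ⟨∑ d ∈ q.support, Polynomial.C (q.coeff d) * ∏ j, L j ^ d j, ?_, ?_⟩
  · refine Polynomial.natDegree_sum_le_of_forall_le _ _ fun d hd => ?_
    refine (Polynomial.natDegree_C_mul_le _ _).trans ((Polynomial.natDegree_prod_le _ _).trans ?_)
    calc ∑ j, (L j ^ d j).natDegree ≤ ∑ j, d j := Finset.sum_le_sum fun j _ =>
          Polynomial.natDegree_pow_le.trans (by nlinarith [hL j])
      _ = d.sum fun _ e => e := by
          rw [Finsupp.sum_fintype _ _ fun _ => rfl]
      _ ≤ p := (MvPolynomial.le_totalDegree hd).trans hq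
  · intro t
    have e : ∀ j, (AffineMap.lineMap P Q t : E2) j = (L j).eval t := fun j => by
      rw [AffineMap.lineMap_apply_module']
      simp [L]; ring
    unfold polyFun
    rw [MvPolynomial.eval_eq', Polynomial.eval_finsetSum]
    refine Finset.sum_congr rfl fun d _ => ?_
    rw [Polynomial.eval_mul, Polynomial.eval_C, Polynomial.eval_prod]
    simp only [Polynomial.eval_pow, e]

lemma continuous_edgePoint (E : PolygonalElement) (i : Fin (E.n + 3)) : Continuous (E.edgePoint i) := by
  unfold PolygonalElement.edgePoint
  exact AffineMap.lineMap_continuous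

lemma intervalIntegrable_edge (E : PolygonalElement) {f : E2 → ℝ}
    (hf : ContinuousOn f (frontier E.carrier)) (i : Fin (E.n + 3)) :
    IntervalIntegrable (fun t => f (E.edgePoint i t)) volume 0 1 := by
  refine ContinuousOn.intervalIntegrable ?_
  rw [uIcc_of_le zero_le_one]
  exact hf.comp (continuous_edgePoint E i).continuousOn fun t ht => E.edgePoint_mem_frontier i ht

lemma boundaryIntegral_add (E : PolygonalElement) {f g : E2 → ℝ}
    (hf : ContinuousOn f (frontier E.carrier)) (hg : ContinuousOn g (frontier E.carrier)) :
    E.boundaryIntegral (fun x => f x + g x) = E.boundaryIntegral f + E.boundaryIntegral g := by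
  unfold PolygonalElement.boundaryIntegral
  rw [← Finset.sum_add_distrib]
  refine Finset.sum_congr rfl fun i _ => ?_
  rw [intervalIntegral.integral_add (intervalIntegrable_edge E hf i) (intervalIntegrable_edge E hg i),
    mul_add]

lemma boundaryIntegral_const_mul (E : PolygonalElement) (s : ℝ) (f : E2 → ℝ) :
    E.boundaryIntegral (fun x => s * f x) = s * E.boundaryIntegral f := by
  unfold PolygonalElement.boundaryIntegral
  rw [Finset.mul_sum]
  refine Finset.sum_congr rfl fun i _ => ?_
  rw [intervalIntegral.integral_const_mul]
  ring

lemma perimeter_pos (E : PolygonalElement) : 0 < ∑ i, E.edgeLength i := by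
  refine Finset.sum_pos (fun i _ => dist_pos.2 fun h => ?_) Finset.univ_nonempty
  have h1 := E.vertex_injective h
  have h2 := congrArg Fin.val (add_eq_left.1 h1.symm)
  simp at h2

/-- A lower bound on the boundary carries over to the boundary integral. -/
lemma le_boundaryIntegral (E : PolygonalElement) {f : E2 → ℝ}
    (hf : ContinuousOn f (frontier E.carrier)) {m : ℝ} (hm : ∀ x ∈ frontier E.carrier, m ≤ f x) :
    m * ∑ i, E.edgeLength i ≤ E.boundaryIntegral f := by
  unfold PolygonalElement.boundaryIntegral
  rw [Finset.mul_sum]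
  refine Finset.sum_le_sum fun i _ => ?_
  rw [mul_comm]
  refine mul_le_mul_of_nonneg_left ?_ dist_nonneg
  have := intervalIntegral.integral_mono_on zero_le_one (intervalIntegrable_const (c := m))
    (intervalIntegrable_edge E hf i) fun t ht => hm _ (E.edgePoint_mem_frontier i ht)
  simpa using this

lemma integrableOn_mul_continuous {G : Set E2} (hG : IsOpen G) (hb : Bornology.IsBounded G)
    {g f : E2 → ℝ} (hg : IntegrableOn g G) (hf : Continuous f) : IntegrableOn (fun x => g x * f x) G :=
  hg.mul_continuousOn_of_subset hf.continuousOn hG.measurableSet hb.isCompact_closure subset_closure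

/-- A polynomial whose gradient vanishes on a disc is constant. -/
lemma eq_C_of_pderiv_eq_zero {q : MvPolynomial (Fin 2) ℝ}
    (hq : ∀ j, MvPolynomial.pderiv j q = 0) : q = MvPolynomial.C (polyFun q 0) := by
  have hf : ∀ x, fderiv ℝ (polyFun q) x = 0 := by
    intro x
    refine ContinuousLinearMap.coe_injective ?_
    refine (EuclideanSpace.basisFun (Fin 2) ℝ).toBasis.ext fun j => ?_
    have h1 := congrFun (pd_polyFun j q) x
    rw [hq j, polyFun_zero] at h1
    simpa [pd] using h1
  have hc := is_const_of_fderiv_eq_zero (differentiable_polyFun q) hf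
  have h0 : q - MvPolynomial.C (polyFun q 0) = 0 := by
    refine eq_zero_of_polyFun_ball (y := 0) zero_lt_one fun x _ => ?_
    rw [polyFun_sub, polyFun_C, hc x 0, sub_self]
  exact sub_eq_zero.1 h0

/-- The boundary integral of polynomials of degree at most `p`, as a linear functional. -/
noncomputable def boundaryFunctional (E : PolygonalElement) (p : ℕ) :
    MvPolynomial.restrictTotalDegree (Fin 2) ℝ p →ₗ[ℝ] ℝ where
  toFun q := E.boundaryIntegral (polyFun q.1)
  map_add' q r := by
    rw [← boundaryIntegral_add E (continuous_polyFun _).continuousOn (continuous_polyFun _).continuousOn]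
    congr 1; ext x; rw [Submodule.coe_add, polyFun_add]
  map_smul' s q := by
    rw [RingHom.id_apply, smul_eq_mul, ← boundaryIntegral_const_mul]
    congr 1; ext x; rw [Submodule.coe_smul, polyFun_smul]

/-- The functional `r ↦ ∫ g · ∇ r` on polynomials of degree at most `p`. -/
noncomputable def gradFunctional {G : Set E2} (hG : IsOpen G) (hb : Bornology.IsBounded G) (p : ℕ)
    {g : Fin 2 → E2 → ℝ} (hg : ∀ j, IntegrableOn (g j) G) :
    MvPolynomial.restrictTotalDegree (Fin 2) ℝ p →ₗ[ℝ] ℝ where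
  toFun r := ∫ x in G, ∑ j, g j x * polyFun (MvPolynomial.pderiv j r.1) x
  map_add' q r := by
    rw [← integral_add
      (integrable_finsetSum _ fun j _ => integrableOn_mul_continuous hG hb (hg j) (continuous_polyFun _))
      (integrable_finsetSum _ fun j _ => integrableOn_mul_continuous hG hb (hg j) (continuous_polyFun _))]
    congr 1; ext x
    rw [← Finset.sum_add_distrib]
    refine Finset.sum_congr rfl fun j _ => ?_
    rw [Submodule.coe_add, map_add, polyFun_add]; ring
  map_smul' s q := by
    rw [RingHom.id_apply, smul_eq_mul, ← integral_const_mul]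
    congr 1; ext x
    rw [Finset.mul_sum]
    refine Finset.sum_congr rfl fun j _ => ?_
    rw [Submodule.coe_smul, Derivation.map_smul, polyFun_smul]; ring

lemma integrableOn_polyFun {G : Set E2} (hb : Bornology.IsBounded G) (q : MvPolynomial (Fin 2) ℝ) :
    IntegrableOn (polyFun q) G :=
  integrableOn_of_continuousOn_closure hb (continuous_polyFun q).continuousOn

lemma gradFunctional_comm (E : PolygonalElement) {p : ℕ}
    (q r : MvPolynomial.restrictTotalDegree (Fin 2) ℝ p) :
    gradFunctional E.isOpen_carrier E.isBounded_carrier p (fun j =>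
      integrableOn_polyFun E.isBounded_carrier (MvPolynomial.pderiv j q.1)) r =
    gradFunctional E.isOpen_carrier E.isBounded_carrier p (fun j =>
      integrableOn_polyFun E.isBounded_carrier (MvPolynomial.pderiv j r.1)) q := by
  change (∫ x in E.carrier, ∑ j, _ * _) = ∫ x in E.carrier, ∑ j, _ * _
  congr 1; ext x
  exact Finset.sum_congr rfl fun j _ => mul_comm _ _

/-- The inner product `∫ ∇ q · ∇ r` completed by the product of the boundary integrals. -/
noncomputable def gradForm (E : PolygonalElement) (p : ℕ) :
    LinearMap.BilinForm ℝ (MvPolynomial.restrictTotalDegree (Fin 2) ℝ p) where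
  toFun q := gradFunctional E.isOpen_carrier E.isBounded_carrier p
      (fun j => integrableOn_polyFun E.isBounded_carrier (MvPolynomial.pderiv j q.1)) +
    boundaryFunctional E p q • boundaryFunctional E p
  map_add' q q' := by
    ext r
    simp only [LinearMap.add_apply, LinearMap.smul_apply, smul_eq_mul, map_add]
    rw [gradFunctional_comm E (q + q') r, gradFunctional_comm E q r, gradFunctional_comm E q' r,
      map_add]
    ring
  map_smul' s q := by
    ext r
    simp only [LinearMap.add_apply, LinearMap.smul_apply, smul_eq_mul, map_smul, RingHom.id_apply]
    rw [gradFunctional_comm E (s • q) r, gradFunctional_comm E q r, map_smul, smul_eq_mul]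
    ring

lemma gradForm_apply (E : PolygonalElement) (p : ℕ)
    (q r : MvPolynomial.restrictTotalDegree (Fin 2) ℝ p) : gradForm E p q r =
      (∫ x in E.carrier, ∑ j, polyFun (MvPolynomial.pderiv j q.1) x *
        polyFun (MvPolynomial.pderiv j r.1) x) +
      E.boundaryIntegral (polyFun q.1) * E.boundaryIntegral (polyFun r.1) := rfl

lemma boundaryIntegral_polyFun_C (E : PolygonalElement) (s : ℝ) :
    E.boundaryIntegral (polyFun (MvPolynomial.C s)) = s * ∑ i, E.edgeLength i := by
  unfold PolygonalElement.boundaryIntegral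
  rw [Finset.mul_sum]
  simp [polyFun_C, mul_comm]

lemma gradForm_definite (E : PolygonalElement) {p : ℕ}
    (q : MvPolynomial.restrictTotalDegree (Fin 2) ℝ p) (h : gradForm E p q q = 0) : q = 0 := by
  rw [gradForm_apply] at h
  have hc : ∀ j, Continuous (polyFun (MvPolynomial.pderiv j q.1)) := fun j => continuous_polyFun _
  have hcont : Continuous fun x => ∑ j, polyFun (MvPolynomial.pderiv j q.1) x *
      polyFun (MvPolynomial.pderiv j q.1) x := by fun_prop
  have hnn : ∀ x, 0 ≤ ∑ j, polyFun (MvPolynomial.pderiv j q.1) x *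
      polyFun (MvPolynomial.pderiv j q.1) x := fun x =>
    Finset.sum_nonneg fun j _ => mul_self_nonneg _
  have h1 : 0 ≤ ∫ x in E.carrier, ∑ j, polyFun (MvPolynomial.pderiv j q.1) x *
      polyFun (MvPolynomial.pderiv j q.1) x := integral_nonneg hnn
  have h2 := mul_self_nonneg (E.boundaryIntegral (polyFun q.1))
  have hint : ∫ x in E.carrier, ∑ j, polyFun (MvPolynomial.pderiv j q.1) x *
      polyFun (MvPolynomial.pderiv j q.1) x = 0 := by linarith
  have hbd : E.boundaryIntegral (polyFun q.1) = 0 := mul_self_eq_zero.1 (by linarith)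
  rw [integral_eq_zero_iff_of_nonneg hnn
    (integrableOn_of_continuousOn_closure E.isBounded_carrier hcont.continuousOn)] at hint
  have hz : EqOn (fun x => ∑ j, polyFun (MvPolynomial.pderiv j q.1) x *
      polyFun (MvPolynomial.pderiv j q.1) x) (fun _ => 0) E.carrier :=
    Measure.eqOn_open_of_ae_eq hint E.isOpen_carrier hcont.continuousOn continuousOn_const
  obtain ⟨y, hy⟩ := E.nonempty_carrier
  obtain ⟨ε, hε, hball⟩ := Metric.isOpen_iff.1 E.isOpen_carrier y hy
  have hp : ∀ j, MvPolynomial.pderiv j q.1 = 0 := by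
    intro j
    refine eq_zero_of_polyFun_ball (y := y) hε fun x hx => ?_
    have := hz (hball hx)
    simp only at this
    rw [Finset.sum_eq_zero_iff_of_nonneg fun j _ => mul_self_nonneg _] at this
    exact mul_self_eq_zero.1 (this j (Finset.mem_univ j))
  have hC := eq_C_of_pderiv_eq_zero hp
  rw [hC, boundaryIntegral_polyFun_C] at hbd
  have h0 : polyFun q.1 0 = 0 := (mul_eq_zero.1 hbd).resolve_right (perimeter_pos E).ne'
  apply Subtype.ext
  rw [hC, h0, map_zero]; rfl

lemma weakPartial_spec {E : PolygonalElement} {v : E2 → ℝ} (hv : MemH E.carrier 1 v) (j : Fin 2) :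
    IntegrableOn (weakPartial E.carrier j v) E.carrier ∧ ∀ φ, IsTest E.carrier φ →
      ∫ x in E.carrier, v x * pd j φ x = -∫ x in E.carrier, weakPartial E.carrier j v x * φ x := by
  have hfin : IsFiniteMeasure (volume.restrict E.carrier) :=
    ⟨by rw [Measure.restrict_apply_univ]; exact E.isBounded_carrier.measure_lt_top⟩
  have key : ∀ a b, a + b ≤ 1 → IsWeakDeriv E.carrier a b v (weakD E.carrier a b v) := by
    intro a b hab
    have h := hv.2 a b hab
    unfold weakD
    rw [dif_pos h]
    exact h.choose_spec
  have h01 : j = 0 ∨ j = 1 := by fin_cases j <;> simp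
  rcases h01 with rfl | rfl
  · have h := key 1 0 (by norm_num)
    simp only [weakPartial, if_true]
    refine ⟨h.1.integrable (by norm_num), fun φ hφ => ?_⟩
    have := h.2 φ hφ
    simpa [pdMulti] using this
  · have h := key 0 1 (by norm_num)
    simp only [weakPartial, one_ne_zero, if_false]
    refine ⟨h.1.integrable (by norm_num), fun φ hφ => ?_⟩
    have := h.2 φ hφ
    simpa [pdMulti] using this

/-- The gradient projection is the polynomial determined by its defining conditions. -/
lemma exists_gradProj_eq {E : PolygonalElement} {p : ℕ} {v : E2 → ℝ} (hv : MemH E.carrier 1 v)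
    (hvc : ContinuousOn v (closure E.carrier)) : ∃ q : MvPolynomial (Fin 2) ℝ,
      gradProj E p v = polyFun q ∧ q.totalDegree ≤ p ∧
      (∀ r : MvPolynomial (Fin 2) ℝ, r.totalDegree ≤ p →
        ∫ x in E.carrier, ∑ j : Fin 2,
          (weakPartial E.carrier j v x - polyFun (MvPolynomial.pderiv j q) x) *
            polyFun (MvPolynomial.pderiv j r) x = 0) ∧
      E.boundaryIntegral (fun x => polyFun q x - v x) = 0 := by
  suffices hex : ∃ q : MvPolynomial (Fin 2) ℝ, q.totalDegree ≤ p ∧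
      (∀ r : MvPolynomial (Fin 2) ℝ, r.totalDegree ≤ p →
        ∫ x in E.carrier, ∑ j : Fin 2,
          (weakPartial E.carrier j v x - polyFun (MvPolynomial.pderiv j q) x) *
            polyFun (MvPolynomial.pderiv j r) x = 0) ∧
      E.boundaryIntegral (fun x => polyFun q x - v x) = 0 by
    refine ⟨hex.choose, ?_, hex.choose_spec⟩
    unfold gradProj thePoly
    rw [dif_pos hex]
  have hG := E.isOpen_carrier
  have hb := E.isBounded_carrier
  have hw := fun j => (weakPartial_spec hv j).1
  obtain ⟨q, hq⟩ := exists_representation (gradForm E p) (gradForm_definite E)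
    (gradFunctional hG hb p hw + E.boundaryIntegral v • boundaryFunctional E p)
  have hq' : ∀ r : MvPolynomial.restrictTotalDegree (Fin 2) ℝ p,
      (∫ x in E.carrier, ∑ j, polyFun (MvPolynomial.pderiv j q.1) x *
        polyFun (MvPolynomial.pderiv j r.1) x) +
      E.boundaryIntegral (polyFun q.1) * E.boundaryIntegral (polyFun r.1) =
      (∫ x in E.carrier, ∑ j, weakPartial E.carrier j v x * polyFun (MvPolynomial.pderiv j r.1) x) +
      E.boundaryIntegral v * E.boundaryIntegral (polyFun r.1) := hq
  have hvf : ContinuousOn v (frontier E.carrier) := hvc.mono frontier_subset_closure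
  -- testing with a constant gives the boundary integral
  have hbd : E.boundaryIntegral (polyFun q.1) = E.boundaryIntegral v := by
    have h1 := hq' ⟨MvPolynomial.C 1, by rw [MvPolynomial.mem_restrictTotalDegree]; simp⟩
    simp only [MvPolynomial.pderiv_C, polyFun_zero, mul_zero, Finset.sum_const_zero,
      integral_zero, zero_add, boundaryIntegral_polyFun_C, one_mul] at h1
    exact mul_right_cancel₀ (perimeter_pos E).ne' h1
  refine ⟨q.1, MvPolynomial.mem_restrictTotalDegree _ _ _ |>.1 q.2, fun r hr => ?_, ?_⟩
  · have h1 := hq' ⟨r, (MvPolynomial.mem_restrictTotalDegree _ _ _).2 hr⟩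
    rw [hbd] at h1
    have h2 := add_right_cancel h1
    have e : ∀ x, ∑ j : Fin 2, (weakPartial E.carrier j v x -
        polyFun (MvPolynomial.pderiv j q.1) x) * polyFun (MvPolynomial.pderiv j r) x =
        (∑ j : Fin 2, weakPartial E.carrier j v x * polyFun (MvPolynomial.pderiv j r) x) -
        ∑ j : Fin 2, polyFun (MvPolynomial.pderiv j q.1) x * polyFun (MvPolynomial.pderiv j r) x :=
      fun x => by rw [← Finset.sum_sub_distrib]; exact Finset.sum_congr rfl fun j _ => by ring
    simp only [e]
    rw [integral_sub
      (integrable_finsetSum _ fun j _ => integrableOn_mul_continuous hG hb (hw j) (continuous_polyFun _))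
      (integrable_finsetSum _ fun j _ => integrableOn_mul_continuous hG hb
        (integrableOn_polyFun hb _) (continuous_polyFun _)), sub_eq_zero]
    exact h2.symm
  · have h1 := boundaryIntegral_add E (continuous_polyFun q.1).continuousOn
      (g := fun x => -1 * v x) (hvf.const_mul _ )
    rw [boundaryIntegral_const_mul, hbd] at h1
    calc E.boundaryIntegral (fun x => polyFun q.1 x - v x)
        = E.boundaryIntegral (fun x => polyFun q.1 x + -1 * v x) := by
          congr 1; ext x; ring
      _ = 0 := by rw [h1]; ring

/-! ### Stability of the interpolation -/

lemma norm_fderiv_le_of_abs_pd_le {f : E2 → ℝ} {x : E2} {B : ℝ} (h : ∀ j, |pd j f x| ≤ B) :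
    ‖fderiv ℝ f x‖ ≤ 2 * B := by
  have hB : 0 ≤ B := (abs_nonneg _).trans (h 0)
  refine ContinuousLinearMap.opNorm_le_bound _ (by positivity) fun v => ?_
  have hv : v = v 0 • (EuclideanSpace.single 0 1 : E2) + v 1 • (EuclideanSpace.single 1 1 : E2) := by
    ext i
    fin_cases i <;> simp
  have e : fderiv ℝ f x v = v 0 * pd 0 f x + v 1 * pd 1 f x := by
    conv_lhs => rw [hv]
    rw [map_add, map_smul, map_smul]; rfl
  rw [e, Real.norm_eq_abs]
  have hn : ∀ j, |v j| ≤ ‖v‖ := fun j => PiLp.norm_apply_le v j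
  calc |v 0 * pd 0 f x + v 1 * pd 1 f x| ≤ |v 0| * |pd 0 f x| + |v 1| * |pd 1 f x| := by
        rw [← abs_mul, ← abs_mul]; exact abs_add_le _ _
    _ ≤ ‖v‖ * B + ‖v‖ * B := by
        gcongr
        · exact hn 0
        · exact h 0
        · exact hn 1
        · exact h 1
    _ = 2 * B * ‖v‖ := by ring

lemma StarDisc.setIntegral_abs_le {G : Set E2} {y : E2} {h r : ℝ} (S : StarDisc G y h r) {f : E2 → ℝ}
    (hf : ContinuousOn f (closure G)) :
    ∫ x in G, |f x| ≤ h * √discArea * √(∫ x in G, f x ^ 2) := by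
  refine (setIntegral_abs_le_sqrt S.volume_lt_top (integrableOn_of_continuousOn_closure S.isBounded hf)
    (integrableOn_of_continuousOn_closure S.isBounded (hf.pow 2))).trans ?_
  refine mul_le_mul_of_nonneg_right ?_ (Real.sqrt_nonneg _)
  refine (Real.sqrt_le_sqrt S.volume_real_le).trans (le_of_eq ?_)
  rw [Real.sqrt_mul (sq_nonneg _), Real.sqrt_sq S.h_pos.le]

lemma StarDisc.setIntegral_abs_le_of_bound {G : Set E2} {y : E2} {h r : ℝ} (S : StarDisc G y h r)
    {f : E2 → ℝ} (hf : ContinuousOn f (closure G)) {B : ℝ} (hB : ∀ x ∈ G, |f x| ≤ B) :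
    ∫ x in G, |f x| ≤ h ^ 2 * discArea * B := by
  have hB0 : 0 ≤ B := by
    obtain ⟨x, hx⟩ := S.nonempty
    exact (abs_nonneg _).trans (hB x hx)
  have i1 : IntegrableOn (fun _ : E2 => B) G := integrableOn_const S.volume_lt_top.ne
  calc ∫ x in G, |f x| ≤ ∫ _ in G, B := setIntegral_mono_on
        (integrableOn_of_continuousOn_closure S.isBounded hf.abs) i1 S.isOpen.measurableSet hB
    _ = volume.real G * B := by rw [setIntegral_const, smul_eq_mul]
    _ ≤ _ := mul_le_mul_of_nonneg_right S.volume_real_le hB0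

/-- If `v` is bounded by `M` on the boundary and in its low-order moments, so is its gradient
projection: Green's formula expresses the energy of the projection by these quantities, and the
boundary mean fixes the additive constant. -/
lemma exists_gradProj_bound (p : ℕ) {δ : ℝ} (hδ : 0 < δ) : ∃ C, 0 < C ∧
    ∀ (E : PolygonalElement) (y : E2) (h : ℝ), StarDisc E.carrier y h (δ * h) →
    ∀ (v : E2 → ℝ) (g : Fin 2 → E2 → ℝ), ContinuousOn v (closure E.carrier) →
    (∀ j, IntegrableOn (g j) E.carrier) →
    (∀ j φ, IsTest E.carrier φ → ∫ x in E.carrier, v x * pd j φ x = -∫ x in E.carrier, g j x * φ x) →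
    ∀ M, 0 < M → (∀ x ∈ frontier E.carrier, |v x| ≤ M) →
    (∀ r : MvPolynomial (Fin 2) ℝ, r.totalDegree + 2 ≤ p →
      |∫ x in E.carrier, v x * polyFun r x| ≤ M * ∫ x in E.carrier, |polyFun r x|) →
    ∀ q : MvPolynomial (Fin 2) ℝ, q.totalDegree ≤ p →
    (∫ x in E.carrier, ∑ j : Fin 2, (g j x - polyFun (MvPolynomial.pderiv j q) x) *
      polyFun (MvPolynomial.pderiv j q) x = 0) →
    E.boundaryIntegral (fun x => polyFun q x - v x) = 0 →
    ∀ x ∈ Metric.closedBall y h, |polyFun q x| ≤ C * M := by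
  obtain ⟨Ci, hCi, hinv⟩ := exists_poly_inverse p hδ
  obtain ⟨Cg, hCg, hgreen⟩ := StarDisc.exists_green_bound
  have hω := discArea_pos
  set C₄ := 2 * Cg * Ci / δ + 2 * discArea * Ci with hC₄
  have hC₄0 : 0 < C₄ := by positivity
  refine ⟨1 + 4 * Ci * C₄, by positivity, ?_⟩
  intro E y h S v g hv hg hvg M hM hfr hmom q hq hproj hbd
  have hh := S.h_pos
  have hb := S.isBounded
  set G := E.carrier with hG
  set D := ∫ x in G, ∑ j, polyFun (MvPolynomial.pderiv j q) x ^ 2 with hD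
  have hpc : ∀ j, Continuous (polyFun (MvPolynomial.pderiv j q)) := fun j => continuous_polyFun _
  have hD0 : 0 ≤ D := integral_nonneg fun x => Finset.sum_nonneg fun j _ => sq_nonneg _
  set N := √D with hN
  have hN0 : 0 ≤ N := Real.sqrt_nonneg _
  have hNN : N ^ 2 = D := Real.sq_sqrt hD0
  have hdeg : ∀ j, (MvPolynomial.pderiv j q).totalDegree ≤ p := fun j =>
    (totalDegree_pderiv_le hq j).trans (Nat.sub_le _ _)
  have hsq : ∀ j, √(∫ x in Metric.ball y (δ * h), polyFun (MvPolynomial.pderiv j q) x ^ 2) ≤ N := by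
    intro j
    refine Real.sqrt_le_sqrt ?_
    have i1 : IntegrableOn (fun x => polyFun (MvPolynomial.pderiv j q) x ^ 2) G :=
      integrableOn_of_continuousOn_closure hb ((hpc j).pow 2).continuousOn
    have i2 : IntegrableOn (fun x => ∑ j, polyFun (MvPolynomial.pderiv j q) x ^ 2) G :=
      integrableOn_of_continuousOn_closure hb (by fun_prop : Continuous _).continuousOn
    refine (setIntegral_mono_set i1 (Filter.Eventually.of_forall fun x => sq_nonneg _)
      S.ball_subset.eventuallyLE).trans (setIntegral_mono i1 i2 fun x => ?_)
    exact Finset.single_le_sum (f := fun j => polyFun (MvPolynomial.pderiv j q) x ^ 2)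
      (fun j _ => sq_nonneg _) (Finset.mem_univ j)
  have hgrad : ∀ j, ∀ x ∈ Metric.closedBall y h,
      |polyFun (MvPolynomial.pderiv j q) x| ≤ Ci / h * N := fun j x hx =>
    ((hinv y h hh _ (hdeg j) x hx).1).trans (mul_le_mul_of_nonneg_left (hsq j) (by positivity))
  have hlap : ∀ x ∈ G, |polyFun (lapPoly q) x| ≤ 2 * (Ci / h ^ 2 * N) := by
    intro x hx
    have h1 : ∀ j, |polyFun (MvPolynomial.pderiv j (MvPolynomial.pderiv j q)) x| ≤ Ci / h ^ 2 * N :=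
      fun j => ((hinv y h hh _ (hdeg j) x (S.subset hx)).2 j).trans
        (mul_le_mul_of_nonneg_left (hsq j) (by positivity))
    unfold lapPoly
    rw [polyFun_add]
    refine (abs_add_le _ _).trans ?_
    linarith [h1 0, h1 1]
  have hDg : ∫ x in G, ∑ j, g j x * polyFun (MvPolynomial.pderiv j q) x = D := by
    have e : ∀ x, ∑ j : Fin 2, (g j x - polyFun (MvPolynomial.pderiv j q) x) *
        polyFun (MvPolynomial.pderiv j q) x = (∑ j, g j x * polyFun (MvPolynomial.pderiv j q) x) -
        ∑ j, polyFun (MvPolynomial.pderiv j q) x ^ 2 := fun x => by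
      rw [← Finset.sum_sub_distrib]; exact Finset.sum_congr rfl fun j _ => by ring
    simp only [e] at hproj
    rw [integral_sub (integrable_finsetSum _ fun j _ =>
      integrableOn_mul_continuous S.isOpen hb (hg j) (hpc j))
      (integrableOn_of_continuousOn_closure hb (by fun_prop : Continuous _).continuousOn)] at hproj
    linarith
  have h1 := hgreen G y h (δ * h) S v g hv hg hvg (2 * M)
    (fun x hx => lt_of_le_of_lt (hfr x hx) (by linarith)) q (Ci / h * N)
    (fun j x hx => hgrad j x (S.subset hx)) (by positivity) (by positivity)
  rw [hDg] at h1
  have h2 : |∫ x in G, v x * polyFun (lapPoly q) x| ≤ M * (h ^ 2 * discArea * (2 * (Ci / h ^ 2 * N))) := by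
    rcases lapPoly_degree hq with h0 | hl
    · rw [h0]
      simp only [polyFun_zero, mul_zero, integral_zero, abs_zero]
      positivity
    · exact (hmom _ hl).trans (mul_le_mul_of_nonneg_left
        (S.setIntegral_abs_le_of_bound (continuous_polyFun _).continuousOn hlap) hM.le)
  have h3 : D ≤ C₄ * M * N := by
    have h4 := (abs_le.1 h1).2
    have h5 := (abs_le.1 h2).1
    have e1 : Cg * h ^ 2 / (δ * h) * (2 * M) * (Ci / h * N) + M * (h ^ 2 * discArea * (2 * (Ci / h ^ 2 * N)))
        = C₄ * M * N := by
      rw [hC₄]; field_simp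
    linarith
  have hNM : N ≤ C₄ * M := by
    rcases hN0.eq_or_lt with h0 | h0
    · rw [← h0]; positivity
    · rw [← hNN, sq] at h3
      exact le_of_mul_le_mul_right h3 h0
  have hosc : ∀ x ∈ Metric.closedBall y h, ∀ x' ∈ Metric.closedBall y h,
      |polyFun q x' - polyFun q x| ≤ 4 * Ci * C₄ * M := by
    intro x hx x' hx'
    have h4 := (convex_closedBall y h).norm_image_sub_le_of_norm_fderiv_le (f := polyFun q) (𝕜 := ℝ)
      (C := 2 * (Ci / h * N)) (fun z _ => (differentiable_polyFun q) z)
      (fun z hz => norm_fderiv_le_of_abs_pd_le fun j => by rw [pd_polyFun]; exact hgrad j z hz) hx hx'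
    rw [Real.norm_eq_abs] at h4
    have h5 : ‖x' - x‖ ≤ 2 * h := by
      rw [← dist_eq_norm]
      have := dist_triangle_right x' x y
      have h6 := Metric.mem_closedBall.1 hx
      have h7 := Metric.mem_closedBall.1 hx'
      linarith
    calc |polyFun q x' - polyFun q x| ≤ 2 * (Ci / h * N) * ‖x' - x‖ := h4
      _ ≤ 2 * (Ci / h * (C₄ * M)) * (2 * h) := by gcongr
      _ = _ := by field_simp; ring
  have hfrb : frontier G ⊆ Metric.closedBall y h := fun x hx =>
    closure_minimal S.subset Metric.isClosed_closedBall (frontier_subset_closure hx)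
  have hper := perimeter_pos E
  have hqv : ContinuousOn (fun x => polyFun q x - v x) (frontier G) :=
    (continuous_polyFun q).continuousOn.sub (hv.mono frontier_subset_closure)
  intro x hx
  rw [abs_le]
  constructor
  · by_contra! hlt
    have h4 := le_boundaryIntegral E (f := fun x => -1 * (polyFun q x - v x)) (hqv.const_mul _)
      (m := -(polyFun q x) - 4 * Ci * C₄ * M - M) (fun z hz => by
        have h5 := (abs_le.1 (hosc x hx z (hfrb hz))).2
        have h6 := (abs_le.1 (hfr z hz)).1
        linarith)
    rw [boundaryIntegral_const_mul, hbd, mul_zero] at h4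
    have h5 : 0 < -(polyFun q x) - 4 * Ci * C₄ * M - M := by linarith
    exact absurd h4 (not_le.2 (mul_pos h5 hper))
  · by_contra! hlt
    have h4 := le_boundaryIntegral E hqv
      (m := polyFun q x - 4 * Ci * C₄ * M - M) (fun z hz => by
        have h5 := (abs_le.1 (hosc x hx z (hfrb hz))).1
        have h6 := (abs_le.1 (hfr z hz)).2
        linarith)
    rw [hbd] at h4
    have h5 : 0 < polyFun q x - 4 * Ci * C₄ * M - M := by linarith
    exact absurd h4 (not_le.2 (mul_pos h5 hper))

/-- The `L²(G)` inner product on polynomials of degree at most `k`. -/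
noncomputable def l2Form {G : Set E2} (hb : Bornology.IsBounded G) (k : ℕ) :
    LinearMap.BilinForm ℝ (MvPolynomial.restrictTotalDegree (Fin 2) ℝ k) :=
  have hi : ∀ q r : MvPolynomial (Fin 2) ℝ, IntegrableOn (fun x => polyFun q x * polyFun r x) G :=
    fun q r => integrableOn_of_continuousOn_closure hb
      ((continuous_polyFun q).mul (continuous_polyFun r)).continuousOn
  LinearMap.mk₂ ℝ (fun q r => ∫ x in G, polyFun q.1 x * polyFun r.1 x)
    (fun q q' r => by
      rw [← integral_add (hi _ _) (hi _ _)]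
      congr 1; ext x
      rw [Submodule.coe_add, polyFun_add]; ring)
    (fun s q r => by
      rw [smul_eq_mul, ← integral_const_mul]
      congr 1; ext x
      rw [Submodule.coe_smul, polyFun_smul]; ring)
    (fun q r r' => by
      rw [← integral_add (hi _ _) (hi _ _)]
      congr 1; ext x
      rw [Submodule.coe_add, polyFun_add]; ring)
    (fun s q r => by
      rw [smul_eq_mul, ← integral_const_mul]
      congr 1; ext x
      rw [Submodule.coe_smul, polyFun_smul]; ring)

lemma l2Form_definite {G : Set E2} (hG : IsOpen G) (hne : G.Nonempty) (hb : Bornology.IsBounded G)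
    {k : ℕ} (q : MvPolynomial.restrictTotalDegree (Fin 2) ℝ k) (h : l2Form hb k q q = 0) : q = 0 := by
  change ∫ x in G, polyFun q.1 x * polyFun q.1 x = 0 at h
  have hcont : Continuous fun x => polyFun q.1 x * polyFun q.1 x :=
    (continuous_polyFun _).mul (continuous_polyFun _)
  rw [integral_eq_zero_iff_of_nonneg (fun x => mul_self_nonneg _)
    (integrableOn_of_continuousOn_closure hb hcont.continuousOn)] at h
  have hz : EqOn (fun x => polyFun q.1 x * polyFun q.1 x) (fun _ => 0) G :=
    Measure.eqOn_open_of_ae_eq h hG hcont.continuousOn continuousOn_const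
  obtain ⟨y, hy⟩ := hne
  obtain ⟨ε, hε, hball⟩ := Metric.isOpen_iff.1 hG y hy
  exact Subtype.ext (eq_zero_of_polyFun_ball hε fun x hx => mul_self_eq_zero.1 (hz (hball hx)))

/-- Splitting of a polynomial into its `L²` projection onto the polynomials of degree at most
`p - 2` (zero if `p < 2`) and a remainder orthogonal to these. -/
lemma exists_l2_split {G : Set E2} (hG : IsOpen G) (hne : G.Nonempty) (hb : Bornology.IsBounded G)
    (p : ℕ) (r : MvPolynomial (Fin 2) ℝ) : ∃ r₁ : MvPolynomial (Fin 2) ℝ,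
      (r₁ = 0 ∨ r₁.totalDegree + 2 ≤ p) ∧ ∀ s : MvPolynomial (Fin 2) ℝ, s.totalDegree + 2 ≤ p →
        ∫ x in G, polyFun (r - r₁) x * polyFun s x = 0 := by
  rcases lt_or_ge p 2 with hp | hp
  · exact ⟨0, Or.inl rfl, fun s hs => by omega⟩
  have hi : ∀ q r : MvPolynomial (Fin 2) ℝ, IntegrableOn (fun x => polyFun q x * polyFun r x) G :=
    fun q r => integrableOn_of_continuousOn_closure hb
      ((continuous_polyFun q).mul (continuous_polyFun r)).continuousOn
  let l : MvPolynomial.restrictTotalDegree (Fin 2) ℝ (p - 2) →ₗ[ℝ] ℝ :=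
    { toFun := fun s => ∫ x in G, polyFun r x * polyFun s.1 x
      map_add' := fun s s' => by
        rw [← integral_add (hi _ _) (hi _ _)]
        congr 1; ext x
        rw [Submodule.coe_add, polyFun_add]; ring
      map_smul' := fun t s => by
        rw [RingHom.id_apply, smul_eq_mul, ← integral_const_mul]
        congr 1; ext x
        rw [Submodule.coe_smul, polyFun_smul]; ring }
  obtain ⟨r₁, hr₁⟩ := exists_representation (l2Form hb (p - 2)) (l2Form_definite hG hne hb) l
  refine ⟨r₁.1, Or.inr ?_, fun s hs => ?_⟩
  · have := (MvPolynomial.mem_restrictTotalDegree _ _ _).1 r₁.2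
    omega
  · have h1 : ∫ x in G, polyFun r₁.1 x * polyFun s x = ∫ x in G, polyFun r x * polyFun s x :=
      hr₁ ⟨s, (MvPolynomial.mem_restrictTotalDegree _ _ _).2 (by omega)⟩
    simp only [polyFun_sub, sub_mul]
    rw [integral_sub (hi _ _) (hi _ _), h1, sub_self]

/-- The moments up to degree `p`, from those up to degree `p - 2` and the enhancement condition of
the space, which replaces `v` by its gradient projection `w` in the remaining ones. -/
lemma abs_moment_le {G : Set E2} {y : E2} {h ρ : ℝ} (S : StarDisc G y h ρ) {p : ℕ} {v w : E2 → ℝ}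
    (hv : ContinuousOn v (closure G)) (hw : Continuous w) {M C : ℝ} (hM : 0 ≤ M) (hC : 0 ≤ C)
    (hmom : ∀ r : MvPolynomial (Fin 2) ℝ, r.totalDegree + 2 ≤ p →
      |∫ x in G, v x * polyFun r x| ≤ M * ∫ x in G, |polyFun r x|)
    (horth : ∀ r : MvPolynomial (Fin 2) ℝ, r.totalDegree ≤ p →
      (∀ s : MvPolynomial (Fin 2) ℝ, s.totalDegree + 2 ≤ p →
        ∫ x in G, polyFun r x * polyFun s x = 0) → ∫ x in G, (v x - w x) * polyFun r x = 0)
    (hwM : ∀ x ∈ G, |w x| ≤ C * M) {r : MvPolynomial (Fin 2) ℝ} (hr : r.totalDegree ≤ p) :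
    |∫ x in G, v x * polyFun r x| ≤ (1 + C) * √discArea * M * h * √(∫ x in G, polyFun r x ^ 2) := by
  have hb := S.isBounded
  have hh := S.h_pos
  obtain ⟨r₁, hr₁, hs⟩ := exists_l2_split S.isOpen S.nonempty hb p r
  set r₂ := r - r₁ with hr₂
  have hrr : r = r₁ + r₂ := by rw [hr₂]; ring
  have hr₂d : r₂.totalDegree ≤ p := by
    refine (MvPolynomial.totalDegree_sub _ _).trans (max_le hr ?_)
    rcases hr₁ with rfl | h1
    · simp
    · omega
  have hvi : ∀ q : MvPolynomial (Fin 2) ℝ, IntegrableOn (fun x => v x * polyFun q x) G := fun q =>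
    integrableOn_of_continuousOn_closure hb (hv.mul (continuous_polyFun q).continuousOn)
  have hci : ∀ f : E2 → ℝ, Continuous f → IntegrableOn f G := fun f hf =>
    integrableOn_of_continuousOn_closure hb hf.continuousOn
  have hc := fun q => continuous_polyFun q
  have h12 : ∫ x in G, polyFun r₂ x * polyFun r₁ x = 0 := by
    rcases hr₁ with h0 | h1
    · rw [h0]; simp [polyFun_zero]
    · exact hs _ h1
  have hpyth : ∫ x in G, polyFun r x ^ 2 =
      (∫ x in G, polyFun r₁ x ^ 2) + ∫ x in G, polyFun r₂ x ^ 2 := by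
    have e : ∀ x, polyFun r x ^ 2 =
        polyFun r₁ x ^ 2 + polyFun r₂ x ^ 2 + 2 * (polyFun r₂ x * polyFun r₁ x) := fun x => by
      conv_lhs => rw [hrr]
      rw [polyFun_add]; ring
    simp only [e]
    have i1 := hci _ ((hc r₁).pow 2)
    have i2 := hci _ ((hc r₂).pow 2)
    have i3 : IntegrableOn (fun x => 2 * (polyFun r₂ x * polyFun r₁ x)) G :=
      hci _ (continuous_const.mul ((hc r₂).mul (hc r₁)))
    have i12 : IntegrableOn (fun x => polyFun r₁ x ^ 2 + polyFun r₂ x ^ 2) G := i1.add i2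
    rw [integral_add i12 i3, integral_const_mul, h12, mul_zero, add_zero]
    exact integral_add i1 i2
  have hn1 : 0 ≤ ∫ x in G, polyFun r₁ x ^ 2 := integral_nonneg fun x => sq_nonneg _
  have hn2 : 0 ≤ ∫ x in G, polyFun r₂ x ^ 2 := integral_nonneg fun x => sq_nonneg _
  set N := √(∫ x in G, polyFun r x ^ 2) with hN
  have hN1 : ∫ x in G, |polyFun r₁ x| ≤ h * √discArea * N :=
    (S.setIntegral_abs_le (hc r₁).continuousOn).trans
      (mul_le_mul_of_nonneg_left (Real.sqrt_le_sqrt (by linarith)) (by positivity))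
  have hN2 : ∫ x in G, |polyFun r₂ x| ≤ h * √discArea * N :=
    (S.setIntegral_abs_le (hc r₂).continuousOn).trans
      (mul_le_mul_of_nonneg_left (Real.sqrt_le_sqrt (by linarith)) (by positivity))
  have e1 : |∫ x in G, v x * polyFun r₁ x| ≤ M * (h * √discArea * N) := by
    rcases hr₁ with h0 | h1
    · rw [h0]
      simp only [polyFun_zero, mul_zero, integral_zero, abs_zero]
      positivity
    · exact (hmom _ h1).trans (mul_le_mul_of_nonneg_left hN1 hM)
  have e2 : |∫ x in G, v x * polyFun r₂ x| ≤ C * M * (h * √discArea * N) := by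
    have h1 := horth r₂ hr₂d hs
    simp only [sub_mul] at h1
    have iw : IntegrableOn (fun x => w x * polyFun r₂ x) G := hci _ (hw.mul (hc r₂))
    rw [integral_sub (hvi _) iw, sub_eq_zero] at h1
    rw [h1]
    calc |∫ x in G, w x * polyFun r₂ x| ≤ ∫ x in G, |w x * polyFun r₂ x| := abs_integral_le_integral_abs
      _ ≤ ∫ x in G, C * M * |polyFun r₂ x| := by
          refine setIntegral_mono_on iw.abs (hci _ (continuous_const.mul (hc r₂).abs))
            S.isOpen.measurableSet fun x hx => ?_
          rw [abs_mul]
          exact mul_le_mul_of_nonneg_right (hwM x hx) (abs_nonneg _)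
      _ = C * M * ∫ x in G, |polyFun r₂ x| := integral_const_mul _ _
      _ ≤ _ := mul_le_mul_of_nonneg_left hN2 (by positivity)
  have hsum : ∫ x in G, v x * polyFun r x =
      (∫ x in G, v x * polyFun r₁ x) + ∫ x in G, v x * polyFun r₂ x := by
    rw [← integral_add (hvi _) (hvi _)]
    congr 1; ext x
    rw [← mul_add, ← polyFun_add, ← hrr]
  rw [hsum]
  refine (abs_add_le _ _).trans ((add_le_add e1 e2).trans (le_of_eq ?_))
  ring

/-- Truncating `v` at the level of its boundary values changes it by a bounded amount and makes it
an admissible test function for its own equation; this bounds the `L²` norm. -/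
lemma sqrt_integral_sq_le_of_moments {G : Set E2} {y : E2} {h r : ℝ} (S : StarDisc G y h r) {p : ℕ}
    {v : E2 → ℝ} (hv : ContinuousOn v (closure G)) {q : MvPolynomial (Fin 2) ℝ}
    (hq : q.totalDegree ≤ p) (hvq : WeakLap G v (polyFun q)) {M C C' : ℝ} (hM : 0 < M)
    (hC' : 0 < C') (hfr : ∀ x ∈ frontier G, |v x| ≤ M) (hC : 0 ≤ C)
    (hmom : ∀ r : MvPolynomial (Fin 2) ℝ, r.totalDegree ≤ p →
      |∫ x in G, v x * polyFun r x| ≤ C * M * h * √(∫ x in G, polyFun r x ^ 2))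
    (hqv : ∀ x ∈ G, |polyFun q x| ≤ C' / h ^ 3 * √(∫ x in G, v x ^ 2)) :
    √(∫ x in G, v x ^ 2) ≤
      (8 * (C + 4 * √discArea) * √discArea * C' + 32 * discArea + 1) * (M * h) := by
  have hh := S.h_pos
  have hb := S.isBounded
  have hω := discArea_pos
  have hsω := Real.sqrt_pos.2 hω
  set N := √(∫ x in G, v x ^ 2) with hN
  have hN0 : 0 ≤ N := Real.sqrt_nonneg _
  have hNN : N ^ 2 = ∫ x in G, v x ^ 2 := Real.sq_sqrt (integral_nonneg fun x => sq_nonneg _)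
  have ha : 0 < 2 * M := by linarith
  set φ : E2 → ℝ := fun x => trunc (2 * M) (v x) - trunc (2 * M) (-v x) with hφ
  have htc := continuous_trunc (2 * M)
  have h1c : ContinuousOn (fun x => trunc (2 * M) (v x)) (closure G) := htc.comp_continuousOn hv
  have h2c : ContinuousOn (fun x => trunc (2 * M) (-v x)) (closure G) := htc.comp_continuousOn hv.neg
  have hφc : ContinuousOn φ (closure G) := h1c.sub h2c
  have hi : ∀ f : E2 → ℝ, ContinuousOn f (closure G) → IntegrableOn f G := fun f hf =>
    integrableOn_of_continuousOn_closure hb hf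
  have hqc := (continuous_polyFun q).continuousOn (s := closure G)
  have hyG : ∀ x ∈ G, |x 0 - y 0| ≤ h := fun x hx =>
    (PiLp.norm_apply_le (x - y) 0).trans (mem_closedBall_iff_norm.1 (S.subset hx))
  have energy : ∀ w r : E2 → ℝ, ContinuousOn w (closure G) → Continuous r → WeakLap G w r →
      (∀ x ∈ frontier G, |w x| ≤ M) →
      ∫ x in G, trunc (2 * M) (w x) ^ 2 ≤ 4 * h ^ 2 * -∫ x in G, trunc (2 * M) (w x) * r x := by
    intro w r hw hr hwr hwM
    refine integral_sq_comp_le S.isOpen hb hw hr hwr (hasDerivAt_trunc (2 * M))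
      (continuous_truncDeriv _) (truncDeriv_nonneg _) (truncDeriv_le_one _) (α := -(2 * M))
      (β := 2 * M) (by linarith) ha (fun s hs => trunc_of_le ha hs.2) (fun x hx => ?_) hyG
    have := abs_le.1 (hwM x hx)
    constructor <;> linarith [this.1, this.2]
  have en1 := energy v _ hv (continuous_polyFun q) hvq hfr
  have en2 := energy (fun x => -v x) (fun x => -polyFun q x) hv.neg (continuous_polyFun q).neg hvq.neg
    fun x hx => by rw [abs_neg]; exact hfr x hx
  have hdiff : ∀ x, |v x - φ x| ≤ 4 * M := by
    intro x
    simp only [hφ]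
    rcases le_total 0 (v x) with h0 | h0
    · have e := trunc_of_le ha (show -v x ≤ 2 * M by linarith)
      have h1 := sub_two_mul_le_trunc ha (v x)
      have h2 := trunc_le_self ha h0
      rw [e, abs_le]; constructor <;> linarith
    · have e := trunc_of_le ha (show v x ≤ 2 * M by linarith)
      have h1 := sub_two_mul_le_trunc ha (-v x)
      have h2 := trunc_le_self ha (neg_nonneg.2 h0)
      rw [e, abs_le]; constructor <;> linarith
  set R := √(∫ x in G, polyFun q x ^ 2) with hR
  have hR0 : 0 ≤ R := Real.sqrt_nonneg _
  have hφ2 : ∫ x in G, φ x ^ 2 ≤ 4 * h ^ 2 * -∫ x in G, φ x * polyFun q x := by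
    have i1 : IntegrableOn (fun x => trunc (2 * M) (v x) ^ 2) G := hi _ (h1c.pow 2)
    have i2 : IntegrableOn (fun x => trunc (2 * M) (-v x) ^ 2) G := hi _ (h2c.pow 2)
    have e1 : ∫ x in G, φ x ^ 2 ≤
        (∫ x in G, trunc (2 * M) (v x) ^ 2) + ∫ x in G, trunc (2 * M) (-v x) ^ 2 := by
      rw [← integral_add i1 i2]
      refine setIntegral_mono (hi _ (hφc.pow 2)) (i1.add i2) fun x => ?_
      have := mul_nonneg (trunc_nonneg ha (v x)) (trunc_nonneg ha (-v x))
      simp only [hφ]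
      nlinarith
    have e2 : ∫ x in G, φ x * polyFun q x = (∫ x in G, trunc (2 * M) (v x) * polyFun q x) +
        ∫ x in G, trunc (2 * M) (-v x) * -polyFun q x := by
      have j1 : IntegrableOn (fun x => trunc (2 * M) (v x) * polyFun q x) G := hi _ (h1c.mul hqc)
      have j2 : IntegrableOn (fun x => trunc (2 * M) (-v x) * -polyFun q x) G :=
        hi _ (h2c.mul hqc.neg)
      rw [← integral_add j1 j2]
      congr 1; ext x
      simp only [hφ]
      ring
    rw [e2]
    linarith
  have hdual : -∫ x in G, φ x * polyFun q x ≤ (C + 4 * √discArea) * (M * h) * R := by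
    have e1 : ∫ x in G, φ x * polyFun q x =
        (∫ x in G, v x * polyFun q x) - ∫ x in G, (v x - φ x) * polyFun q x := by
      have j1 : IntegrableOn (fun x => v x * polyFun q x) G := hi _ (hv.mul hqc)
      have j2 : IntegrableOn (fun x => (v x - φ x) * polyFun q x) G := hi _ ((hv.sub hφc).mul hqc)
      rw [← integral_sub j1 j2]
      congr 1; ext x; ring
    have e2 := (abs_le.1 (hmom q hq)).1
    have e3 : ∫ x in G, (v x - φ x) * polyFun q x ≤ 4 * M * (h * √discArea * R) := by
      calc ∫ x in G, (v x - φ x) * polyFun q x ≤ ∫ x in G, 4 * M * |polyFun q x| := by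
            refine setIntegral_mono (hi _ ((hv.sub hφc).mul hqc)) (hi _ (hqc.abs.const_mul _)) fun x => ?_
            refine (le_abs_self _).trans ?_
            simp only [abs_mul]
            exact mul_le_mul_of_nonneg_right (hdiff x) (abs_nonneg _)
        _ = 4 * M * ∫ x in G, |polyFun q x| := integral_const_mul _ _
        _ ≤ _ := mul_le_mul_of_nonneg_left (S.setIntegral_abs_le hqc) (by positivity)
    have e4 : (C + 4 * √discArea) * (M * h) * R = C * M * h * R + 4 * M * (h * √discArea * R) := by ring
    rw [e1, e4]
    linarith
  have hRN : R ≤ √discArea * C' / h ^ 2 * N := by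
    refine Real.sqrt_le_iff.2 ⟨by positivity, ?_⟩
    have e : (√discArea * C' / h ^ 2 * N) ^ 2 = h ^ 2 * discArea * (C' / h ^ 3 * N) ^ 2 := by
      rw [mul_pow, div_pow, mul_pow, Real.sq_sqrt hω.le]
      field_simp
    rw [e]
    have h1 := S.setIntegral_abs_le_of_bound (f := fun x => polyFun q x ^ 2) (hqc.pow 2)
      (B := (C' / h ^ 3 * N) ^ 2) fun x hx => by
        rw [abs_of_nonneg (sq_nonneg _), ← sq_abs]
        exact pow_le_pow_left₀ (abs_nonneg _) (hqv x hx) 2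
    simpa only [abs_pow, sq_abs] using h1
  have hφN : ∫ x in G, φ x ^ 2 ≤ 4 * (C + 4 * √discArea) * √discArea * C' * (M * h) * N := by
    calc ∫ x in G, φ x ^ 2 ≤ 4 * h ^ 2 * ((C + 4 * √discArea) * (M * h) * (√discArea * C' / h ^ 2 * N)) := by
          refine hφ2.trans (mul_le_mul_of_nonneg_left (hdual.trans ?_) (by positivity))
          gcongr
      _ = _ := by field_simp
  have hfinal : N ^ 2 ≤ 8 * (C + 4 * √discArea) * √discArea * C' * (M * h) * N +
      32 * discArea * (M * h) ^ 2 := by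
    have j1 : IntegrableOn (fun x => 2 * φ x ^ 2) G := hi _ ((hφc.pow 2).const_mul _)
    have j2 : IntegrableOn (fun _ : E2 => 2 * (4 * M) ^ 2) G := integrableOn_const S.volume_lt_top.ne
    have e1 : ∫ x in G, v x ^ 2 ≤ ∫ x in G, (2 * φ x ^ 2 + 2 * (4 * M) ^ 2) := by
      refine setIntegral_mono (hi _ (hv.pow 2)) (j1.add j2) fun x => ?_
      have h1 : (v x - φ x) ^ 2 ≤ (4 * M) ^ 2 := by
        rw [← sq_abs]; exact pow_le_pow_left₀ (abs_nonneg _) (hdiff x) 2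
      have h2 : 0 ≤ (v x - 2 * φ x) ^ 2 := sq_nonneg _
      change v x ^ 2 ≤ 2 * φ x ^ 2 + 2 * (4 * M) ^ 2
      nlinarith
    rw [integral_add j1 j2, integral_const_mul, setIntegral_const, smul_eq_mul] at e1
    have e2 : volume.real G * (2 * (4 * M) ^ 2) ≤ h ^ 2 * discArea * (2 * (4 * M) ^ 2) :=
      mul_le_mul_of_nonneg_right S.volume_real_le (by positivity)
    rw [hNN]
    nlinarith
  set X := M * h with hX
  have hX0 : 0 < X := by positivity
  set A := 8 * (C + 4 * √discArea) * √discArea * C' with hA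
  have hA0 : 0 ≤ A := by positivity
  by_contra! hlt
  have h1 : X ≤ N := by nlinarith
  nlinarith [mul_lt_mul_of_pos_right hlt (hX0.trans_le h1), mul_le_mul_of_nonneg_left h1 hX0.le]

/-- Stability of the interpolation in the maximum norm: if a continuous function is uniformly close
to a polynomial of degree at most `p`, so is its interpolant. -/
theorem exists_interpolant_bound {p : ℕ} (hp : 1 ≤ p) {δ : ℝ} (hδ : 0 < δ) : ∃ C, 0 < C ∧
    ∀ (E : PolygonalElement) (y : E2) (h : ℝ), StarDisc E.carrier y h (δ * h) →
    ∀ u W : E2 → ℝ, ContinuousOn u (closure E.carrier) → MemVLoc E p W →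
    (∀ i t, IsLobatto p t → W (E.edgePoint i t) = u (E.edgePoint i t)) →
    (∀ r : MvPolynomial (Fin 2) ℝ, r.totalDegree + 2 ≤ p →
      ∫ x in E.carrier, W x * polyFun r x = ∫ x in E.carrier, u x * polyFun r x) →
    ∀ q : MvPolynomial (Fin 2) ℝ, q.totalDegree ≤ p → ∀ ε, 0 < ε →
    (∀ x ∈ closure E.carrier, |u x - polyFun q x| ≤ ε) →
    ∀ x ∈ closure E.carrier, |W x - polyFun q x| ≤ C * ε := by
  obtain ⟨s, hscard, hs⟩ := exists_lobatto_nodes hp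
  obtain ⟨C₁, hC₁, hnodes⟩ := exists_bound_of_nodes p s hscard
  obtain ⟨C₂, hC₂, hproj⟩ := exists_gradProj_bound p hδ
  obtain ⟨C₃, hC₃, hlap⟩ := exists_weakLap_bound p hδ
  have hω := Real.sqrt_pos.2 discArea_pos
  have hω' := discArea_pos
  set A := 8 * ((1 + C₂) * √discArea + 4 * √discArea) * √discArea * C₃ + 32 * discArea + 1 with hA
  have hA0 : 0 < A := by positivity
  refine ⟨C₁ + C₃ * (A * C₁) / 4, by positivity, ?_⟩
  intro E y h S u W hu hW hlob hmomW q hq ε hε huq x hx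
  obtain ⟨⟨hWH, hWc, hWtr, ρ, hρ, hWρ⟩, hWorth⟩ := hW
  have hh := S.h_pos
  have hb := S.isBounded
  set G := E.carrier with hG
  set v : E2 → ℝ := fun x => W x + polyFun (-q) x with hvdef
  have hve : ∀ x, v x = W x - polyFun q x := fun x => by
    have : polyFun (-q) x = -polyFun q x := by simp [polyFun]
    simp only [hvdef, this]; ring
  have hqc := continuous_polyFun (-q)
  have hvc : ContinuousOn v (closure G) := hWc.add hqc.continuousOn
  set M := C₁ * ε with hM
  have hM0 : 0 < M := by positivity
  have hεM : ε ≤ M := le_mul_of_one_le_left hε.le hC₁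
  have hnq : (-q).totalDegree ≤ p := by rwa [MvPolynomial.totalDegree_neg]
  have hfr : ∀ x ∈ frontier G, |v x| ≤ M := by
    intro x hx
    obtain ⟨i, t, ht, rfl⟩ := E.exists_edgePoint hx
    obtain ⟨g, hg, hgW⟩ := hWtr i
    obtain ⟨g', hg', hgq⟩ := exists_polyFun_lineMap hnq (E.vertex i) (E.vertex (i + 1))
    have e : ∀ t ∈ Icc (0 : ℝ) 1, v (E.edgePoint i t) = (g + g').eval t := fun t ht => by
      rw [Polynomial.eval_add, ← hgW t ht, ← hgq t]; rfl
    rw [e t ht]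
    refine (hnodes (g + g') ((Polynomial.natDegree_add_le _ _).trans (max_le hg hg')) ε
      (fun τ hτ => ?_) t ht).1
    obtain ⟨hτ1, hτ2⟩ := hs τ hτ
    rw [← e τ hτ1, hve, hlob i τ hτ2]
    exact huq _ (frontier_subset_closure (E.edgePoint_mem_frontier i hτ1))
  -- the weak Laplacian and the weak gradient of `v`
  have hvlap : WeakLap G v (polyFun (ρ + lapPoly (-q))) := by
    have h1 : WeakLap G W (polyFun ρ) := hWρ
    have h2 := WeakLap.add (integrableOn_of_continuousOn_closure hb hWc) (integrableOn_polyFun hb (-q))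
      (integrableOn_polyFun hb ρ) (integrableOn_polyFun hb _) h1 (weakLap_polyFun G (-q))
    rw [show polyFun (ρ + lapPoly (-q)) = _ from funext fun x => polyFun_add _ _ x]
    exact h2
  have hρd : (ρ + lapPoly (-q)).totalDegree ≤ p := by
    refine (MvPolynomial.totalDegree_add _ _).trans (max_le hρ ?_)
    rcases lapPoly_degree hnq with h0 | h1
    · rw [h0]; simp
    · omega
  set g : Fin 2 → E2 → ℝ := fun j x =>
    weakPartial G j W x + polyFun (MvPolynomial.pderiv j (-q)) x with hgdef
  have hgi : ∀ j, IntegrableOn (g j) G := fun j =>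
    (weakPartial_spec hWH j).1.add (integrableOn_polyFun hb _)
  have hgv : ∀ j φ, IsTest G φ → ∫ x in G, v x * pd j φ x = -∫ x in G, g j x * φ x := by
    intro j φ hφ
    have h1 := (weakPartial_spec hWH j).2 φ hφ
    have h2 := setIntegral_mul_pd_of_isTest (contDiff_polyFun (-q)) hφ j
    rw [pd_polyFun] at h2
    have hφc := hφ.1.continuous
    have hpc : Continuous (pd j φ) := (contDiff_pd hφ.1 j).continuous
    have a1 := integrableOn_mul_continuous S.isOpen hb (integrableOn_of_continuousOn_closure hb hWc) hpc
    have a2 := integrableOn_mul_continuous S.isOpen hb (integrableOn_polyFun hb (-q)) hpc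
    have a3 := integrableOn_mul_continuous S.isOpen hb (weakPartial_spec hWH j).1 hφc
    have a4 := integrableOn_mul_continuous S.isOpen hb
      (integrableOn_polyFun hb (MvPolynomial.pderiv j (-q))) hφc
    simp only [hvdef, hgdef, add_mul]
    rw [integral_add a1 a2, integral_add a3 a4, h1, h2]
    ring
  have hmom : ∀ r : MvPolynomial (Fin 2) ℝ, r.totalDegree + 2 ≤ p →
      |∫ x in G, v x * polyFun r x| ≤ M * ∫ x in G, |polyFun r x| := by
    intro r hr
    have hrc := continuous_polyFun r
    have a1 := integrableOn_mul_continuous S.isOpen hb (integrableOn_of_continuousOn_closure hb hWc) hrc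
    have a2 := integrableOn_mul_continuous S.isOpen hb (integrableOn_polyFun hb (-q)) hrc
    have a3 := integrableOn_mul_continuous S.isOpen hb (integrableOn_of_continuousOn_closure hb hu) hrc
    have e : ∫ x in G, v x * polyFun r x = ∫ x in G, (u x + polyFun (-q) x) * polyFun r x := by
      simp only [hvdef, add_mul]
      rw [integral_add a1 a2, integral_add a3 a2, hmomW r hr]
    rw [e]
    have hcu : ContinuousOn (fun x => (u x + polyFun (-q) x) * polyFun r x) (closure G) :=
      (hu.add hqc.continuousOn).mul hrc.continuousOn
    calc |∫ x in G, (u x + polyFun (-q) x) * polyFun r x|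
        ≤ ∫ x in G, |(u x + polyFun (-q) x) * polyFun r x| := abs_integral_le_integral_abs
      _ ≤ ∫ x in G, M * |polyFun r x| := by
          refine setIntegral_mono_on (integrableOn_of_continuousOn_closure hb hcu.abs)
            (integrableOn_of_continuousOn_closure hb (continuous_const.mul hrc.abs).continuousOn)
            S.isOpen.measurableSet fun x hx => ?_
          rw [abs_mul]
          refine mul_le_mul_of_nonneg_right ?_ (abs_nonneg _)
          have h1 := huq x (subset_closure hx)
          have h2 : polyFun (-q) x = -polyFun q x := by simp [polyFun]
          rw [h2, ← sub_eq_add_neg]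
          exact h1.trans hεM
      _ = _ := integral_const_mul _ _
  -- the gradient projection of `v`
  obtain ⟨π, hπe, hπd, hπg, hπb⟩ := exists_gradProj_eq (p := p) hWH hWc
  have hπq : (π + -q).totalDegree ≤ p := (MvPolynomial.totalDegree_add _ _).trans (max_le hπd hnq)
  have hproj_le := hproj E y h S v g hvc hgi hgv M hM0 hfr hmom (π + -q) hπq (by
      rw [← hπg (π + -q) hπq]
      congr 1; ext x
      refine Finset.sum_congr rfl fun j _ => ?_
      simp only [hgdef, map_add, polyFun_add]
      ring) (by
      rw [← hπb]
      congr 1; ext x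
      simp only [hvdef, polyFun_add]
      ring)
  have hmomall : ∀ r : MvPolynomial (Fin 2) ℝ, r.totalDegree ≤ p → |∫ x in G, v x * polyFun r x| ≤
      (1 + C₂) * √discArea * M * h * √(∫ x in G, polyFun r x ^ 2) := fun r hr => by
    refine abs_moment_le S hvc (continuous_polyFun (π + -q)) hM0.le hC₂.le hmom (fun r hr hrs => ?_)
      (fun x hx => hproj_le x (S.subset hx)) hr
    have h1 := hWorth r hr hrs
    rw [hπe] at h1
    rw [← h1]
    congr 1; ext x
    simp only [hvdef, polyFun_add]
    ring
  have hK := fun x hx => hlap y h hh _ hρd G S.isOpen hb S.ball_subset v hvc hvlap x (S.subset hx)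
  have hN := sqrt_integral_sq_le_of_moments S hvc hρd hvlap (C := (1 + C₂) * √discArea) hM0 hC₃ hfr
    (by positivity) hmomall hK
  have hmain := hvlap.abs_le_of_frontier S.isOpen S.subset hvc (continuous_polyFun _)
    (by positivity) hK hM0.le hfr x hx
  rw [← hve]
  refine hmain.trans ?_
  have e1 : C₃ / h ^ 3 * √(∫ x in G, v x ^ 2) ≤ C₃ / h ^ 3 * (A * (M * h)) :=
    mul_le_mul_of_nonneg_left hN (by positivity)
  calc M + C₃ / h ^ 3 * √(∫ x in G, v x ^ 2) * h ^ 2 / 4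
      ≤ M + C₃ / h ^ 3 * (A * (M * h)) * h ^ 2 / 4 := by gcongr
    _ = (C₁ + C₃ * (A * C₁) / 4) * ε := by rw [hM]; field_simp

/-! ### From a single element to the mesh -/

lemma setIntegral_sq_le_of_eLpNorm_le {G : Set E2} {g : E2 → ℝ} (hg : MemLp g 2 (volume.restrict G))
    {B : ℝ≥0} (h : eLpNorm g 2 (volume.restrict G) ≤ B) : ∫ x in G, g x ^ 2 ≤ (B : ℝ) ^ 2 := by
  have h0 : 0 ≤ ∫ x in G, g x ^ 2 := integral_nonneg fun x => sq_nonneg _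
  rw [hg.eLpNorm_eq_integral_rpow_norm two_ne_zero ENNReal.ofNat_ne_top] at h
  have e : ∫ x in G, ‖g x‖ ^ (2 : ℝ≥0∞).toReal = ∫ x in G, g x ^ 2 := by
    congr 1; ext x
    simp
  rw [e, ENNReal.toReal_ofNat, ← one_div, ← Real.sqrt_eq_rpow, ← ENNReal.ofReal_coe_nnreal,
    ENNReal.ofReal_le_ofReal_iff B.coe_nonneg, Real.sqrt_le_iff] at h
  exact h.2

/-- A bound on the `H^k` norm gives bounded weak derivatives on every open subset. -/
lemma exists_isWeakDeriv_of_sobolevNorm_le {Ω G : Set E2} (hGΩ : G ⊆ Ω) {k : ℕ} {u : E2 → ℝ} {B : ℝ≥0}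
    (hu : sobolevNorm Ω k u ≤ B) {a b : ℕ} (hab : a + b = k) :
    ∃ g, IsWeakDeriv G a b u g ∧ ∫ x in G, g x ^ 2 ≤ (B : ℝ) ^ 2 := by
  have hmem : MemH Ω k u := by
    by_contra hn
    unfold sobolevNorm at hu
    rw [if_neg hn] at hu
    exact absurd hu (by simp)
  have hex := hmem.2 a b hab.le
  have hw : IsWeakDeriv Ω a b u (weakD Ω a b u) := by
    unfold weakD
    rw [dif_pos hex]
    exact hex.choose_spec
  have hle : eLpNorm (weakD Ω a b u) 2 (volume.restrict Ω) ≤ B := by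
    unfold sobolevNorm at hu
    rw [if_pos hmem] at hu
    refine le_trans ?_ hu
    have h1 : eLpNorm (weakD Ω a b u) 2 (volume.restrict Ω) ^ 2 ≤
        ∑ a ∈ Finset.range (k + 1), ∑ b ∈ Finset.range (k + 1 - a),
          eLpNorm (weakD Ω a b u) 2 (volume.restrict Ω) ^ 2 :=
      (Finset.single_le_sum (f := fun b => eLpNorm (weakD Ω a b u) 2 (volume.restrict Ω) ^ 2)
        (fun _ _ => zero_le) (Finset.mem_range.2 (by omega : b < k + 1 - a))).trans
      (Finset.single_le_sum (f := fun a => ∑ b ∈ Finset.range (k + 1 - a),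
        eLpNorm (weakD Ω a b u) 2 (volume.restrict Ω) ^ 2)
        (fun _ _ => zero_le) (Finset.mem_range.2 (by omega : a < k + 1)))
    refine le_trans (le_of_eq ?_) (ENNReal.rpow_le_rpow h1 (by norm_num : (0 : ℝ) ≤ 1 / 2))
    rw [← ENNReal.rpow_natCast, ← ENNReal.rpow_mul]
    norm_num
  have hm : volume.restrict G ≤ volume.restrict Ω := Measure.restrict_mono hGΩ le_rfl
  have hgG : MemLp (weakD Ω a b u) 2 (volume.restrict G) := hw.1.mono_measure hm
  refine ⟨weakD Ω a b u, ⟨hgG, fun φ hφ => ?_⟩,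
    setIntegral_sq_le_of_eLpNorm_le hgG ((eLpNorm_mono_measure _ hm).trans hle)⟩
  have h1 := hw.2 φ ⟨hφ.1, hφ.2.1, hφ.2.2.trans hGΩ⟩
  have hs : tsupport (pdMulti a b φ) ⊆ G :=
    (closure_minimal (fun x hx => by
      by_contra hx'
      exact hx (image_eq_zero_of_notMem_tsupport fun h => hx' (tsupport_pdMulti_subset φ a b h)))
      (isClosed_tsupport φ)).trans hφ.2.2
  rw [setIntegral_eq_integral_of_tsupport (hs.trans hGΩ) (fun x hx => by simp [hx]),
    setIntegral_eq_integral_of_tsupport (hφ.2.2.trans hGΩ) (fun x hx => by simp [hx])] at h1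
  rw [setIntegral_eq_integral_of_tsupport hs (fun x hx => by simp [hx]),
    setIntegral_eq_integral_of_tsupport hφ.2.2 (fun x hx => by simp [hx]), h1]

lemma abs_le_of_eLpNorm_top_le {Ω : Set E2} (hΩ : IsOpen Ω) {u : E2 → ℝ} (hu : ContinuousOn u Ω)
    {μ : ℝ} (hμ : 0 ≤ μ) (h : eLpNorm u ∞ (volume.restrict Ω) ≤ ENNReal.ofReal μ) :
    ∀ x ∈ Ω, |u x| ≤ μ := by
  rw [eLpNorm_exponent_top] at h
  have hae : (fun x => max |u x| μ) =ᵐ[volume.restrict Ω] fun _ => μ := by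
    filter_upwards [ae_le_eLpNormEssSup (f := u) (μ := volume.restrict Ω)] with x hx
    have h1 := hx.trans h
    rw [← ofReal_norm, ENNReal.ofReal_le_ofReal_iff hμ] at h1
    exact max_eq_right h1
  have := Measure.eqOn_open_of_ae_eq hae hΩ (ContinuousOn.sup hu.abs continuousOn_const) continuousOn_const
  intro x hx
  have h1 := this hx
  simp only at h1
  exact max_eq_right_iff.1 h1

lemma PolygonalElement.diam_pos (E : PolygonalElement) : 0 < E.diam := by
  obtain ⟨y, hy⟩ := E.nonempty_carrier
  obtain ⟨ε, hε, hball⟩ := Metric.isOpen_iff.1 E.isOpen_carrier y hy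
  have h1 : y + EuclideanSpace.single 0 (ε / 2) ∈ E.carrier := by
    refine hball ?_
    rw [mem_ball_iff_norm, add_sub_cancel_left, PiLp.norm_single, Real.norm_eq_abs,
      abs_of_pos (by positivity)]
    linarith
  have h2 := Metric.dist_le_diam_of_mem E.isBounded_carrier h1 hy
  rw [dist_eq_norm, add_sub_cancel_left, PiLp.norm_single, Real.norm_eq_abs,
      abs_of_pos (by positivity)] at h2
  exact lt_of_lt_of_le (by positivity) h2

lemma PolygonalElement.starDisc (E : PolygonalElement) {δ : ℝ} (hδ : 0 < δ) {y : E2}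
    (hy : ∀ z ∈ Metric.ball y (δ * E.diam), StarConvex ℝ z E.carrier) :
    StarDisc E.carrier y E.diam (δ * E.diam) where
  isOpen := E.isOpen_carrier
  nonempty := E.nonempty_carrier
  h_pos := E.diam_pos
  r_pos := mul_pos hδ E.diam_pos
  star := hy
  subset := by
    intro x hx
    have hyG : y ∈ E.carrier := by
      have := hy y (Metric.mem_ball_self (mul_pos hδ E.diam_pos)) hx zero_le_one le_rfl (by norm_num)
      simpa using this
    exact Metric.dist_le_diam_of_mem E.isBounded_carrier hx hyG

/-- The estimate on one element: interpolation error plus inverse estimate for the difference of the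
interpolant and the discrete function. -/
theorem exists_element_bound {p s : ℕ} (hs : 1 ≤ s) (hsp : s ≤ p) {δ c : ℝ} (hδ : 0 < δ) (hc : 0 < c)
    (B : ℝ≥0) : ∃ C, 0 < C ∧ ∀ (E : PolygonalElement) (Ω : Set E2), E.carrier ⊆ Ω →
      (∃ y : E2, ∀ z ∈ Metric.ball y (δ * E.diam), StarConvex ℝ z E.carrier) →
      (∀ i, c * E.diam ≤ E.edgeLength i) → ∀ u I U : E2 → ℝ,
      ContinuousOn u (closure E.carrier) → sobolevNorm Ω (s + 1) u ≤ B →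
      MemVLoc E p I → (∀ i t, IsLobatto p t → I (E.edgePoint i t) = u (E.edgePoint i t)) →
      (∀ r : MvPolynomial (Fin 2) ℝ, r.totalDegree + 2 ≤ p →
        ∫ x in E.carrier, I x * polyFun r x = ∫ x in E.carrier, u x * polyFun r x) →
      MemVLoc E p U → ∀ x ∈ closure E.carrier,
        |U x - u x| ≤ C * (E.diam ^ s + √(∫ x in E.carrier, (I x - U x) ^ 2) / E.diam) := by
  obtain ⟨Cb, hCb, hBH⟩ := exists_poly_approx hs hδ
  obtain ⟨Ci, hCi, hint⟩ := exists_interpolant_bound (hs.trans hsp) hδ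
  obtain ⟨Cv, hCv, hinv⟩ := exists_inverse_estimate p hδ hc
  set β : ℝ := B + 1 with hβ
  have hβ0 : 0 < β := by positivity
  refine ⟨(1 + Ci) * (Cb * β) + Cv, by positivity, ?_⟩
  intro E Ω hEΩ ⟨y, hy⟩ hedge u I U hu huB hI hlob hmom hU x hx
  have S := E.starDisc hδ hy
  have hh := S.h_pos
  have hb := S.isBounded
  set h := E.diam with hhdef
  obtain ⟨q, hq, hqu⟩ := hBH E.carrier y h S u hu β hβ0 fun a b hab => by
    obtain ⟨g, hg, hgB⟩ := exists_isWeakDeriv_of_sobolevNorm_le hEΩ huB hab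
    exact ⟨g, hg, hgB.trans (pow_le_pow_left₀ B.coe_nonneg (by rw [hβ]; linarith) 2)⟩
  have h1 := hqu x hx
  have h2 := hint E y h S u I hu hI hlob hmom q (hq.trans hsp) (Cb * h ^ s * β) (by positivity) hqu x hx
  obtain ⟨⟨-, hIc, hItr, ρ, hρ, hIρ⟩, -⟩ := hI
  obtain ⟨⟨-, hUc, hUtr, τ, hτ, hUτ⟩, -⟩ := hU
  have hIρ' : WeakLap E.carrier I (polyFun ρ) := hIρ
  have hUτ' : WeakLap E.carrier U (polyFun τ) := hUτ
  have hlap : WeakLap E.carrier (fun x => I x + -U x) (polyFun (ρ - τ)) := by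
    rw [show polyFun (ρ - τ) = fun x => polyFun ρ x + -polyFun τ x from
      funext fun x => by rw [polyFun_sub, sub_eq_add_neg]]
    exact WeakLap.add (integrableOn_of_continuousOn_closure hb hIc)
      (integrableOn_of_continuousOn_closure hb hUc.neg) (integrableOn_polyFun hb ρ)
      (integrableOn_polyFun hb τ).neg hIρ' hUτ'.neg
  have htr : PolyTrace E p fun x => I x + -U x := by
    intro i
    obtain ⟨g, hg, hgI⟩ := hItr i
    obtain ⟨g', hg', hgU⟩ := hUtr i
    refine ⟨g - g', (Polynomial.natDegree_sub_le _ _).trans (max_le hg hg'), fun t ht => ?_⟩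
    change I (E.edgePoint i t) + -U (E.edgePoint i t) = _
    rw [Polynomial.eval_sub, hgI t ht, hgU t ht, sub_eq_add_neg]
  have h3 := hinv E y h S hedge (fun x => I x + -U x) (hIc.add hUc.neg) htr (ρ - τ)
    ((MvPolynomial.totalDegree_sub _ _).trans (max_le hρ hτ)) hlap x hx
  simp only [← sub_eq_add_neg] at h3
  have h4 : U x - u x = -(u x - polyFun q x) + (I x - polyFun q x) - (I x - U x) := by ring
  have h5 : |U x - u x| ≤ |u x - polyFun q x| + |I x - polyFun q x| + |I x - U x| := by
    rw [h4]
    refine (abs_sub _ _).trans (add_le_add_left ?_ _)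
    exact (abs_add_le _ _).trans (by rw [abs_neg])
  set N := √(∫ x in E.carrier, (I x - U x) ^ 2) with hN
  have hN0 : 0 ≤ N := Real.sqrt_nonneg _
  have h6 : 0 ≤ (1 + Ci) * (Cb * β) * (N / h) := by positivity
  have h7 : 0 ≤ Cv * h ^ s := by positivity
  calc |U x - u x| ≤ Cb * h ^ s * β + Ci * (Cb * h ^ s * β) + Cv / h * N := by linarith
    _ = (1 + Ci) * (Cb * β) * h ^ s + Cv * (N / h) := by ring
    _ ≤ _ := by rw [mul_add, add_mul, add_mul]; linarith

lemma PolyMesh.diam_le_size {Ω : Set E2} (M : PolyMesh Ω) (K : Fin M.card) :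
    (M.elem K).diam ≤ M.size :=
  le_ciSup (Finite.bddAbove_range fun K => (M.elem K).diam) K

lemma PolyMesh.size_nonneg {Ω : Set E2} (M : PolyMesh Ω) : 0 ≤ M.size :=
  Real.iSup_nonneg fun _ => Metric.diam_nonneg

lemma sqrt_le_of_le_sq_add_sq {X C a b : ℝ} (hC : 0 ≤ C) (ha : 0 ≤ a) (hb : 0 ≤ b)
    (h : X ≤ C * (a ^ 2 + b ^ 2)) : √X ≤ √C * (a + b) := by
  refine Real.sqrt_le_iff.2 ⟨by positivity, h.trans ?_⟩
  rw [mul_pow, Real.sq_sqrt hC]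
  refine mul_le_mul_of_nonneg_left ?_ hC
  nlinarith [mul_nonneg ha hb]

end VEM

open VEM
theorem mainTheorem4 {m : ℕ} (Ω : Set E2) (hΩ_open : IsOpen Ω) (hΩ_conn : IsConnected Ω)
    (hΩ_bdd : Bornology.IsBounded Ω) (T : ℝ) (hT : 0 < T)
    (p s : ℕ) (hs : 1 ≤ s) (hsp : s ≤ p)
    (D : Coeffs m) (hD : D.Admissible Ω T)
    (u : Fin m → ℝ → E2 → ℝ) (hu : IsWeakSolution D Ω T u)
    (hu_cont : ∀ i, ∀ t ∈ Icc 0 T, ContinuousOn (u i t) (closure Ω))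
    (hu_reg : ∃ B : ℝ≥0, ∀ i, ∀ t ∈ Icc 0 T, sobolevNorm Ω (s + 1) (u i t) ≤ B)
    (μ : ℝ) (hμ : 0 < μ)
    (hu_bdd : ∀ i, ∀ t ∈ Icc 0 T, eLpNorm (u i t) ∞ (volume.restrict Ω) ≤ ENNReal.ofReal μ)
    (δ c σ : ℝ) (hδ : 0 < δ) (hc : 0 < c) (hσ : 0 < σ)
    (α₁ α₂ β₁ β₂ : ℝ) (hα₁ : 0 < α₁) (hα : α₁ ≤ α₂) (hβ₁ : 0 < β₁) (hβ : β₁ ≤ β₂)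
    (C₀ : ℝ) :
    ∃ C h₀ ρ : ℝ, 0 < C ∧ 0 < h₀ ∧ 0 < ρ ∧
      ∀ M : PolyMesh Ω, M.ShapeRegular δ c → M.QuasiUniform σ →
      ∀ S : Stabilization M, S.Admissible p α₁ α₂ β₁ β₂ →
      ∀ (N : ℕ), 1 ≤ N →
      ∀ U : ℕ → Fin m → E2 → ℝ,
        (IsNonlinearSolution M p S D T N U ∨ IsLinearSolution M p S D T N U) →
      ∀ n ≤ N, ∀ I : Fin m → E2 → ℝ, (∀ i, IsInterpolant M p (u i (n * (T / N))) (I i)) →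
        (∑ i, ∑ K, ∫ x in (M.elem K).carrier, (I i x - U n i x) ^ 2) ≤
          C₀ * (M.size ^ (2 * s) + (T / N) ^ 2) →
        (∀ i, eLpNorm (U n i) ∞ (volume.restrict Ω) ≤
          ENNReal.ofReal (μ + C * (M.size ^ s + M.size ^ (s - 1) + (T / N) / M.size))) ∧
        (2 ≤ s → M.size ≤ h₀ → T / N ≤ ρ * M.size →
          ∀ i, eLpNorm (U n i) ∞ (volume.restrict Ω) ≤ ENNReal.ofReal (μ + 1)) := by
  obtain ⟨B, hB⟩ := hu_reg
  obtain ⟨Ce, hCe, helem⟩ := exists_element_bound hs hsp hδ hc B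
  set A := √(|C₀| + 1) with hA
  have hA0 : 0 < A := Real.sqrt_pos.2 (by positivity)
  set C := Ce * (1 + A / σ) with hC
  have hC0 : 0 < C := by positivity
  refine ⟨C, min 1 (1 / (3 * C)), 1 / (3 * C), hC0, by positivity, by positivity, ?_⟩
  intro M hM hMσ S _ N hN U hU n hn I hI herr
  have hT0 : 0 ≤ T / N := by positivity
  have hN0 : (0 : ℝ) < N := by exact_mod_cast hN
  have ht : (n : ℝ) * (T / N) ∈ Icc 0 T := by
    refine ⟨by positivity, ?_⟩
    have hnN : (n : ℝ) ≤ N := by exact_mod_cast hn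
    calc (n : ℝ) * (T / N) ≤ N * (T / N) := by gcongr
      _ = T := by field_simp
  have hUV : ∀ i, MemV M p (U n i) := fun i => by
    rcases hU with h | h
    · exact h.1 n hn i
    · exact h.1 n hn i
  have hsize := M.size_nonneg
  have hbound : ∀ i, ∀ x ∈ Ω,
      |U n i x| ≤ μ + C * (M.size ^ s + M.size ^ (s - 1) + (T / N) / M.size) := by
    intro i x hx
    obtain ⟨K, hK⟩ := mem_iUnion.1 (M.cover hx)
    obtain ⟨hstar, hedge⟩ := hM K
    obtain ⟨hIV, hIlob, hImom⟩ := hI i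
    have hh := (M.elem K).diam_pos
    have hle := M.diam_le_size K
    have hs0 : 0 < M.size := hh.trans_le hle
    have hcl : closure (M.elem K).carrier ⊆ closure Ω := closure_mono (M.elem_subset K)
    have h1 := helem (M.elem K) Ω (M.elem_subset K) hstar hedge (u i (n * (T / N))) (I i) (U n i)
      ((hu_cont i _ ht).mono hcl) (hB i _ ht) (hIV.2 K) (hIlob K) (hImom K) ((hUV i).2 K) x hK
    have h2 := abs_le_of_eLpNorm_top_le hΩ_open ((hu_cont i _ ht).mono subset_closure) hμ.le
      (hu_bdd i _ ht) x hx
    have hnn : ∀ i K, 0 ≤ ∫ x in (M.elem K).carrier, (I i x - U n i x) ^ 2 := fun i K =>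
      integral_nonneg fun x => sq_nonneg _
    have h3 : ∫ x in (M.elem K).carrier, (I i x - U n i x) ^ 2 ≤
        (|C₀| + 1) * ((M.size ^ s) ^ 2 + (T / N) ^ 2) := by
      calc ∫ x in (M.elem K).carrier, (I i x - U n i x) ^ 2
          ≤ ∑ K, ∫ x in (M.elem K).carrier, (I i x - U n i x) ^ 2 :=
            Finset.single_le_sum (f := fun K => ∫ x in (M.elem K).carrier, (I i x - U n i x) ^ 2)
              (fun K _ => hnn i K) (Finset.mem_univ K)
        _ ≤ ∑ i, ∑ K, ∫ x in (M.elem K).carrier, (I i x - U n i x) ^ 2 :=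
            Finset.single_le_sum (f := fun i => ∑ K, ∫ x in (M.elem K).carrier, (I i x - U n i x) ^ 2)
              (fun i _ => Finset.sum_nonneg fun K _ => hnn i K) (Finset.mem_univ i)
        _ ≤ C₀ * (M.size ^ (2 * s) + (T / N) ^ 2) := herr
        _ ≤ (|C₀| + 1) * (M.size ^ (2 * s) + (T / N) ^ 2) :=
            mul_le_mul_of_nonneg_right (by linarith [le_abs_self C₀]) (by positivity)
        _ = _ := by rw [mul_comm 2 s, pow_mul]
    have h4 := sqrt_le_of_le_sq_add_sq (by positivity) (by positivity) hT0 h3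
    have h5 : √(∫ x in (M.elem K).carrier, (I i x - U n i x) ^ 2) / (M.elem K).diam ≤
        A * (M.size ^ s + T / N) / (σ * M.size) :=
      div_le_div₀ (by positivity) h4 (by positivity) (hMσ K)
    have h6 : A * (M.size ^ s + T / N) / (σ * M.size) =
        A / σ * (M.size ^ (s - 1) + (T / N) / M.size) := by
      obtain ⟨k, rfl⟩ : ∃ k, s = k + 1 := ⟨s - 1, by omega⟩
      rw [Nat.add_sub_cancel, pow_succ]
      field_simp
    have h7 : (M.elem K).diam ^ s ≤ M.size ^ s := pow_le_pow_left₀ hh.le hle s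
    rw [h6] at h5
    have h8 : |U n i x - u i (n * (T / N)) x| ≤
        Ce * (M.size ^ s + A / σ * (M.size ^ (s - 1) + (T / N) / M.size)) :=
      h1.trans (mul_le_mul_of_nonneg_left (add_le_add h7 h5) hCe.le)
    have h9 : |U n i x| ≤ |u i (n * (T / N)) x| + |U n i x - u i (n * (T / N)) x| := by
      have := abs_add_le (u i (n * (T / N)) x) (U n i x - u i (n * (T / N)) x)
      rwa [add_sub_cancel] at this
    have h10 : Ce * (M.size ^ s + A / σ * (M.size ^ (s - 1) + (T / N) / M.size)) ≤
        C * (M.size ^ s + M.size ^ (s - 1) + (T / N) / M.size) := by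
      have e1 : 0 ≤ Ce * (A / σ) * M.size ^ s := by positivity
      have e2 : 0 ≤ Ce * (M.size ^ (s - 1) + (T / N) / M.size) := by positivity
      rw [hC]
      linarith
    linarith
  have hfin : ∀ i (b : ℝ), (∀ x ∈ Ω, |U n i x| ≤ b) →
      eLpNorm (U n i) ∞ (volume.restrict Ω) ≤ ENNReal.ofReal b := by
    intro i b hb
    rw [eLpNorm_exponent_top]
    refine eLpNormEssSup_le_of_ae_bound ?_
    filter_upwards [ae_restrict_mem hΩ_open.measurableSet] with x hx using hb x hx
  refine ⟨fun i => hfin i _ (hbound i), fun hs2 hh₀ hρ i => hfin i _ fun x hx => ?_⟩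
  refine (hbound i x hx).trans ?_
  have hle1 : M.size ≤ 1 := hh₀.trans (min_le_left _ _)
  have hleC : M.size ≤ 1 / (3 * C) := hh₀.trans (min_le_right _ _)
  have e1 : M.size ^ s ≤ M.size := pow_le_of_le_one hsize hle1 (by omega)
  have e2 : M.size ^ (s - 1) ≤ M.size := pow_le_of_le_one hsize hle1 (by omega)
  have e3 : (T / N) / M.size ≤ 1 / (3 * C) := div_le_of_le_mul₀ hsize (by positivity) hρ
  have e4 : M.size ^ s + M.size ^ (s - 1) + (T / N) / M.size ≤ 3 * (1 / (3 * C)) := by linarith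
  have e5 : C * (3 * (1 / (3 * C))) = 1 := by field_simp
  have e6 := mul_le_mul_of_nonneg_left e4 hC0.le
  linarith
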